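/- Let $G$ be a locally compact étale groupoid (not necessarily Hausdorff) whose unit space $G^0$ is Hausdorff; étale means that the topology has a basis of open bisections, i.e. of open sets on which the source and range maps $s,r$ are homeomorphisms onto open subsets of $G^0$. Let $\mathrm{Bis}(G)$ be the inverse semigroup of all open bisections, with unit $G^0$, product $uv=\{gh: g\in u,\ h\in v,\ s(g)=r(h)\}$ and $u^*=\{g^{-1}:g\in u\}$. It acts on $G^0$ canonically: $u\in\mathrm{Bis}(G)$ acts as the homeomorphism $s(u)\to r(u)$, $s(g)\mapsto r(g)$ for $g\in u$. An inverse subsemigroup $S\subseteq\mathrm{Bis}(G)$ is *wide* if $\bigcup_{u\in S}u=G$ and for all $u,v\in S$ and $g\in u\cap v$ there is $w\in S$ with $g\in w\subseteq u\cap v$. $G$ is *topologically amenable* if there is a net $(\eta_i)$ in $C_c(G)$ (the span of the functions on $G$ that are continuous on some open bisection and vanish off a compact subset of it) with $\sup_{x\in G^0}\bigl(\sum_{r(h)=x}|\eta_i(h)|^2\bigr)^{1/2}\le 1$ for all $i$ and $\sum_{r(h)=r(g)}\overline{\eta_i(h)}\,\eta_i(g^{-1}h)\to 1$ uniformly for $g$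 in compact subsets of $G$. Let $S$ be a unital inverse semigroup. A Fell bundle $\mathcal A=(A_s)_{s\in S}$ over $S$ has the *approximation property* if there is a net of finitely supported functions $\xi_i\colon S\to A_1$ with $\xi_i(p)\in A_{pp^*}$ for all $p\in S$ such that $$\sup_i\Bigl\|\sum_{p,t\in S}\xi_i(p)^*\xi_i(t)1_{pt^*}\Bigr\|<\infty\quad\text{and}\quad \sum_{p,t\in S}1_{p(st)^*}\xi_i(p)^*a\,\xi_i(t)\to a\ \text{ in norm, for all } s\in S,\ a\in A_s,$$ where $1_s\in A_1''$ is the unit of the bidual $I_{s,1}''$ of the closed ideal $I_{s,1}\subseteq A_1$ generated by the $A_{v^*v}$ with $v\le s$ and $v\le 1$, and the sums are taken in the biduals $A_1''$ and $A_s''$. An action $\alpha$ of $S$ on a locally compact Hausdorff space $X$ by homeomorphisms between open subsets has the approximation property if its Fell bundle has it; this has the fibres $A_s=C_0(\operatorname{ran}\alpha_s)\subseteq C_0(X)$ with $(f\delta_s)(g\delta_t)=f\cdot(g\circ\alpha_s^{-1})\,\delta_{st}$ and $(f\delta_s)^*=(\overline f\circ\alpha_s)\,\delta_{s^*}$. (If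 a wide $S\subseteq\mathrm{Bis}(G)$ has no unit, the unit $G^0$ is adjoined to it.) Then the following assertions are equivalent: (i) $G$ is topologically amenable; (ii) the canonical action of $\mathrm{Bis}(G)$ on $G^0$ has the approximation property; (iii) for every wide inverse subsemigroup $S\subseteq\mathrm{Bis}(G)$, the canonical action of $S$ on $G^0$ has the approximation property. Moreover, for each single wide inverse subsemigroup $S\subseteq\mathrm{Bis}(G)$, the canonical action of $S$ on $G^0$ has the approximation property if and only if $G$ is topologically amenable. -/

import Mathlib

noncomputable section

open Filter Topology
open scoped ZeroAtInfty ComplexConjugate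

set_option linter.unusedSectionVars false

namespace InvFell

universe u

/-! ### Inverse semigroups with unit -/

/-- An inverse semigroup with unit: every `s` has exactly one generalized inverse, written `s⁻¹`. -/
class InverseMonoid (S : Type u) extends Monoid S, Inv S where
  mul_inv_mul_self : ∀ s : S, s * s⁻¹ * s = s
  inv_mul_inv_self : ∀ s : S, s⁻¹ * s * s⁻¹ = s⁻¹
  inv_unique : ∀ s t : S, s * t * s = s → t * s * t = t → t = s⁻¹

namespace InverseMonoid

variable {S : Type u} [InverseMonoid S]

/-- The natural partial order: `s ≤ t` iff `s = t * e` for some idempotent `e`. -/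
def NatLE (s t : S) : Prop := ∃ e : S, e * e = e ∧ s = t * e

theorem inv_inv_eq (s : S) : s⁻¹⁻¹ = s :=
  (inv_unique s⁻¹ s (inv_mul_inv_self s) (mul_inv_mul_self s)).symm

theorem inv_idem {e : S} (he : e * e = e) : e⁻¹ = e :=
  (inv_unique e e (by rw [he, he]) (by rw [he, he])).symm

theorem idem_mul_idem {e f : S} (he : e * e = e) (hf : f * f = f) :
    (e * f) * (e * f) = e * f := by
  set x := (e * f)⁻¹ with hx
  have h1 : e * f * x * (e * f) = e * f := mul_inv_mul_self _
  have h2 : x * (e * f) * x = x := inv_mul_inv_self _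
  have h3 : f * x * e = x := by
    refine inv_unique _ _ ?_ ?_
    · calc e * f * (f * x * e) * (e * f) = e * (f * f) * x * (e * e) * f := by
            simp only [mul_assoc]
        _ = e * f * x * (e * f) := by rw [he, hf]; simp only [mul_assoc]
        _ = e * f := h1
    · calc f * x * e * (e * f) * (f * x * e) = f * x * (e * e) * (f * f) * x * e := by
            simp only [mul_assoc]
        _ = f * (x * (e * f) * x) * e := by rw [he, hf]; simp only [mul_assoc]
        _ = f * x * e := by rw [h2]
  have h4 : x * x = x := by
    calc x * x = (f * x * e) * (f * x * e) := by rw [h3]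
      _ = f * (x * (e * f) * x) * e := by simp only [mul_assoc]
      _ = x := by rw [h2, h3]
  have h5 : e * f = x := by
    rw [← inv_inv_eq (e * f), ← hx, inv_idem h4]
  rw [h5, h4]

theorem idem_comm {e f : S} (he : e * e = e) (hf : f * f = f) : e * f = f * e := by
  have h1 := idem_mul_idem he hf
  have h2 := idem_mul_idem hf he
  have h3 : f * e = (e * f)⁻¹ := by
    refine inv_unique _ _ ?_ ?_
    · calc e * f * (f * e) * (e * f) = e * (f * f) * (e * e) * f := by simp only [mul_assoc]
        _ = (e * f) * (e * f) := by rw [he, hf]; simp only [mul_assoc]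
        _ = e * f := h1
    · calc f * e * (e * f) * (f * e) = f * (e * e) * (f * f) * e := by simp only [mul_assoc]
        _ = (f * e) * (f * e) := by rw [he, hf]; simp only [mul_assoc]
        _ = f * e := h2
  rw [h3, inv_idem h1]

theorem idem_inv_mul (s : S) : (s⁻¹ * s) * (s⁻¹ * s) = s⁻¹ * s := by
  rw [← mul_assoc, inv_mul_inv_self]

theorem idem_mul_inv (s : S) : (s * s⁻¹) * (s * s⁻¹) = s * s⁻¹ := by
  rw [← mul_assoc, mul_inv_mul_self]

theorem idem_conj {e : S} (he : e * e = e) (t : S) :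
    (t⁻¹ * e * t) * (t⁻¹ * e * t) = t⁻¹ * e * t := by
  calc (t⁻¹ * e * t) * (t⁻¹ * e * t) = t⁻¹ * (e * (t * t⁻¹)) * e * t := by
        simp only [mul_assoc]
    _ = t⁻¹ * ((t * t⁻¹) * e) * e * t := by rw [idem_comm he (idem_mul_inv t)]
    _ = (t⁻¹ * t * t⁻¹) * (e * e) * t := by simp only [mul_assoc]
    _ = t⁻¹ * e * t := by rw [inv_mul_inv_self, he]

theorem idem_mul_eq {e : S} (he : e * e = e) (t : S) : e * t = t * (t⁻¹ * e * t) := by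
  calc e * t = e * (t * t⁻¹ * t) := by rw [mul_inv_mul_self]
    _ = (e * (t * t⁻¹)) * t := by simp only [mul_assoc]
    _ = ((t * t⁻¹) * e) * t := by rw [idem_comm he (idem_mul_inv t)]
    _ = t * (t⁻¹ * e * t) := by simp only [mul_assoc]

theorem mul_inv_eq (s t : S) : (s * t)⁻¹ = t⁻¹ * s⁻¹ := by
  have hc := idem_comm (idem_mul_inv t) (idem_inv_mul s)
  refine (inv_unique _ _ ?_ ?_).symm
  · calc s * t * (t⁻¹ * s⁻¹) * (s * t) = s * ((t * t⁻¹) * (s⁻¹ * s)) * t := by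
          simp only [mul_assoc]
      _ = (s * s⁻¹ * s) * (t * t⁻¹ * t) := by rw [hc]; simp only [mul_assoc]
      _ = s * t := by rw [mul_inv_mul_self, mul_inv_mul_self]
  · calc t⁻¹ * s⁻¹ * (s * t) * (t⁻¹ * s⁻¹) = t⁻¹ * ((s⁻¹ * s) * (t * t⁻¹)) * s⁻¹ := by
          simp only [mul_assoc]
      _ = (t⁻¹ * t * t⁻¹) * (s⁻¹ * s * s⁻¹) := by rw [← hc]; simp only [mul_assoc]
      _ = t⁻¹ * s⁻¹ := by rw [inv_mul_inv_self, inv_mul_inv_self]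

theorem natLE_of_eq {s t : S} (h : s = t) : NatLE s t := ⟨1, by simp, by simp [h]⟩

theorem natLE_trans {r s t : S} (h : NatLE r s) (h' : NatLE s t) : NatLE r t := by
  obtain ⟨e, he, rfl⟩ := h
  obtain ⟨f, hf, rfl⟩ := h'
  exact ⟨f * e, idem_mul_idem hf he, mul_assoc _ _ _⟩

theorem natLE_mul {s s' t t' : S} (h : NatLE s s') (h' : NatLE t t') :
    NatLE (s * t) (s' * t') := by
  obtain ⟨e, he, rfl⟩ := h
  obtain ⟨f, hf, rfl⟩ := h'
  refine ⟨(t'⁻¹ * e * t') * f, idem_mul_idem (idem_conj he _) hf, ?_⟩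
  calc s' * e * (t' * f) = s' * (e * t') * f := by simp only [mul_assoc]
    _ = s' * (t' * (t'⁻¹ * e * t')) * f := by rw [← idem_mul_eq he]
    _ = s' * t' * (t'⁻¹ * e * t' * f) := by simp only [mul_assoc]

theorem natLE_inv {s t : S} (h : NatLE s t) : NatLE s⁻¹ t⁻¹ := by
  obtain ⟨e, he, rfl⟩ := h
  exact ⟨t⁻¹⁻¹ * e * t⁻¹, idem_conj he _, by rw [mul_inv_eq, inv_idem he, idem_mul_eq he]⟩

theorem idem_natLE_one {e : S} (he : e * e = e) : NatLE e 1 := ⟨e, he, (one_mul e).symm⟩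

end InverseMonoid

open InverseMonoid

/-- A unital inverse subsemigroup (same unit) of an inverse semigroup with unit. -/
structure InverseSubmonoid (M : Type u) [InverseMonoid M] extends Submonoid M where
  inv_mem : ∀ s ∈ carrier, s⁻¹ ∈ carrier

/-- The elements of an inverse subsemigroup, as a type. -/
def InverseSubmonoid.Elem {M : Type u} [InverseMonoid M] (S : InverseSubmonoid M) : Type u :=
  S.toSubmonoid

instance {M : Type u} [InverseMonoid M] (S : InverseSubmonoid M) : InverseMonoid S.Elem where
  toMonoid := inferInstanceAs (Monoid S.toSubmonoid)
  inv s := ⟨s.1⁻¹, S.inv_mem _ s.2⟩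
  mul_inv_mul_self s := Subtype.ext (mul_inv_mul_self s.1)
  inv_mul_inv_self s := Subtype.ext (inv_mul_inv_self s.1)
  inv_unique s t h h' := Subtype.ext
    (inv_unique s.1 t.1 (congrArg Subtype.val h) (congrArg Subtype.val h'))

/-- An inverse subsemigroup of an inverse semigroup, with or without the unit. -/
structure InverseSubsemigroup (M : Type u) [InverseMonoid M] extends Subsemigroup M where
  inv_mem : ∀ s ∈ carrier, s⁻¹ ∈ carrier

/-- `S ∪ {1}`; this is `S` itself if `S` contains the unit. -/
def InverseSubsemigroup.unitize {M : Type u} [InverseMonoid M] (S : InverseSubsemigroup M) :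
    InverseSubmonoid M where
  carrier := {s | s = 1 ∨ s ∈ S.carrier}
  one_mem' := Or.inl rfl
  mul_mem' := by
    rintro s t (rfl | hs) (rfl | ht)
    · exact Or.inl (one_mul 1)
    · exact Or.inr (by rwa [one_mul])
    · exact Or.inr (by rwa [mul_one])
    · exact Or.inr (S.mul_mem' hs ht)
  inv_mem := by
    rintro s (rfl | hs)
    · exact Or.inl (inv_idem (mul_one 1))
    · exact Or.inr (S.inv_mem s hs)

/-! ### Fell bundles over inverse semigroups -/

/-- A (not necessarily saturated) Fell bundle over a unital inverse semigroup `S`: Banach spaces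
`A_s`, multiplications `A_s × A_t → A_{st}`, involutions `A_s → A_{s*}` and inclusions
`A_s ⊆ A_t` for `s ≤ t`. Since `s = t` implies `s ≤ t`, the inclusions also serve to identify
fibres over equal elements. Positivity of `a* a` in the `C*`-algebra `A_{s* s}` is expressed as
`a* a = c* c` with `c ∈ A_{s* s}`. -/
structure FellBundle (S : Type u) [InverseMonoid S] where
  Fib : S → Type u
  [normed : ∀ s, NormedAddCommGroup (Fib s)]
  [space : ∀ s, NormedSpace ℂ (Fib s)]
  [complete : ∀ s, CompleteSpace (Fib s)]
  mul : ∀ {s t : S}, Fib s →ₗ[ℂ] Fib t →ₗ[ℂ] Fib (s * t)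
  star : ∀ {s : S}, Fib s →ₗ⋆[ℂ] Fib s⁻¹
  incl : ∀ {s t : S}, NatLE s t → Fib s →ₗᵢ[ℂ] Fib t
  norm_mul_le : ∀ {s t : S} (a : Fib s) (b : Fib t), ‖mul a b‖ ≤ ‖a‖ * ‖b‖
  mul_assoc : ∀ {s t r : S} (a : Fib s) (b : Fib t) (c : Fib r),
    incl (natLE_of_eq (_root_.mul_assoc s t r)) (mul (mul a b) c) = mul a (mul b c)
  norm_star : ∀ {s : S} (a : Fib s), ‖star a‖ = ‖a‖
  star_star : ∀ {s : S} (a : Fib s), incl (natLE_of_eq (inv_inv_eq s)) (star (star a)) = a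
  star_mul : ∀ {s t : S} (a : Fib s) (b : Fib t),
    incl (natLE_of_eq (mul_inv_eq s t)) (star (mul a b)) = mul (star b) (star a)
  norm_star_mul_self : ∀ {s : S} (a : Fib s), ‖mul (star a) a‖ = ‖a‖ ^ 2
  star_mul_self_pos : ∀ {s : S} (a : Fib s), ∃ c : Fib (s⁻¹ * s),
    mul (star a) a = incl (natLE_of_eq (by rw [inv_idem (idem_inv_mul s), idem_inv_mul s]))
      (mul (star c) c)
  incl_refl : ∀ {s : S} (a : Fib s), incl (natLE_of_eq rfl) a = a
  incl_trans : ∀ {r s t : S} (h : NatLE r s) (h' : NatLE s t) (a : Fib r),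
    incl h' (incl h a) = incl (natLE_trans h h') a
  incl_mul : ∀ {s s' t t' : S} (h : NatLE s s') (h' : NatLE t t') (a : Fib s) (b : Fib t),
    mul (incl h a) (incl h' b) = incl (natLE_mul h h') (mul a b)
  incl_star : ∀ {s t : S} (h : NatLE s t) (a : Fib s),
    star (incl h a) = incl (natLE_inv h) (star a)

attribute [instance] FellBundle.normed FellBundle.space FellBundle.complete

/-! ### Biduals -/

/-- The bidual `E''` of a Banach space `E`; for a `C*`-algebra, with the product `arens`, it is the
enveloping von Neumann algebra. -/
abbrev Bidual (E : Type u) [NormedAddCommGroup E] [NormedSpace ℂ E] : Type u :=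
  StrongDual ℂ (StrongDual ℂ E)

/-- The canonical embedding `E ⊆ E''`. -/
abbrev toBidual {E : Type u} [NormedAddCommGroup E] [NormedSpace ℂ E] (a : E) : Bidual E :=
  NormedSpace.inclusionInDoubleDual ℂ E a

/-- The canonical extension `E'' × F'' → H''` of a bounded bilinear map `m : E × F → H`, given by
`(x ⬝ y)(φ) = x (a ↦ y (b ↦ φ (m a b)))`. -/
def arens {E F H : Type u} [NormedAddCommGroup E] [NormedSpace ℂ E] [NormedAddCommGroup F]
    [NormedSpace ℂ F] [NormedAddCommGroup H] [NormedSpace ℂ H]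
    (m : E →L[ℂ] F →L[ℂ] H) (x : Bidual E) (y : Bidual F) : Bidual H :=
  x ∘L (ContinuousLinearMap.compL ℂ E (StrongDual ℂ F) ℂ y) ∘L
    ((ContinuousLinearMap.compL ℂ E (F →L[ℂ] H) (StrongDual ℂ F)).flip m) ∘L
      (ContinuousLinearMap.compL ℂ F H ℂ)

theorem arens_apply {E F H : Type u} [NormedAddCommGroup E] [NormedSpace ℂ E]
    [NormedAddCommGroup F] [NormedSpace ℂ F] [NormedAddCommGroup H] [NormedSpace ℂ H]
    (m : E →L[ℂ] F →L[ℂ] H) (x : Bidual E) (y : Bidual F) (φ : StrongDual ℂ H) :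
    arens m x y φ = x (y ∘L (ContinuousLinearMap.compL ℂ F H ℂ φ) ∘L m) := rfl

namespace FellBundle

variable {S : Type u} [InverseMonoid S] (A : FellBundle S)

/-- The multiplication of a Fell bundle as a bounded bilinear map. -/
def mulL (s t : S) : A.Fib s →L[ℂ] A.Fib t →L[ℂ] A.Fib (s * t) :=
  A.mul.mkContinuous₂ 1 fun a b => by simpa using A.norm_mul_le a b

/-- The left multiplication `A_1 × A_s → A_s`; for `s = 1` it is the product of `A_1`. -/
def lmul (s : S) : A.Fib 1 →L[ℂ] A.Fib s →L[ℂ] A.Fib s :=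
  ContinuousLinearMap.compL ℂ (A.Fib s) (A.Fib (1 * s)) (A.Fib s)
    (A.incl (natLE_of_eq (one_mul s))).toContinuousLinearMap ∘L A.mulL 1 s

/-- The right multiplication `A_s × A_1 → A_s`. -/
def rmul (s : S) : A.Fib s →L[ℂ] A.Fib 1 →L[ℂ] A.Fib s :=
  ContinuousLinearMap.compL ℂ (A.Fib 1) (A.Fib (s * 1)) (A.Fib s)
    (A.incl (natLE_of_eq (mul_one s))).toContinuousLinearMap ∘L A.mulL s 1

/-- The involution of the `C*`-algebra `A_1`. -/
def starOne (a : A.Fib 1) : A.Fib 1 :=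
  A.incl (natLE_of_eq (inv_idem (mul_one 1))) (A.star a)

/-- The ideal `A_e`, for an idempotent `e`, as a subspace of `A_1`. -/
def idemIdeal (e : S) (he : e * e = e) : Submodule ℂ (A.Fib 1) :=
  LinearMap.range (A.incl (idem_natLE_one he)).toLinearMap

/-- `I_{s,t}`: the closed two-sided ideal of `A_1` generated by the `A_{v* v}` with `v ≤ s, t`. -/
def idealOf (s t : S) : Submodule ℂ (A.Fib 1) :=
  sInf {J | IsClosed (J : Set (A.Fib 1)) ∧
    (∀ a : A.Fib 1, ∀ b ∈ J, A.lmul 1 a b ∈ J ∧ A.lmul 1 b a ∈ J) ∧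
    ∀ v : S, NatLE v s → NatLE v t → A.idemIdeal (v⁻¹ * v) (idem_inv_mul v) ≤ J}

/-- `J'' ⊆ A_1''`, the bidual (bipolar, i.e. weak-star closure) of a subspace `J` of `A_1`. -/
def bidualOf (J : Submodule ℂ (A.Fib 1)) : Set (Bidual (A.Fib 1)) :=
  {x | ∀ φ : StrongDual ℂ (A.Fib 1), (∀ b ∈ J, φ b = 0) → x φ = 0}

/-- `e` is the unit of `J''`. -/
def IsUnitOf (J : Submodule ℂ (A.Fib 1)) (e : Bidual (A.Fib 1)) : Prop :=
  e ∈ A.bidualOf J ∧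
    ∀ x ∈ A.bidualOf J, arens (A.lmul 1) e x = x ∧ arens (A.lmul 1) x e = x

theorem IsUnitOf.unique {J : Submodule ℂ (A.Fib 1)} {e f : Bidual (A.Fib 1)}
    (he : A.IsUnitOf J e) (hf : A.IsUnitOf J f) : e = f :=
  (hf.2 e he.1).2.symm.trans (he.2 f hf.1).1

open Classical in
/-- `1_s`, the unit of the von Neumann algebra `I_{s,1}''` (it exists, since `I_{s,1}` is a closed
ideal of a `C*`-algebra, and it is unique). -/
def unitProj (s : S) : Bidual (A.Fib 1) :=
  if h : ∃ e, A.IsUnitOf (A.idealOf s 1) e then h.choose else 0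

/-- `Γ_c(S, A)`: finitely supported `ξ : S → A_1` with `ξ(p) ∈ A_{p p*}`. -/
def sections : Set (S →₀ A.Fib 1) :=
  {ξ | ∀ p, ξ p ∈ A.idemIdeal (p * p⁻¹) (idem_mul_inv p)}

/-- The approximation property of a Fell bundle over a unital inverse semigroup. -/
def ApproximationProperty : Prop :=
  ∃ (I : Type u) (_ : Preorder I) (_ : IsDirectedOrder I) (_ : Nonempty I)
    (ξ : I → S →₀ A.Fib 1),
    (∀ i, ξ i ∈ A.sections) ∧
    (∃ C : ℝ, ∀ i, ‖∑ p ∈ (ξ i).support, ∑ t ∈ (ξ i).support,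
      arens (A.lmul 1) (toBidual (A.lmul 1 (A.starOne (ξ i p)) (ξ i t)))
        (A.unitProj (p * t⁻¹))‖ ≤ C) ∧
    ∀ (s : S) (a : A.Fib s), Tendsto (fun i => ∑ p ∈ (ξ i).support, ∑ t ∈ (ξ i).support,
      arens (A.lmul s) (A.unitProj (p * (s * t)⁻¹))
        (toBidual (A.rmul s (A.lmul s (A.starOne (ξ i p)) a) (ξ i t))))
      atTop (𝓝 (toBidual a))

end FellBundle

/-! ### Actions on spaces and their Fell bundles -/

/-- An action of a unital inverse semigroup on a space by homeomorphisms between open subsets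
(`≈` is equality of partial homeomorphisms: same source, same values there). -/
structure PartialAction (S : Type u) [InverseMonoid S] (X : Type u) [TopologicalSpace X] where
  act : S → OpenPartialHomeomorph X X
  act_one : act 1 ≈ OpenPartialHomeomorph.refl X
  act_mul : ∀ s t, act (s * t) ≈ (act t).trans (act s)
  act_inv : ∀ s, act s⁻¹ ≈ (act s).symm

/-- Restriction of an action to an inverse subsemigroup. -/
def PartialAction.restrict {M : Type u} [InverseMonoid M] {X : Type u} [TopologicalSpace X]
    (α : PartialAction M X) (S : InverseSubmonoid M) : PartialAction S.Elem X where
  act s := α.act s.1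
  act_one := α.act_one
  act_mul s t := α.act_mul s.1 t.1
  act_inv s := α.act_inv s.1

namespace PartialAction

variable {S : Type u} [InverseMonoid S] {X : Type u} [TopologicalSpace X] (α : PartialAction S X)

theorem source_inv (s : S) : (α.act s⁻¹).source = (α.act s).target := (α.act_inv s).source_eq

theorem target_inv (s : S) : (α.act s⁻¹).target = (α.act s).source := (α.act_inv s).target_eq

theorem act_inv_apply (s : S) {x : X} (hx : x ∈ (α.act s).target) :
    α.act s⁻¹ x = (α.act s).symm x :=
  (α.act_inv s).eqOn (by rwa [source_inv])

theorem act_inv_symm_apply (s : S) {x : X} (hx : x ∈ (α.act s).source) :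
    (α.act s⁻¹).symm x = α.act s x := by
  have := (α.act_inv s).symm_eqOn_target (x := x) (by rwa [target_inv])
  simpa using this

theorem mem_source_mul (s t : S) (x : X) : x ∈ (α.act (s * t)).source ↔
    x ∈ (α.act t).source ∧ α.act t x ∈ (α.act s).source := by
  rw [(α.act_mul s t).source_eq, OpenPartialHomeomorph.trans_source]; rfl

theorem act_mul_apply (s t : S) {x : X} (hx : x ∈ (α.act (s * t)).source) :
    α.act (s * t) x = α.act s (α.act t x) := (α.act_mul s t).eqOn hx

theorem mem_target_mul (s t : S) (x : X) : x ∈ (α.act (s * t)).target ↔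
    x ∈ (α.act s).target ∧ (α.act s).symm x ∈ (α.act t).target := by
  rw [(α.act_mul s t).target_eq, OpenPartialHomeomorph.trans_target]; rfl

theorem act_mul_symm_apply (s t : S) {x : X} (hx : x ∈ (α.act (s * t)).target) :
    (α.act (s * t)).symm x = (α.act t).symm ((α.act s).symm x) :=
  (α.act_mul s t).symm_eqOn_target hx

theorem act_idem {e : S} (he : e * e = e) {x : X} (hx : x ∈ (α.act e).source) :
    α.act e x = x := by
  have hx' : x ∈ (α.act (e * e)).source := by rwa [he]
  have h1 := (α.mem_source_mul e e x).1 hx'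
  have h2 := α.act_mul_apply e e hx'
  rw [he] at h2
  exact (α.act e).injOn h1.2 hx h2.symm

theorem natLE_source {s t : S} (h : NatLE s t) {x : X} (hx : x ∈ (α.act s).source) :
    x ∈ (α.act t).source ∧ α.act t x = α.act s x := by
  obtain ⟨e, he, rfl⟩ := h
  have h1 := (α.mem_source_mul t e x).1 hx
  have h2 := α.act_mul_apply t e hx
  rw [α.act_idem he h1.1] at h1 h2
  exact ⟨h1.2, h2.symm⟩

theorem natLE_target {s t : S} (h : NatLE s t) {x : X} (hx : x ∈ (α.act s).target) :
    x ∈ (α.act t).target ∧ (α.act t).symm x = (α.act s).symm x := by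
  have h1 := (α.act s).map_target hx
  obtain ⟨h2, h3⟩ := α.natLE_source h h1
  rw [(α.act s).right_inv hx] at h3
  constructor
  · rw [← h3]; exact (α.act t).map_source h2
  · conv_lhs => rw [← h3]
    exact (α.act t).left_inv h2

end PartialAction

section C0

variable {X : Type u} [TopologicalSpace X]

theorem c0_norm_le (f : C₀(X, ℂ)) (x : X) : ‖f x‖ ≤ ‖f‖ := by
  rw [← ZeroAtInftyContinuousMap.norm_toBCF_eq_norm]
  exact f.toBCF.norm_coe_le_norm x

theorem c0_norm_le_of (f : C₀(X, ℂ)) {C : ℝ} (hC : 0 ≤ C) (h : ∀ x, ‖f x‖ ≤ C) : ‖f‖ ≤ C := by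
  rw [← ZeroAtInftyContinuousMap.norm_toBCF_eq_norm]
  exact (BoundedContinuousFunction.norm_le hC).2 h

theorem c0_compact (f : C₀(X, ℂ)) {ε : ℝ} (hε : 0 < ε) : IsCompact {x | ε ≤ ‖f x‖} := by
  have h1 : Tendsto (fun x => ‖f x‖) (cocompact X) (𝓝 0) := by
    simpa using (zero_at_infty f).norm
  have h2 : ∀ᶠ x in cocompact X, ‖f x‖ < ε := h1.eventually (gt_mem_nhds hε)
  obtain ⟨K, hK, hKs⟩ := mem_cocompact.1 h2
  refine hK.of_isClosed_subset (isClosed_le continuous_const (map_continuous f).norm) ?_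
  intro x hx
  by_contra hxK
  have h3 : ‖f x‖ < ε := hKs hxK
  exact absurd hx (not_le.2 h3)

/-- The function `|f|`. -/
def absC0 (f : C₀(X, ℂ)) : C₀(X, ℂ) where
  toFun x := (‖f x‖ : ℂ)
  continuous_toFun := Complex.continuous_ofReal.comp (map_continuous f).norm
  zero_at_infty' := by
    have h1 : Tendsto (fun x => ‖f x‖) (cocompact X) (𝓝 0) := by
      simpa using (zero_at_infty f).norm
    have h2 := (Complex.continuous_ofReal.tendsto 0).comp h1
    rw [Complex.ofReal_zero] at h2
    exact h2

/-- `f · (g ∘ e⁻¹)`, extended by zero, for `f` vanishing off the target of `e`. -/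
def twistMul (e : OpenPartialHomeomorph X X) (f g : C₀(X, ℂ)) (hf : ∀ x ∉ e.target, f x = 0) :
    C₀(X, ℂ) where
  toFun x := f x * g (e.symm x)
  continuous_toFun := by
    rw [continuous_iff_continuousAt]
    intro x
    by_cases hx : x ∈ e.target
    · exact (map_continuous f).continuousAt.mul
        ((map_continuous g).continuousAt.comp (e.continuousAt_symm hx))
    · change Tendsto _ _ (𝓝 (f x * g (e.symm x)))
      rw [hf x hx, zero_mul]
      refine squeeze_zero_norm (a := fun y => ‖f y‖ * ‖g‖) (fun y => ?_) ?_
      · rw [norm_mul]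
        exact mul_le_mul_of_nonneg_left (c0_norm_le g _) (norm_nonneg _)
      · have h1 : Tendsto (fun y => ‖f y‖ * ‖g‖) (𝓝 x) (𝓝 (‖f x‖ * ‖g‖)) :=
          ((map_continuous f).norm.mul continuous_const).continuousAt
        simpa [hf x hx] using h1
  zero_at_infty' := by
    refine squeeze_zero_norm (a := fun y => ‖f y‖ * ‖g‖) (fun y => ?_) ?_
    · rw [norm_mul]
      exact mul_le_mul_of_nonneg_left (c0_norm_le g _) (norm_nonneg _)
    · simpa using ((zero_at_infty f).norm).mul_const ‖g‖

open Classical in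
/-- `f ∘ e` on the source of `e`, extended by zero, for `f` vanishing off the target of `e`. -/
def pullC0 [T2Space X] (e : OpenPartialHomeomorph X X) (f : C₀(X, ℂ))
    (hf : ∀ x ∉ e.target, f x = 0) : C₀(X, ℂ) :=
  have key : ∀ ε : ℝ, 0 < ε → ∃ K : Set X, IsCompact K ∧ K ⊆ e.source ∧
      ∀ x ∉ K, ‖if x ∈ e.source then f (e x) else 0‖ < ε := fun ε hε => by
    have hsub : {x | ε ≤ ‖f x‖} ⊆ e.target := by
      intro x hx
      by_contra h
      have hx' : ε ≤ ‖f x‖ := hx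
      rw [hf x h, norm_zero] at hx'
      linarith
    refine ⟨e.symm '' {x | ε ≤ ‖f x‖}, (c0_compact f hε).image_of_continuousOn
      (e.continuousOn_symm.mono hsub), ?_, ?_⟩
    · rintro _ ⟨x, hx, rfl⟩
      exact e.map_target (hsub hx)
    · intro x hx
      split_ifs with h
      · by_contra hlt
        exact hx ⟨e x, not_lt.1 hlt, e.left_inv h⟩
      · simpa using hε
  { toFun := fun x => if x ∈ e.source then f (e x) else 0
    continuous_toFun := by
      rw [continuous_iff_continuousAt]
      intro x
      by_cases hx : x ∈ e.source
      · have h1 : ContinuousAt (fun y => f (e y)) x :=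
          (map_continuous f).continuousAt.comp (e.continuousAt hx)
        refine h1.congr ?_
        filter_upwards [e.open_source.mem_nhds hx] with y hy
        rw [if_pos hy]
      · change Tendsto _ _ (𝓝 (if x ∈ e.source then f (e x) else 0))
        rw [if_neg hx, Metric.tendsto_nhds]
        intro ε hε
        obtain ⟨K, hK, hKs, hK'⟩ := key ε hε
        filter_upwards [hK.isClosed.isOpen_compl.mem_nhds (fun h => hx (hKs h))] with y hy
        rw [dist_zero_right]
        exact hK' y hy
    zero_at_infty' := by
      rw [Metric.tendsto_nhds]
      intro ε hε
      obtain ⟨K, hK, hKs, hK'⟩ := key ε hε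
      filter_upwards [hK.compl_mem_cocompact] with y hy
      rw [dist_zero_right]
      exact hK' y hy }

theorem absC0_apply (f : C₀(X, ℂ)) (x : X) : absC0 f x = (‖f x‖ : ℂ) := rfl

theorem twistMul_apply (e : OpenPartialHomeomorph X X) (f g : C₀(X, ℂ))
    (hf : ∀ x ∉ e.target, f x = 0) (x : X) : twistMul e f g hf x = f x * g (e.symm x) := rfl

theorem pullC0_of_mem [T2Space X] (e : OpenPartialHomeomorph X X) (f : C₀(X, ℂ))
    (hf : ∀ x ∉ e.target, f x = 0) {x : X} (hx : x ∈ e.source) :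
    pullC0 e f hf x = f (e x) := if_pos hx

theorem pullC0_of_not_mem [T2Space X] (e : OpenPartialHomeomorph X X) (f : C₀(X, ℂ))
    (hf : ∀ x ∉ e.target, f x = 0) {x : X} (hx : x ∉ e.source) :
    pullC0 e f hf x = 0 := if_neg hx

theorem c0_isClosed_vanishing (U : Set X) :
    IsClosed {f : C₀(X, ℂ) | ∀ x ∉ U, f x = 0} := by
  have hc : ∀ x : X, Continuous fun f : C₀(X, ℂ) => f x := fun x => by
    refine (LipschitzWith.of_dist_le_mul (K := 1) fun f g => ?_).continuous
    rw [dist_eq_norm, dist_eq_norm, NNReal.coe_one, one_mul]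
    exact c0_norm_le (f - g) x
  have h : {f : C₀(X, ℂ) | ∀ x ∉ U, f x = 0} = ⋂ x ∈ Uᶜ, {f : C₀(X, ℂ) | f x = 0} := by
    ext f; simp
  rw [h]
  exact isClosed_biInter fun x _ => isClosed_eq (hc x) continuous_const

/-- `C_0(U) ⊆ C_0(X)`: the functions vanishing off `U`. -/
def c0Sub (U : Set X) : Submodule ℂ C₀(X, ℂ) where
  carrier := {f | ∀ x ∉ U, f x = 0}
  add_mem' hf hg x hx := by simp [hf x hx, hg x hx]
  zero_mem' x _ := rfl
  smul_mem' c f hf x hx := by simp [hf x hx]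

theorem mem_c0Sub {U : Set X} {f : C₀(X, ℂ)} : f ∈ c0Sub U ↔ ∀ x ∉ U, f x = 0 := Iff.rfl

theorem c0Sub_vanish {U : Set X} (f : c0Sub U) : ∀ x ∉ U, f.1 x = 0 := f.2

theorem c0Sub_norm {U : Set X} (f : c0Sub U) : ‖f‖ = ‖f.1‖ := rfl

theorem c0Sub_norm_nonneg {U : Set X} (f : c0Sub U) : 0 ≤ ‖f‖ := norm_nonneg f.1

theorem completeSpace_c0Sub (U : Set X) : CompleteSpace (c0Sub U) :=
  IsComplete.completeSpace_coe (s := (c0Sub U : Set C₀(X, ℂ)))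
    (c0_isClosed_vanishing U).isComplete

theorem c0Sub_ext {U : Set X} {f g : c0Sub U} (h : ∀ x, f.1 x = g.1 x) : f = g :=
  Subtype.ext (ZeroAtInftyContinuousMap.ext h)

end C0

namespace PartialAction

variable {S : Type u} [InverseMonoid S] {X : Type u} [TopologicalSpace X]

/-- The multiplication `C_0(X_{s s*}) × C_0(X_{t t*}) → C_0(X_{st (st)*})`. -/
def fibMul (α : PartialAction S X) (s t : S) (f : c0Sub (α.act s).target)
    (g : c0Sub (α.act t).target) : c0Sub (α.act (s * t)).target :=
  ⟨twistMul (α.act s) f.1 g.1 (c0Sub_vanish f), mem_c0Sub.2 fun x hx => by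
    rw [twistMul_apply]
    by_cases h : x ∈ (α.act s).target
    · rw [c0Sub_vanish g _ (fun h' => hx ((α.mem_target_mul s t x).2 ⟨h, h'⟩)), mul_zero]
    · rw [c0Sub_vanish f x h, zero_mul]⟩

theorem fibMul_apply (α : PartialAction S X) (s t : S) (f : c0Sub (α.act s).target)
    (g : c0Sub (α.act t).target) (x : X) :
    (α.fibMul s t f g).1 x = f.1 x * g.1 ((α.act s).symm x) := rfl

theorem norm_fibMul_le (α : PartialAction S X) {s t : S} (f : c0Sub (α.act s).target)
    (g : c0Sub (α.act t).target) : ‖α.fibMul s t f g‖ ≤ ‖f‖ * ‖g‖ := by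
  rw [c0Sub_norm, c0Sub_norm, c0Sub_norm]
  refine c0_norm_le_of _ (by positivity) fun x => ?_
  rw [fibMul_apply, norm_mul]
  exact mul_le_mul (c0_norm_le _ _) (c0_norm_le _ _) (norm_nonneg _) (norm_nonneg _)

variable [T2Space X]

/-- The involution `C_0(X_{s s*}) → C_0(X_{s* s})`. -/
def fibStar (α : PartialAction S X) (s : S) (f : c0Sub (α.act s).target) :
    c0Sub (α.act s⁻¹).target :=
  ⟨Star.star (pullC0 (α.act s) f.1 (c0Sub_vanish f)), mem_c0Sub.2 fun x hx => by
    rw [α.target_inv] at hx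
    rw [ZeroAtInftyContinuousMap.star_apply, pullC0_of_not_mem _ _ _ hx, star_zero]⟩

theorem fibStar_of_mem (α : PartialAction S X) (s : S) (f : c0Sub (α.act s).target) {x : X}
    (hx : x ∈ (α.act s).source) : (α.fibStar s f).1 x = conj (f.1 (α.act s x)) := by
  change Star.star (pullC0 (α.act s) f.1 (c0Sub_vanish f) x) = _
  rw [pullC0_of_mem _ _ _ hx]; rfl

theorem fibStar_of_not_mem (α : PartialAction S X) (s : S) (f : c0Sub (α.act s).target) {x : X}
    (hx : x ∉ (α.act s).source) : (α.fibStar s f).1 x = 0 :=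
  c0Sub_vanish (α.fibStar s f) x (by rwa [α.target_inv])

theorem norm_fibStar_le (α : PartialAction S X) {s : S} (f : c0Sub (α.act s).target) :
    ‖α.fibStar s f‖ ≤ ‖f‖ := by
  rw [c0Sub_norm, c0Sub_norm]
  refine c0_norm_le_of _ (norm_nonneg _) fun x => ?_
  by_cases hx : x ∈ (α.act s).source
  · rw [α.fibStar_of_mem s f hx, RCLike.norm_conj]
    exact c0_norm_le _ _
  · rw [α.fibStar_of_not_mem s f hx, norm_zero]
    exact norm_nonneg _

theorem le_norm_fibStar_mul (α : PartialAction S X) {s : S} (f : c0Sub (α.act s).target) :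
    ‖f‖ ^ 2 ≤ ‖α.fibMul s⁻¹ s (α.fibStar s f) f‖ := by
  have h : ‖f‖ ≤ Real.sqrt ‖α.fibMul s⁻¹ s (α.fibStar s f) f‖ := by
    rw [c0Sub_norm f]
    refine c0_norm_le_of _ (Real.sqrt_nonneg _) fun x => ?_
    by_cases hx : x ∈ (α.act s).target
    · have hy := (α.act s).map_target hx
      refine Real.le_sqrt_of_sq_le ?_
      have := c0_norm_le (α.fibMul s⁻¹ s (α.fibStar s f) f).1 ((α.act s).symm x)
      rw [fibMul_apply, α.fibStar_of_mem s f hy, α.act_inv_symm_apply s hy,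
        (α.act s).right_inv hx, norm_mul, RCLike.norm_conj, ← sq] at this
      exact this
    · rw [c0Sub_vanish f x hx, norm_zero]
      exact Real.sqrt_nonneg _
  calc ‖f‖ ^ 2 ≤ Real.sqrt ‖α.fibMul s⁻¹ s (α.fibStar s f) f‖ ^ 2 :=
        pow_le_pow_left₀ (c0Sub_norm_nonneg _) h 2
    _ = _ := Real.sq_sqrt (c0Sub_norm_nonneg _)

/-- The Fell bundle of an action `α` of `S` on `X`: the fibre over `s` is
`C_0(X_{s s*}) ⊆ C_0(X)`, where `X_{s s*}` is the range of `α_s`, with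
`(f δ_s)(g δ_t) = f · (g ∘ α_s⁻¹) δ_{st}` and `(f δ_s)* = (conj f ∘ α_s) δ_{s*}`. -/
def fellBundle (α : PartialAction S X) : FellBundle S where
  Fib s := c0Sub (α.act s).target
  complete s := completeSpace_c0Sub _
  mul {s t} := LinearMap.mk₂ ℂ (α.fibMul s t)
    (fun f f' g => c0Sub_ext fun x => by
      rw [fibMul_apply]; exact add_mul (f.1 x) (f'.1 x) _)
    (fun c f g => c0Sub_ext fun x => by
      rw [fibMul_apply]; exact smul_mul_assoc c (f.1 x) _)
    (fun f g g' => c0Sub_ext fun x => by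
      rw [fibMul_apply]; exact mul_add (f.1 x) _ _)
    (fun c f g => c0Sub_ext fun x => by
      rw [fibMul_apply]; exact mul_smul_comm c (f.1 x) _)
  star {s} :=
    { toFun := α.fibStar s
      map_add' := fun f g => c0Sub_ext fun x => by
        by_cases hx : x ∈ (α.act s).source
        · rw [α.fibStar_of_mem s _ hx]
          change conj (f.1 _ + g.1 _) = (α.fibStar s f).1 x + (α.fibStar s g).1 x
          rw [map_add, α.fibStar_of_mem s _ hx, α.fibStar_of_mem s _ hx]
        · change _ = (α.fibStar s f).1 x + (α.fibStar s g).1 x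
          simp only [α.fibStar_of_not_mem s _ hx, add_zero]
      map_smul' := fun c f => c0Sub_ext fun x => by
        by_cases hx : x ∈ (α.act s).source
        · rw [α.fibStar_of_mem s _ hx]
          change conj (c * f.1 _) = conj c * (α.fibStar s f).1 x
          rw [map_mul, α.fibStar_of_mem s _ hx]
        · change _ = conj c * (α.fibStar s f).1 x
          simp only [α.fibStar_of_not_mem s _ hx, mul_zero] }
  incl {s t} h :=
    { toLinearMap := Submodule.inclusion
        (fun _ hf => mem_c0Sub.2 fun x hx =>
          mem_c0Sub.1 hf x fun h' => hx (α.natLE_target h h').1)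
      norm_map' := fun f => rfl }
  norm_mul_le f g := α.norm_fibMul_le f g
  mul_assoc {s t r} f g k := c0Sub_ext fun x => by
    change f.1 x * g.1 ((α.act s).symm x) * k.1 ((α.act (s * t)).symm x) =
      f.1 x * (g.1 ((α.act s).symm x) * k.1 ((α.act t).symm ((α.act s).symm x)))
    by_cases hx : x ∈ (α.act (s * t)).target
    · rw [α.act_mul_symm_apply s t hx, mul_assoc]
    · have h0 : f.1 x * g.1 ((α.act s).symm x) = 0 := c0Sub_vanish (α.fibMul s t f g) x hx
      rw [← mul_assoc, h0, zero_mul, zero_mul]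
  norm_star {s} f := le_antisymm (α.norm_fibStar_le f) (by
    rcases eq_or_lt_of_le (c0Sub_norm_nonneg f) with h | h
    · rw [← h]; exact c0Sub_norm_nonneg _
    · have h1 := (α.le_norm_fibStar_mul f).trans (α.norm_fibMul_le _ _)
      rw [sq] at h1
      exact le_of_mul_le_mul_right h1 h)
  star_star {s} f := c0Sub_ext fun x => by
    change (α.fibStar s⁻¹ (α.fibStar s f)).1 x = f.1 x
    by_cases hx : x ∈ (α.act s).target
    · rw [α.fibStar_of_mem _ _ (by rwa [α.source_inv]), α.act_inv_apply s hx,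
        α.fibStar_of_mem _ _ ((α.act s).map_target hx), (α.act s).right_inv hx, RCLike.conj_conj]
    · rw [α.fibStar_of_not_mem _ _ (by rwa [α.source_inv]), c0Sub_vanish f x hx]
  star_mul {s t} f g := c0Sub_ext fun x => by
    change (α.fibStar (s * t) (α.fibMul s t f g)).1 x =
      (α.fibStar t g).1 x * (α.fibStar s f).1 ((α.act t⁻¹).symm x)
    by_cases hx : x ∈ (α.act t).source
    · rw [α.act_inv_symm_apply t hx, α.fibStar_of_mem t g hx]
      by_cases hy : α.act t x ∈ (α.act s).source
      · have hst := (α.mem_source_mul s t x).2 ⟨hx, hy⟩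
        rw [α.fibStar_of_mem _ _ hst, α.fibStar_of_mem _ _ hy, fibMul_apply,
          α.act_mul_apply s t hst, (α.act s).left_inv hy, map_mul, mul_comm]
      · rw [α.fibStar_of_not_mem _ _ hy, mul_zero,
          α.fibStar_of_not_mem _ _ (fun h => hy ((α.mem_source_mul s t x).1 h).2)]
    · rw [α.fibStar_of_not_mem _ _ hx, zero_mul,
        α.fibStar_of_not_mem _ _ (fun h => hx ((α.mem_source_mul s t x).1 h).1)]
  norm_star_mul_self {s} f := le_antisymm
    ((α.norm_fibMul_le _ _).trans (by
      rw [sq]; exact mul_le_mul_of_nonneg_right (α.norm_fibStar_le f) (c0Sub_norm_nonneg _)))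
    (α.le_norm_fibStar_mul f)
  star_mul_self_pos {s} f := by
    have habs : ∀ x ∉ (α.act s).target, absC0 f.1 x = 0 := fun x hx => by
      rw [absC0_apply, c0Sub_vanish f x hx, norm_zero, Complex.ofReal_zero]
    have hsrc : ∀ x, x ∈ (α.act s).source → x ∈ (α.act (s⁻¹ * s)).source := fun x hx =>
      (α.mem_source_mul _ _ x).2 ⟨hx, by rw [α.source_inv]; exact (α.act s).map_source hx⟩
    have hid := idem_inv_mul s
    refine ⟨⟨pullC0 (α.act s) (absC0 f.1) habs, mem_c0Sub.2 fun x hx => ?_⟩, c0Sub_ext fun x => ?_⟩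
    · refine pullC0_of_not_mem _ _ _ fun h => hx ?_
      have h1 := (α.act (s⁻¹ * s)).map_source (hsrc x h)
      rwa [α.act_idem hid (hsrc x h)] at h1
    · change (α.fibStar s f).1 x * f.1 ((α.act s⁻¹).symm x) =
        (α.fibStar (s⁻¹ * s) _).1 x *
          pullC0 (α.act s) (absC0 f.1) habs ((α.act (s⁻¹ * s)⁻¹).symm x)
      by_cases hx : x ∈ (α.act s).source
      · rw [α.act_inv_symm_apply _ (hsrc x hx), α.fibStar_of_mem _ _ (hsrc x hx),
          α.act_idem hid (hsrc x hx), α.fibStar_of_mem _ _ hx, α.act_inv_symm_apply _ hx]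
        change _ = conj (pullC0 (α.act s) (absC0 f.1) habs x) * _
        rw [pullC0_of_mem _ _ _ hx, absC0_apply, Complex.conj_ofReal, mul_comm,
          Complex.mul_conj, Complex.normSq_eq_norm_sq, sq, Complex.ofReal_mul]
      · rw [α.fibStar_of_not_mem _ _ hx, zero_mul,
          α.fibStar_of_not_mem _ _ (fun h => hx ((α.mem_source_mul _ _ x).1 h).1), zero_mul]
  incl_refl f := rfl
  incl_trans h h' f := rfl
  incl_mul {s s' t t'} h h' f g := c0Sub_ext fun x => by
    change f.1 x * g.1 ((α.act s').symm x) = f.1 x * g.1 ((α.act s).symm x)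
    by_cases hx : x ∈ (α.act s).target
    · rw [(α.natLE_target h hx).2]
    · rw [c0Sub_vanish f x hx, zero_mul, zero_mul]
  incl_star {s t} h f := c0Sub_ext fun x => by
    change (α.fibStar t _).1 x = (α.fibStar s f).1 x
    by_cases hx : x ∈ (α.act s).source
    · obtain ⟨h1, h2⟩ := α.natLE_source h hx
      rw [α.fibStar_of_mem _ _ hx, α.fibStar_of_mem _ _ h1, h2]; rfl
    · rw [α.fibStar_of_not_mem _ _ hx]
      by_cases hx' : x ∈ (α.act t).source
      · rw [α.fibStar_of_mem _ _ hx']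
        change conj (f.1 (α.act t x)) = 0
        rw [c0Sub_vanish f _ ?_, map_zero]
        intro hy
        have h3 := (α.act s).map_target hy
        have h4 := (α.natLE_target h hy).2
        rw [(α.act t).left_inv hx'] at h4
        rw [← h4] at h3
        exact hx h3
      · rw [α.fibStar_of_not_mem _ _ hx']

/-- An action on a space has the approximation property if its Fell bundle has it. -/
def HasApproximationProperty (α : PartialAction S X) : Prop :=
  α.fellBundle.ApproximationProperty

end PartialAction

/-! ### Topological groupoids -/

/-- A topological groupoid, given by its space of arrows `G`. A unit is identified with the
corresponding identity arrow; `mul g h` is meaningful only if `src g = rng h`. -/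
class TopGroupoid (G : Type u) [TopologicalSpace G] where
  src : G → G
  rng : G → G
  mul : G → G → G
  inv : G → G
  src_src : ∀ g, src (src g) = src g
  rng_src : ∀ g, rng (src g) = src g
  src_rng : ∀ g, src (rng g) = rng g
  rng_rng : ∀ g, rng (rng g) = rng g
  src_mul : ∀ g h, src g = rng h → src (mul g h) = src h
  rng_mul : ∀ g h, src g = rng h → rng (mul g h) = rng g
  mul_assoc : ∀ g h k, src g = rng h → src h = rng k → mul (mul g h) k = mul g (mul h k)
  mul_src : ∀ g, mul g (src g) = g
  rng_mul_self : ∀ g, mul (rng g) g = g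
  src_inv : ∀ g, src (inv g) = rng g
  rng_inv : ∀ g, rng (inv g) = src g
  inv_mul : ∀ g, mul (inv g) g = src g
  mul_inv : ∀ g, mul g (inv g) = rng g
  continuous_inv : Continuous inv
  continuousOn_mul : ContinuousOn (fun p : G × G => mul p.1 p.2) {p | src p.1 = rng p.2}

namespace TopGroupoid

section Basic

variable {G : Type u} [TopologicalSpace G] [TopGroupoid G]

variable (G) in
/-- The unit space `G⁰`, with the subspace topology. -/
def UnitSpace : Type u := {x : G // src x = x}

instance : TopologicalSpace (UnitSpace G) := inferInstanceAs (TopologicalSpace {x : G // src x = x})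

/-- The source map `G → G⁰`. -/
def source (g : G) : UnitSpace G := ⟨src g, src_src g⟩

/-- The range map `G → G⁰`. -/
def range (g : G) : UnitSpace G := ⟨rng g, src_rng g⟩

theorem source_eq_iff {g h : G} : source g = source h ↔ src g = src h := Subtype.ext_iff

theorem range_eq_iff {g h : G} : range g = range h ↔ rng g = rng h := Subtype.ext_iff

theorem source_eq_range_iff {g h : G} : source g = range h ↔ src g = rng h := Subtype.ext_iff

theorem rng_of_unit {x : G} (hx : src x = x) : rng x = x := by
  rw [← hx, rng_src]

theorem inv_inv_self (g : G) : inv (inv g) = g := by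
  calc inv (inv g) = mul (inv (inv g)) (src (inv (inv g))) := (mul_src _).symm
    _ = mul (inv (inv g)) (mul (inv g) g) := by rw [src_inv, rng_inv, inv_mul]
    _ = mul (mul (inv (inv g)) (inv g)) g := by
        rw [mul_assoc _ _ _ (src_inv _) (src_inv _)]
    _ = mul (rng g) g := by rw [inv_mul, src_inv]
    _ = g := rng_mul_self g

theorem inv_mul_cancel_left {g h : G} (hgh : src g = rng h) : mul (inv g) (mul g h) = h := by
  rw [← mul_assoc _ _ _ (src_inv g) hgh, inv_mul, hgh, rng_mul_self]

theorem mul_inv_cancel_left {g h : G} (hgh : rng g = rng h) : mul g (mul (inv g) h) = h := by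
  rw [← mul_assoc _ _ _ (rng_inv g).symm (by rw [src_inv, hgh]), mul_inv, hgh, rng_mul_self]

theorem mul_mul_inv_rev {g h : G} (hgh : src g = rng h) : mul (mul g h) (inv h) = g := by
  rw [mul_assoc _ _ _ hgh (rng_inv h).symm, mul_inv, ← hgh, mul_src]

theorem continuous_src : Continuous (src : G → G) := by
  have h : (src : G → G) = fun g => mul (inv g) g := funext fun g => (inv_mul g).symm
  rw [h]
  exact continuousOn_mul.comp_continuous (continuous_inv.prodMk continuous_id)
    fun g => src_inv g

theorem continuous_rng : Continuous (rng : G → G) := by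
  have h : (rng : G → G) = fun g => src (inv g) := funext fun g => (src_inv g).symm
  rw [h]
  exact continuous_src.comp continuous_inv

theorem continuous_source : Continuous (source : G → UnitSpace G) := continuous_src.subtype_mk _

theorem continuous_range : Continuous (range : G → UnitSpace G) := continuous_rng.subtype_mk _

/-- Open bisections: open sets on which `s` and `r` are homeomorphisms onto open subsets of `G⁰`. -/
structure IsOpenBisection (u : Set G) : Prop where
  isOpen : IsOpen u
  source_openEmbedding : IsOpenEmbedding (fun g : u => source g.1)
  range_openEmbedding : IsOpenEmbedding (fun g : u => range g.1)

theorem IsOpenBisection.src_inj {u : Set G} (hu : IsOpenBisection u) {g h : G} (hg : g ∈ u)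
    (hh : h ∈ u) (e : src g = src h) : g = h :=
  congrArg Subtype.val (hu.source_openEmbedding.injective
    (a₁ := ⟨g, hg⟩) (a₂ := ⟨h, hh⟩) (source_eq_iff.2 e))

theorem IsOpenBisection.rng_inj {u : Set G} (hu : IsOpenBisection u) {g h : G} (hg : g ∈ u)
    (hh : h ∈ u) (e : rng g = rng h) : g = h :=
  congrArg Subtype.val (hu.range_openEmbedding.injective
    (a₁ := ⟨g, hg⟩) (a₂ := ⟨h, hh⟩) (range_eq_iff.2 e))

end Basic

/-- A topological groupoid is étale if its open bisections form a basis of its topology. -/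
class IsEtale (G : Type u) [TopologicalSpace G] [TopGroupoid G] : Prop where
  isTopologicalBasis : TopologicalSpace.IsTopologicalBasis {u : Set G | IsOpenBisection u}

section Etale

variable {G : Type u} [TopologicalSpace G] [TopGroupoid G] [IsEtale G]

theorem exists_bisection (g : G) {W : Set G} (hW : IsOpen W) (hg : g ∈ W) :
    ∃ u, IsOpenBisection u ∧ g ∈ u ∧ u ⊆ W := by
  obtain ⟨u, hu, h1, h2⟩ := (IsEtale.isTopologicalBasis (G := G)).exists_subset_of_mem_open hg hW
  exact ⟨u, hu, h1, h2⟩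

theorem isOpenMap_of_bisection {f : G → UnitSpace G}
    (hf : ∀ u : Set G, IsOpenBisection u → IsOpenMap (fun g : u => f g.1)) : IsOpenMap f := by
  intro W hW
  rw [isOpen_iff_mem_nhds]
  rintro _ ⟨g, hg, rfl⟩
  obtain ⟨u, hu, hgu, huW⟩ := exists_bisection g hW hg
  refine mem_of_superset ((hf u hu).isOpen_range.mem_nhds ⟨⟨g, hgu⟩, rfl⟩) ?_
  rintro _ ⟨h, rfl⟩
  exact ⟨h.1, huW h.2, rfl⟩

theorem isOpenMap_source : IsOpenMap (source : G → UnitSpace G) :=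
  isOpenMap_of_bisection fun _ hu => hu.source_openEmbedding.isOpenMap

theorem isOpenMap_range : IsOpenMap (range : G → UnitSpace G) :=
  isOpenMap_of_bisection fun _ hu => hu.range_openEmbedding.isOpenMap

theorem isOpenBisection_of {u : Set G} (ho : IsOpen u)
    (hs : ∀ g ∈ u, ∀ h ∈ u, src g = src h → g = h)
    (hr : ∀ g ∈ u, ∀ h ∈ u, rng g = rng h → g = h) : IsOpenBisection u where
  isOpen := ho
  source_openEmbedding := IsOpenEmbedding.of_continuous_injective_isOpenMap
    (continuous_source.comp continuous_subtype_val)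
    (fun g h e => Subtype.ext (hs g.1 g.2 h.1 h.2 (source_eq_iff.1 e)))
    (isOpenMap_source.comp ho.isOpenMap_subtype_val)
  range_openEmbedding := IsOpenEmbedding.of_continuous_injective_isOpenMap
    (continuous_range.comp continuous_subtype_val)
    (fun g h e => Subtype.ext (hr g.1 g.2 h.1 h.2 (range_eq_iff.1 e)))
    (isOpenMap_range.comp ho.isOpenMap_subtype_val)

/-- The product `u · v = {gh : g ∈ u, h ∈ v, s(g) = r(h)}`. -/
def setMul (u v : Set G) : Set G := {k | ∃ g ∈ u, ∃ h ∈ v, src g = rng h ∧ mul g h = k}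

theorem isOpenBisection_units : IsOpenBisection {x : G | src x = x} := by
  refine isOpenBisection_of ?_ ?_ ?_
  · rw [isOpen_iff_mem_nhds]
    intro x hx
    obtain ⟨u, hu, hxu, -⟩ := exists_bisection x isOpen_univ (Set.mem_univ x)
    have h1 : IsOpen (u ∩ src ⁻¹' u) := hu.isOpen.inter (hu.isOpen.preimage continuous_src)
    refine mem_of_superset (h1.mem_nhds ⟨hxu, ?_⟩) ?_
    · change src x ∈ u
      rwa [show src x = x from hx]
    · rintro g ⟨hg, hg'⟩
      exact hu.src_inj hg' hg (src_src g)
  · intro g hg h hh e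
    rwa [show src g = g from hg, show src h = h from hh] at e
  · intro g hg h hh e
    rwa [rng_of_unit hg, rng_of_unit hh] at e

theorem isOpenBisection_inv {u : Set G} (hu : IsOpenBisection u) :
    IsOpenBisection {g : G | inv g ∈ u} := by
  refine isOpenBisection_of (hu.isOpen.preimage continuous_inv) ?_ ?_
  · intro g hg h hh e
    have := hu.rng_inj hg hh (by rw [rng_inv, rng_inv, e])
    rw [← inv_inv_self g, this, inv_inv_self]
  · intro g hg h hh e
    have := hu.src_inj hg hh (by rw [src_inv, src_inv, e])
    rw [← inv_inv_self g, this, inv_inv_self]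

theorem isOpen_setMul {u v : Set G} (hu : IsOpenBisection u) (hv : IsOpenBisection v) :
    IsOpen (setMul u v) := by
  rw [isOpen_iff_mem_nhds]
  rintro k ⟨g, hg, h, hh, hgh, rfl⟩
  have hne : Nonempty u := ⟨⟨g, hg⟩⟩
  let e := hu.range_openEmbedding.toOpenPartialHomeomorph (fun g : u => range g.1)
  have het : e.target = Set.range (fun g : u => range g.1) := by simp [e]
  have hes : ∀ x ∈ e.target, range (e.symm x).1 = x := fun x hx => e.right_inv hx
  set W : Set G := range ⁻¹' e.target with hW
  have hWo : IsOpen W := e.open_target.preimage continuous_range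
  have hc : ContinuousOn (fun k : G => mul (inv (e.symm (range k)).1) k) W := by
    refine continuousOn_mul.comp (f := fun k : G => (inv (e.symm (range k)).1, k)) ?_ ?_
    · refine ContinuousOn.prodMk ?_ continuousOn_id
      refine (continuous_inv.comp continuous_subtype_val).comp_continuousOn ?_
      exact e.continuousOn_symm.comp continuous_range.continuousOn fun x hx => hx
    · intro k hk
      change src (inv (e.symm (range k)).1) = rng k
      rw [src_inv]
      exact range_eq_iff.1 (hes _ hk)
  have hopen := hc.isOpen_inter_preimage hWo hv.isOpen
  have hgk : range (mul g h) = range g := range_eq_iff.2 (rng_mul g h hgh)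
  have hkW : mul g h ∈ W := by
    change range (mul g h) ∈ e.target
    rw [hgk, het]
    exact ⟨⟨g, hg⟩, rfl⟩
  have hsec : ((e.symm (range (mul g h))).1 : G) = g := by
    refine hu.rng_inj (e.symm _).2 hg ?_
    rw [range_eq_iff.1 (hes _ hkW), rng_mul g h hgh]
  refine mem_of_superset (hopen.mem_nhds ⟨hkW, ?_⟩) ?_
  · change mul (inv (e.symm (range (mul g h))).1) (mul g h) ∈ v
    rw [hsec, inv_mul_cancel_left hgh]
    exact hh
  · rintro k ⟨hk, hkv⟩
    have hr : rng (e.symm (range k)).1 = rng k := range_eq_iff.1 (hes _ hk)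
    refine ⟨(e.symm (range k)).1, (e.symm (range k)).2, _, hkv, ?_, mul_inv_cancel_left hr⟩
    rw [rng_mul _ _ (by rw [src_inv, hr]), rng_inv]

theorem isOpenBisection_mul {u v : Set G} (hu : IsOpenBisection u) (hv : IsOpenBisection v) :
    IsOpenBisection (setMul u v) := by
  refine isOpenBisection_of (isOpen_setMul hu hv) ?_ ?_
  · rintro _ ⟨g, hg, h, hh, e, rfl⟩ _ ⟨g', hg', h', hh', e', rfl⟩ E
    rw [src_mul _ _ e, src_mul _ _ e'] at E
    obtain rfl := hv.src_inj hh hh' E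
    obtain rfl := hu.src_inj hg hg' (e.trans e'.symm)
    rfl
  · rintro _ ⟨g, hg, h, hh, e, rfl⟩ _ ⟨g', hg', h', hh', e', rfl⟩ E
    rw [rng_mul _ _ e, rng_mul _ _ e'] at E
    obtain rfl := hu.rng_inj hg hg' E
    obtain rfl := hv.rng_inj hh hh' (e.symm.trans e')
    rfl

variable (G) in
/-- `Bis(G)`: the open bisections of `G`. -/
def Bis : Type u := {u : Set G // IsOpenBisection u}

theorem setMul_inv_setMul {u t : Set G} (hu : IsOpenBisection u)
    (h : setMul (setMul u t) u = u) {g : G} (hg : g ∈ u) : inv g ∈ t := by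
  have hg' := hg
  rw [← h] at hg'
  obtain ⟨_, ⟨a, ha, b, hb, hab, rfl⟩, c, hc, habc, he⟩ := hg'
  rw [src_mul _ _ hab] at habc
  have hab' : src (mul a b) = rng c := by rw [src_mul _ _ hab, habc]
  have hcg : c = g := hu.src_inj hc hg (by rw [← he, src_mul _ _ hab'])
  have hag : a = g := hu.rng_inj ha hg (by rw [← he, rng_mul _ _ hab', rng_mul _ _ hab])
  subst hcg
  subst hag
  have h1 : mul (mul (mul a b) a) (inv a) = mul a b := mul_mul_inv_rev hab'
  rw [he] at h1
  have h2 : mul (inv a) (mul a b) = b := inv_mul_cancel_left hab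
  rw [← h1, mul_inv, ← src_inv, mul_src] at h2
  rwa [h2]

theorem setMul_inv_self (u : Set G) (hu : IsOpenBisection u) :
    setMul (setMul u {g | inv g ∈ u}) u = u := by
  ext k
  constructor
  · rintro ⟨_, ⟨a, ha, b, hb, hab, rfl⟩, c, hc, habc, rfl⟩
    rw [src_mul _ _ hab] at habc
    have h1 : inv b = a := hu.src_inj hb ha (by rw [src_inv, hab])
    have h2 : inv b = c := hu.rng_inj hb hc (by rw [rng_inv, habc])
    have h3 : c = a := h2.symm.trans h1
    subst h3
    have h4 : b = inv c := by rw [← h1, inv_inv_self]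
    subst h4
    rwa [mul_inv, rng_mul_self]
  · intro hk
    refine ⟨rng k, ⟨k, hk, inv k, ?_, (rng_inv k).symm, mul_inv k⟩, k, hk, src_rng k,
      rng_mul_self k⟩
    change inv (inv k) ∈ u
    rwa [inv_inv_self]

theorem setOf_inv_inv (u : Set G) : {g : G | inv g ∈ {h : G | inv h ∈ u}} = u := by
  ext g
  change inv (inv g) ∈ u ↔ g ∈ u
  rw [inv_inv_self]

/-- `Bis(G)` is an inverse semigroup with unit `G⁰`. -/
instance : InverseMonoid (Bis G) where
  mul u v := ⟨setMul u.1 v.1, isOpenBisection_mul u.2 v.2⟩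
  one := ⟨{x | src x = x}, isOpenBisection_units⟩
  inv u := ⟨{g | inv g ∈ u.1}, isOpenBisection_inv u.2⟩
  mul_assoc u v w := Subtype.ext (Set.ext fun k => by
    constructor
    · rintro ⟨_, ⟨a, ha, b, hb, hab, rfl⟩, c, hc, habc, rfl⟩
      rw [src_mul _ _ hab] at habc
      exact ⟨a, ha, _, ⟨b, hb, c, hc, habc, rfl⟩, by rw [rng_mul _ _ habc, hab],
        (mul_assoc _ _ _ hab habc).symm⟩
    · rintro ⟨a, ha, _, ⟨b, hb, c, hc, hbc, rfl⟩, habc, rfl⟩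
      rw [rng_mul _ _ hbc] at habc
      exact ⟨_, ⟨a, ha, b, hb, habc, rfl⟩, c, hc, by rw [src_mul _ _ habc, hbc],
        mul_assoc _ _ _ habc hbc⟩)
  one_mul u := Subtype.ext (Set.ext fun k => by
    constructor
    · rintro ⟨a, ha, b, hb, hab, rfl⟩
      rw [show a = rng b from (show src a = a from ha).symm.trans hab, rng_mul_self]
      exact hb
    · intro hk
      exact ⟨rng k, src_rng k, k, hk, src_rng k, rng_mul_self k⟩)
  mul_one u := Subtype.ext (Set.ext fun k => by
    constructor
    · rintro ⟨a, ha, b, hb, hab, rfl⟩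
      rw [show b = src a from (rng_of_unit hb).symm.trans hab.symm, mul_src]
      exact ha
    · intro hk
      exact ⟨k, hk, src k, src_src k, (rng_src k).symm, mul_src k⟩)
  mul_inv_mul_self u := Subtype.ext (setMul_inv_self u.1 u.2)
  inv_mul_inv_self u := Subtype.ext (by
    have h := setMul_inv_self _ (isOpenBisection_inv u.2)
    rw [setOf_inv_inv] at h
    exact h)
  inv_unique u t h h' := Subtype.ext (Set.ext fun g => by
    constructor
    · intro hg
      exact setMul_inv_setMul t.2 (congrArg Subtype.val h') hg
    · intro hg
      have := setMul_inv_setMul u.2 (congrArg Subtype.val h) (show inv g ∈ u.1 from hg)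
      rwa [inv_inv_self] at this)

/-! ### The canonical action on the unit space -/

open Classical in
/-- `x ↦ u x`: if `g ∈ u` has source `x`, then `u x = r(g)` (and junk if there is no such `g`). -/
def bisFun (u : Bis G) (x : UnitSpace G) : UnitSpace G :=
  if h : ∃ g ∈ u.1, source g = x then range h.choose else x

theorem bisFun_source (u : Bis G) {g : G} (hg : g ∈ u.1) : bisFun u (source g) = range g := by
  have h : ∃ g' ∈ u.1, source g' = source g := ⟨g, hg, rfl⟩
  rw [bisFun, dif_pos h]
  rw [u.2.src_inj h.choose_spec.1 hg (source_eq_iff.1 h.choose_spec.2)]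

theorem mem_inv_iff (u : Bis G) (g : G) : g ∈ (u⁻¹).1 ↔ inv g ∈ u.1 := Iff.rfl

theorem inv_mem_inv (u : Bis G) {g : G} (hg : g ∈ u.1) : inv g ∈ (u⁻¹).1 := by
  rwa [mem_inv_iff, inv_inv_self]

theorem source_inv (g : G) : source (inv g) = range g := Subtype.ext (src_inv g)

theorem range_inv (g : G) : range (inv g) = source g := Subtype.ext (rng_inv g)

theorem bisFun_inv_range (u : Bis G) {g : G} (hg : g ∈ u.1) :
    bisFun u⁻¹ (range g) = source g := by
  rw [← source_inv, bisFun_source _ (inv_mem_inv u hg), range_inv]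

theorem continuousOn_bisFun (u : Bis G) : ContinuousOn (bisFun u) (source '' u.1) := by
  rw [continuousOn_iff']
  intro W hW
  refine ⟨source '' (u.1 ∩ range ⁻¹' W),
    isOpenMap_source _ (u.2.isOpen.inter (hW.preimage continuous_range)), ?_⟩
  ext x
  constructor
  · rintro ⟨hx, g, hg, rfl⟩
    refine ⟨⟨g, ⟨hg, ?_⟩, rfl⟩, g, hg, rfl⟩
    rwa [Set.mem_preimage, bisFun_source u hg] at hx
  · rintro ⟨⟨g, ⟨hg, hgW⟩, rfl⟩, -⟩
    refine ⟨?_, g, hg, rfl⟩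
    rwa [Set.mem_preimage, bisFun_source u hg]

theorem source_image_inv (u : Bis G) : source '' (u⁻¹).1 = range '' u.1 := by
  ext x
  constructor
  · rintro ⟨g, hg, rfl⟩
    exact ⟨inv g, hg, range_inv g⟩
  · rintro ⟨g, hg, rfl⟩
    exact ⟨inv g, inv_mem_inv u hg, source_inv g⟩

/-- The partial homeomorphism `s(u) → r(u)` of `G⁰` given by an open bisection `u`. -/
def bisHomeo (u : Bis G) : OpenPartialHomeomorph (UnitSpace G) (UnitSpace G) where
  toFun := bisFun u
  invFun := bisFun u⁻¹
  source := source '' u.1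
  target := range '' u.1
  map_source' := by
    rintro _ ⟨g, hg, rfl⟩
    rw [bisFun_source u hg]
    exact ⟨g, hg, rfl⟩
  map_target' := by
    rintro _ ⟨g, hg, rfl⟩
    rw [bisFun_inv_range u hg]
    exact ⟨g, hg, rfl⟩
  left_inv' := by
    rintro _ ⟨g, hg, rfl⟩
    rw [bisFun_source u hg, bisFun_inv_range u hg]
  right_inv' := by
    rintro _ ⟨g, hg, rfl⟩
    rw [bisFun_inv_range u hg, bisFun_source u hg]
  open_source := isOpenMap_source _ u.2.isOpen
  open_target := isOpenMap_range _ u.2.isOpen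
  continuousOn_toFun := continuousOn_bisFun u
  continuousOn_invFun := by
    have h := continuousOn_bisFun u⁻¹
    rwa [source_image_inv] at h

variable (G) in
/-- The canonical action of `Bis(G)` on `G⁰`. -/
def canonicalAction : PartialAction (Bis G) (UnitSpace G) where
  act := bisHomeo
  act_one := by
    have hone : ∀ x : UnitSpace G, x.1 ∈ (1 : Bis G).1 ∧ source x.1 = x ∧ range x.1 = x :=
      fun x => ⟨x.2, Subtype.ext x.2, Subtype.ext (rng_of_unit x.2)⟩
    refine ⟨?_, ?_⟩
    · ext x
      exact ⟨fun _ => Set.mem_univ _, fun _ => ⟨x.1, (hone x).1, (hone x).2.1⟩⟩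
    · intro x _
      change bisFun 1 x = x
      have := bisFun_source 1 (hone x).1
      rwa [(hone x).2.1, (hone x).2.2] at this
  act_mul u v := by
    have key : ∀ g ∈ u.1, ∀ h ∈ v.1, src g = rng h →
        bisFun (u * v) (source h) = range g := fun g hg h hh e => by
      have hm : mul g h ∈ (u * v).1 := ⟨g, hg, h, hh, e, rfl⟩
      have := bisFun_source (u * v) hm
      rwa [show source (mul g h) = source h from Subtype.ext (src_mul g h e),
        show range (mul g h) = range g from Subtype.ext (rng_mul g h e)] at this
    refine ⟨?_, ?_⟩
    · ext x
      change x ∈ source '' (u * v).1 ↔ x ∈ (source '' v.1) ∩ bisFun v ⁻¹' (source '' u.1)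
      constructor
      · rintro ⟨_, ⟨g, hg, h, hh, e, rfl⟩, rfl⟩
        rw [show source (mul g h) = source h from Subtype.ext (src_mul g h e)]
        refine ⟨⟨h, hh, rfl⟩, ?_⟩
        rw [Set.mem_preimage, bisFun_source v hh]
        exact ⟨g, hg, source_eq_range_iff.2 e⟩
      · rintro ⟨⟨h, hh, rfl⟩, hx⟩
        rw [Set.mem_preimage, bisFun_source v hh] at hx
        obtain ⟨g, hg, e⟩ := hx
        have e' := source_eq_range_iff.1 e
        exact ⟨mul g h, ⟨g, hg, h, hh, e', rfl⟩, Subtype.ext (src_mul g h e')⟩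
    · rintro _ ⟨_, ⟨g, hg, h, hh, e, rfl⟩, rfl⟩
      change bisFun (u * v) (source (mul g h)) = bisFun u (bisFun v (source (mul g h)))
      rw [show source (mul g h) = source h from Subtype.ext (src_mul g h e), key g hg h hh e,
        bisFun_source v hh, ← source_eq_range_iff.2 e, bisFun_source u hg]
  act_inv u := by
    refine ⟨source_image_inv u, fun x _ => rfl⟩

/-- An inverse subsemigroup `S ⊆ Bis(G)` is wide if it covers `G` and `u ∩ v`, for `u, v ∈ S`, is a
union of elements of `S`. (If a wide `S` has a unit, this unit is `G⁰`.) -/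
def IsWide (S : InverseSubsemigroup (Bis G)) : Prop :=
  (∀ g : G, ∃ u ∈ S.carrier, g ∈ u.1) ∧
  ∀ g : G, ∀ u ∈ S.carrier, ∀ v ∈ S.carrier, g ∈ u.1 ∩ v.1 →
    ∃ w ∈ S.carrier, g ∈ w.1 ∧ w.1 ⊆ u.1 ∩ v.1

end Etale

/-- The canonical action of `S ⊆ Bis(G)` on `G⁰`. If `S` has no unit, a unit acting as the identity
is adjoined to `S`; for wide `S` this unit is the element `G⁰` of `Bis(G)`. -/
def canonicalActionOf {G : Type u} [TopologicalSpace G] [TopGroupoid G] [IsEtale G]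
    (S : InverseSubsemigroup (Bis G)) : PartialAction S.unitize.Elem (UnitSpace G) :=
  (canonicalAction G).restrict S.unitize

/-! ### Topological amenability -/

section Amenable

variable (G : Type u) [TopologicalSpace G] [TopGroupoid G]

/-- `C_c(G)`: the span of the functions that are continuous on some open bisection and vanish off
a compact subset of it. -/
def CompactlySupported : Submodule ℂ (G → ℂ) :=
  Submodule.span ℂ {f | ∃ u : Set G, IsOpenBisection u ∧ ContinuousOn f u ∧
    ∃ K ⊆ u, IsCompact K ∧ ∀ g ∉ K, f g = 0}

/-- Topological amenability of an étale groupoid. -/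
def IsTopologicallyAmenable : Prop :=
  ∃ (I : Type u) (_ : Preorder I) (_ : IsDirectedOrder I) (_ : Nonempty I) (η : I → G → ℂ),
    (∀ i, η i ∈ CompactlySupported G) ∧
    (∀ i, ∀ x : UnitSpace G, Real.sqrt (∑ᶠ h : {h : G // range h = x}, ‖η i h‖ ^ 2) ≤ 1) ∧
    ∀ K : Set G, IsCompact K → TendstoUniformlyOn
      (fun i g => ∑ᶠ h : {h : G // range h = range g}, conj (η i h) * η i (mul (inv g) h))
      (fun _ => 1) atTop K

end Amenable

end TopGroupoid

end InvFell

end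

noncomputable section

open Filter Topology
open scoped ZeroAtInfty ComplexConjugate

set_option linter.unusedSectionVars false

namespace InvFell

universe u

/-! ### Functions vanishing at infinity -/

section SoftThreshold

/-! All assertions are instances of one equivalence, for a homomorphism `ι : M → Bis G` with wide
image. A section `ξ`, with `ξ p` in `C₀(r(ι p))`, spreads out to the function `η g = ∑_{p : g ∈ ι p}
ξ p (r g)` on `G`. The approximation property speaks of `ξ`, amenability of `η`, and a dictionary
with two halves shows that they say the same.

The algebraic half: for `k ∈ ι s`, the coefficient `∑_h conj (η h) η (k⁻¹ h)` expands into a sum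
over pairs `(p, t)`. As `ι p` is a bisection, at most one `h` contributes for each pair. It exists
exactly when the unit `r(k)` is an arrow of `ι (p (s t)*)`, that is, when `r(k)` lies in the open
set `U_w` with `I_{w,1} = C₀(U_w)` for `w = p (s t)*` (`range_mem_unitSet_iff`, `coeff_spread`).

The analytic half: in the bidual, `1_w` behaves like the characteristic function of `U_w`, and a
finite combination of such units has as norm the supremum of the corresponding pointwise combination
(`norm_sum_arens_sub_le_iff`). Point evaluations give one inequality. For the other, a functional on
`C₀(U)` is small away from a large compact subset of `U` (`exists_compact_functional_small`); this
plays the role of inner regularity, so no measures are needed.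

Hence the approximating sum for `a ∈ A_s` differs from `a` in norm by `sup_{k ∈ ι s} |coeff η k - 1|
|a (r k)|`, and the boundedness condition is a bound on `∑_{r(h) = x} |η h|²`. From amenability,
partitions of unity write every function in `C_c(G)` as a spread section, and Cauchy–Schwarz handles
the region where `a` is small. Conversely, bump functions `a` and compactness give uniform
convergence of coefficients. Soft thresholds then move `η` into `C_c(G)`, and since `∑ |η h|²` is
the coefficient at a unit, a cut-off and a rescaling make it at most `1` everywhere. -/

/-- The soft threshold: `z` minus its radial projection to the disc of radius `δ`. -/
def softThreshold (δ : ℝ) (z : ℂ) : ℂ := z - ((δ / max δ ‖z‖ : ℝ) : ℂ) * z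

theorem softThreshold_zero (δ : ℝ) : softThreshold δ 0 = 0 := by simp [softThreshold]

theorem continuous_softThreshold {δ : ℝ} (hδ : 0 < δ) : Continuous (softThreshold δ) := by
  unfold softThreshold
  refine continuous_id.sub (Continuous.mul ?_ continuous_id)
  refine Complex.continuous_ofReal.comp (continuous_const.div (by fun_prop) fun z => ?_)
  exact (lt_of_lt_of_le hδ (le_max_left _ _)).ne'

theorem softThreshold_of_norm_le {δ : ℝ} (hδ : 0 < δ) {z : ℂ} (hz : ‖z‖ ≤ δ) :
    softThreshold δ z = 0 := by
  simp [softThreshold, max_eq_left hz, div_self hδ.ne']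

theorem norm_sub_softThreshold_le {δ : ℝ} (hδ : 0 < δ) (z : ℂ) :
    ‖z - softThreshold δ z‖ ≤ δ := by
  have h : z - softThreshold δ z = ((δ / max δ ‖z‖ : ℝ) : ℂ) * z := by simp [softThreshold]
  have hm : 0 < max δ ‖z‖ := lt_of_lt_of_le hδ (le_max_left _ _)
  rw [h, norm_mul, Complex.norm_real, Real.norm_of_nonneg (by positivity), div_mul_eq_mul_div,
    div_le_iff₀ hm]
  exact mul_le_mul_of_nonneg_left (le_max_right _ _) hδ.le

theorem norm_softThreshold_le {δ : ℝ} (hδ : 0 < δ) (z : ℂ) : ‖softThreshold δ z‖ ≤ ‖z‖ := by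
  have hm : 0 < max δ ‖z‖ := lt_of_lt_of_le hδ (le_max_left _ _)
  have h : softThreshold δ z = ((1 - δ / max δ ‖z‖ : ℝ) : ℂ) * z := by
    simp [softThreshold, sub_mul]
  have h1 : δ / max δ ‖z‖ ≤ 1 := (div_le_one hm).2 (le_max_left _ _)
  have h2 : 0 ≤ δ / max δ ‖z‖ := by positivity
  rw [h, norm_mul, Complex.norm_real, Real.norm_of_nonneg (by linarith)]
  exact mul_le_of_le_one_left (norm_nonneg _) (by linarith)

end SoftThreshold

section C0

variable {X : Type u} [TopologicalSpace X]

/-- The soft threshold of a function vanishing at infinity. -/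
def softC0 (δ : ℝ) (hδ : 0 < δ) (f : C₀(X, ℂ)) : C₀(X, ℂ) where
  toFun x := softThreshold δ (f x)
  continuous_toFun := (continuous_softThreshold hδ).comp (map_continuous f)
  zero_at_infty' :=
    squeeze_zero_norm (fun x => norm_softThreshold_le hδ (f x))
      (by simpa using (zero_at_infty f).norm)

theorem softC0_apply {δ : ℝ} (hδ : 0 < δ) (f : C₀(X, ℂ)) (x : X) :
    softC0 δ hδ f x = softThreshold δ (f x) := rfl

/-- A continuous function vanishing off a compact set, as a function vanishing at infinity. -/
def c0OfCompact (f : X → ℂ) (hf : Continuous f) {K : Set X} (hK : IsCompact K)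
    (h : ∀ x ∉ K, f x = 0) : C₀(X, ℂ) where
  toFun := f
  continuous_toFun := hf
  zero_at_infty' := tendsto_const_nhds.congr' (by
    filter_upwards [hK.compl_mem_cocompact] with x hx
    exact (h x hx).symm)

theorem c0OfCompact_apply (f : X → ℂ) (hf : Continuous f) {K : Set X} (hK : IsCompact K)
    (h : ∀ x ∉ K, f x = 0) (x : X) : c0OfCompact f hf hK h x = f x := rfl

/-- The set `{δ ≤ |f|}` is compact, and lies in `U` because `f` vanishes off `U`. So thresholding
yields compact support inside `U` at a cost of `δ` in norm; this is the approximation device used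
throughout. -/
theorem exists_compact_softC0 {U : Set X} {f : C₀(X, ℂ)} (hf : f ∈ c0Sub U) {δ : ℝ}
    (hδ : 0 < δ) : ∃ K ⊆ U, IsCompact K ∧ ∀ x ∉ K, softC0 δ hδ f x = 0 := by
  refine ⟨{x | δ ≤ ‖f x‖}, fun x hx => ?_, c0_compact f hδ, fun x hx => ?_⟩
  · by_contra h
    have hx' : δ ≤ ‖f x‖ := hx
    rw [hf x h, norm_zero] at hx'
    linarith
  · exact softThreshold_of_norm_le hδ (not_le.1 hx).le

theorem norm_sub_softC0_le {δ : ℝ} (hδ : 0 < δ) (f : C₀(X, ℂ)) : ‖f - softC0 δ hδ f‖ ≤ δ :=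
  c0_norm_le_of _ hδ.le fun x => norm_sub_softThreshold_le hδ (f x)

theorem norm_softC0_le {δ : ℝ} (hδ : 0 < δ) (f : C₀(X, ℂ)) : ‖softC0 δ hδ f‖ ≤ ‖f‖ :=
  c0_norm_le_of _ (norm_nonneg f) fun x =>
    (norm_softThreshold_le hδ (f x)).trans (c0_norm_le f x)

theorem softC0_mem {U : Set X} {f : C₀(X, ℂ)} (hf : f ∈ c0Sub U) {δ : ℝ} (hδ : 0 < δ) :
    softC0 δ hδ f ∈ c0Sub U := fun x hx => by
  rw [softC0_apply, hf x hx, softThreshold_zero]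

theorem mul_mem_c0Sub_left {U : Set X} {f : C₀(X, ℂ)} (hf : f ∈ c0Sub U) (g : C₀(X, ℂ)) :
    f * g ∈ c0Sub U := fun x hx => by
  rw [ZeroAtInftyContinuousMap.mul_apply, hf x hx, zero_mul]

theorem mul_mem_c0Sub_right {U : Set X} {f : C₀(X, ℂ)} (hf : f ∈ c0Sub U) (g : C₀(X, ℂ)) :
    g * f ∈ c0Sub U := fun x hx => by
  rw [ZeroAtInftyContinuousMap.mul_apply, hf x hx, mul_zero]

variable [T2Space X] [LocallyCompactSpace X]

theorem exists_c0_bump {K U : Set X} (hK : IsCompact K) (hU : IsOpen U) (hKU : K ⊆ U) :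
    ∃ h ∈ c0Sub U, (∀ x ∈ K, h x = 1) ∧ ∀ x, ∃ r ∈ Set.Icc (0 : ℝ) 1, h x = r := by
  obtain ⟨f, h1, h2, h3, h4⟩ := exists_continuousMap_one_of_isCompact_subset_isOpen hK hU hKU
  have h0 : ∀ x ∉ tsupport f, f x = 0 := fun x hx => image_eq_zero_of_notMem_tsupport hx
  refine ⟨c0OfCompact (fun x => (f x : ℂ)) (by fun_prop) h2 (fun x hx => by simp [h0 x hx]),
    fun x hx => ?_, fun x hx => ?_, fun x => ⟨f x, h4 x, rfl⟩⟩
  · simp [c0OfCompact_apply, h0 x fun h => hx (h3 h)]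
  · simp [c0OfCompact_apply, h1 hx]

theorem exists_c0_partition {ι : Type*} [Fintype ι] {K : Set X} {U : ι → Set X}
    (hK : IsCompact K) (hU : ∀ i, IsOpen (U i)) (hKU : K ⊆ ⋃ i, U i) :
    ∃ χ : ι → C₀(X, ℂ), (∀ i, χ i ∈ c0Sub (U i)) ∧ (∀ x ∈ K, ∑ i, χ i x = 1) ∧
      ∀ i x, ‖χ i x‖ ≤ 1 := by
  let e := Fintype.equivFin ι
  obtain ⟨f, h1, h2, h3, h4⟩ := exists_continuous_sum_one_of_isOpen_isCompact
    (s := fun k => U (e.symm k)) (fun k => hU _) hK (by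
      intro x hx
      obtain ⟨i, hi⟩ := Set.mem_iUnion.1 (hKU hx)
      exact Set.mem_iUnion.2 ⟨e i, by simpa using hi⟩)
  have h0 : ∀ i, ∀ x ∉ tsupport (f i), f i x = 0 := fun i x hx =>
    image_eq_zero_of_notMem_tsupport hx
  have h4' : ∀ i, IsCompact (tsupport (f i)) := h4
  refine ⟨fun i => c0OfCompact (fun x => (f (e i) x : ℂ)) (by fun_prop) (h4' (e i))
    (fun x hx => by simp [h0 _ x hx]), fun i x hx => ?_, fun x hx => ?_, fun i x => ?_⟩
  · have := h1 (e i)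
    simp only [Equiv.symm_apply_apply] at this
    simp [c0OfCompact_apply, h0 _ x fun h => hx (this h)]
  · simp only [c0OfCompact_apply]
    have := h2 hx
    rw [Finset.sum_apply, Pi.one_apply] at this
    rw [← Complex.ofReal_sum, ← Complex.ofReal_one, ← this]
    congr 1
    exact e.sum_comp (fun k => f k x)
  · simp only [c0OfCompact_apply]
    rw [Complex.norm_real, Real.norm_of_nonneg (h3 _ _).1]
    exact (h3 _ _).2

end C0

/-! ### Functionals on normed spaces -/

/-- The dual of a normed space over `ℂ`. -/
abbrev Dual (E : Type u) [NormedAddCommGroup E] [NormedSpace ℂ E] : Type u := StrongDual ℂ E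

section Functional

variable {E : Type*} [NormedAddCommGroup E] [NormedSpace ℂ E]

/-- Here `N` is the norm of `φ` restricted to `p`. -/
theorem exists_near_norming (p : Submodule ℂ E) (φ : StrongDual ℂ E) :
    ∃ N : ℝ, 0 ≤ N ∧ (∀ f ∈ p, ‖φ f‖ ≤ N * ‖f‖) ∧
      ∀ δ > 0, ∃ g ∈ p, ‖g‖ ≤ 1 ∧ N - δ ≤ ‖φ g‖ := by
  refine ⟨‖φ ∘L p.subtypeL‖, ContinuousLinearMap.opNorm_nonneg _,
    fun f hf => (φ ∘L p.subtypeL).le_opNorm ⟨f, hf⟩,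
    fun δ hδ => ?_⟩
  obtain ⟨g, hg1, hg2⟩ := (φ ∘L p.subtypeL).exists_lt_apply_of_lt_opNorm
    (r := ‖φ ∘L p.subtypeL‖ - δ) (by linarith)
  exact ⟨g.1, g.2, hg1.le, hg2.le⟩

theorem exists_extension_of_linearIsometry {F : Type*} [NormedAddCommGroup F] [NormedSpace ℂ F]
    (j : E →ₗᵢ[ℂ] F) (φ : StrongDual ℂ E) :
    ∃ ψ : StrongDual ℂ F, (∀ x, ψ (j x) = φ x) ∧ ‖ψ‖ ≤ ‖φ‖ := by
  let e := j.equivRange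
  obtain ⟨ψ, h1, h2⟩ := exists_extension_norm_eq (LinearMap.range j.toLinearMap)
    (φ ∘L (e.symm.toContinuousLinearEquiv : _ →L[ℂ] E))
  refine ⟨ψ, fun x => ?_, ?_⟩
  · have := h1 (e x)
    simpa [e] using this
  · rw [h2]
    refine ContinuousLinearMap.opNorm_le_bound _ (norm_nonneg _) fun y => ?_
    have := φ.le_opNorm (e.symm y)
    rwa [e.symm.norm_map] at this

/-- An element of the bipolar of `p` is controlled by restrictions of functionals to `p`. -/
theorem norm_le_of_mem_bipolar (p : Submodule ℂ E) (e : StrongDual ℂ (StrongDual ℂ E))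
    (he : ∀ φ : StrongDual ℂ E, (∀ f ∈ p, φ f = 0) → e φ = 0) (φ : StrongDual ℂ E) {D : ℝ}
    (hD : 0 ≤ D) (h : ∀ f ∈ p, ‖φ f‖ ≤ D * ‖f‖) : ‖e φ‖ ≤ ‖e‖ * D := by
  -- Hahn–Banach: `ψ` extends `φ|_p` without increasing its norm, and `e` cannot distinguish `φ`
  -- from `ψ` because they agree on `p`.
  obtain ⟨ψ, h1, h2⟩ := exists_extension_norm_eq p (φ ∘L p.subtypeL)
  have h3 : ‖ψ‖ ≤ D := by
    rw [h2]
    exact ContinuousLinearMap.opNorm_le_bound _ hD fun f => h f.1 f.2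
  have h4 : e φ = e ψ := by
    rw [← sub_eq_zero, ← map_sub]
    refine he _ fun f hf => ?_
    have := h1 ⟨f, hf⟩
    simp only [sub_apply] at this ⊢
    rw [this]
    simp
  rw [h4]
  exact (e.le_opNorm ψ).trans (mul_le_mul_of_nonneg_left h3 (norm_nonneg _))

/-- Banach–Alaoglu in the bidual: the image of the unit ball lies in a weak-star compact ball. -/
theorem exists_weakStar_limit {E : Type u} [NormedAddCommGroup E] [NormedSpace ℂ E]
    (l : Ultrafilter E) (hl : ∀ᶠ h in (l : Filter E), ‖h‖ ≤ 1) :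
    ∃ e : Bidual E, ∀ φ : Dual E, Tendsto (fun h => φ h) l (𝓝 (e φ)) := by
  let j : E → WeakDual ℂ (Dual E) := fun h =>
    StrongDual.toWeakDual (NormedSpace.inclusionInDoubleDual ℂ E h)
  have hball : ∀ᶠ h in (l : Filter E), j h ∈ WeakDual.toStrongDual ⁻¹'
      Metric.closedBall (0 : Bidual E) 1 := by
    filter_upwards [hl] with h hh
    refine (mem_closedBall_zero_iff (E := Bidual E)).2 ?_
    exact (NormedSpace.double_dual_bound ℂ E h).trans hh
  obtain ⟨w, -, hw⟩ := (WeakDual.isCompact_closedBall (𝕜 := ℂ)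
    (0 : Bidual E) 1).ultrafilter_le_nhds (l.map j) (le_principal_iff.2 hball)
  refine ⟨WeakDual.toStrongDual w, fun φ => ?_⟩
  have h1 : Tendsto j l (𝓝 w) := hw
  exact ((WeakDual.eval_continuous φ).tendsto w).comp h1

/-- Rotate `b` into the direction of `a`. -/
theorem exists_phase (a b : ℂ) : ∃ c : ℂ, ‖c‖ ≤ 1 ∧ ‖a + c * b‖ = ‖a‖ + ‖b‖ := by
  rcases eq_or_ne b 0 with h0 | h0
  · exact ⟨0, by simp, by simp [h0]⟩
  rcases eq_or_ne a 0 with h1 | h1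
  · exact ⟨1, by simp, by simp [h1]⟩
  have n1 : (‖a‖ : ℂ) ≠ 0 := by simpa using h1
  refine ⟨(a / ‖a‖) * (‖b‖ / b), ?_, ?_⟩
  · rw [norm_mul, norm_div, norm_div, Complex.norm_real, Complex.norm_real, norm_norm, norm_norm,
      div_self (norm_ne_zero_iff.2 h1), div_self (norm_ne_zero_iff.2 h0), one_mul]
  · have : a + a / ‖a‖ * (‖b‖ / b) * b = (a / ‖a‖) * ((‖a‖ + ‖b‖ : ℝ) : ℂ) := by
      push_cast; field_simp
    rw [this, norm_mul, norm_div, Complex.norm_real, Complex.norm_real, norm_norm,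
      div_self (norm_ne_zero_iff.2 h1), one_mul, Real.norm_of_nonneg (by positivity)]

end Functional

/-! ### Functionals on `C₀(X)` -/

section C0Functional

variable {X : Type u} [TopologicalSpace X]

/-- A functional on `C₀(X)` is small on the functions supported in `U` away from a large
compact subset of `U`. -/
theorem exists_compact_functional_small (φ : Dual C₀(X, ℂ)) (U : Set X) {δ : ℝ}
    (hδ : 0 < δ) : ∃ K ⊆ U, IsCompact K ∧
      ∀ f ∈ c0Sub U, (∀ x ∈ K, f x = 0) → ‖φ f‖ ≤ δ * ‖f‖ := by
  obtain ⟨N, hN, hNle, hNnear⟩ := exists_near_norming (c0Sub U) φ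
  -- Half of `δ` is spent on the near-norming `g`, the other half on making its support a compact `K
  -- ⊆ U`.
  obtain ⟨g, hgU, hg1, hg2⟩ := hNnear (δ / 2) (by linarith)
  obtain ⟨ε, hε, hε'⟩ : ∃ ε > 0, N * ε ≤ δ / 2 := by
    refine ⟨δ / 2 / (N + 1), by positivity, ?_⟩
    rw [mul_div_assoc', div_le_iff₀ (by positivity)]
    nlinarith
  obtain ⟨K, hKU, hK, hK0⟩ := exists_compact_softC0 hgU hε
  set g' := softC0 ε hε g with hg'
  have hg'U : g' ∈ c0Sub U := softC0_mem hgU hε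
  have hg'1 : ‖g'‖ ≤ 1 := (norm_softC0_le hε _).trans hg1
  have hg'2 : N - δ ≤ ‖φ g'‖ := by
    have h1 := hNle (g - g') ((c0Sub U).sub_mem hgU hg'U)
    have h2 : N * ‖g - g'‖ ≤ N * ε :=
      mul_le_mul_of_nonneg_left (norm_sub_softC0_le hε _) hN
    have h3 : ‖φ g‖ ≤ ‖φ g'‖ + ‖φ (g - g')‖ := by
      calc ‖φ g‖ = ‖φ g' + φ (g - g')‖ := by rw [map_sub]; congr 1; ring
        _ ≤ _ := norm_add_le _ _
    linarith
  refine ⟨K, hKU, hK, fun f hf hfK => ?_⟩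
  rcases eq_or_ne f 0 with rfl | hf0
  · simp
  have hfn : 0 < ‖f‖ := norm_pos_iff.2 hf0
  -- `g'` vanishes off `K` and `f` on `K`, so `g' + c f / ‖f‖` remains in the unit ball while its
  -- value has modulus `|φ g'| + |φ f| / ‖f‖`. This is at most `N`, and `|φ g'| ≥ N - δ` leaves only
  -- `δ` for the second term.
  obtain ⟨c, hc1, hc2⟩ := exists_phase (φ g') (φ f / ‖f‖)
  have hsum : ‖g' + (c / ‖f‖) • f‖ ≤ 1 := by
    refine c0_norm_le_of _ zero_le_one fun x => ?_
    rw [ZeroAtInftyContinuousMap.add_apply, ZeroAtInftyContinuousMap.smul_apply, smul_eq_mul]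
    by_cases hx : x ∈ K
    · rw [hfK x hx, mul_zero, add_zero]
      exact (c0_norm_le g' x).trans hg'1
    · rw [hK0 x hx, zero_add, norm_mul, norm_div, Complex.norm_real, norm_norm,
        div_mul_eq_mul_div, div_le_one hfn]
      exact (mul_le_of_le_one_left (norm_nonneg _) hc1).trans (c0_norm_le f x)
  have h1 := hNle _ ((c0Sub U).add_mem hg'U ((c0Sub U).smul_mem (c / ‖f‖) hf))
  have h2 : φ (g' + (c / ‖f‖) • f) = φ g' + c * (φ f / ‖f‖) := by
    rw [map_add, map_smul, smul_eq_mul]; ring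
  rw [h2, hc2, norm_div, Complex.norm_real, norm_norm] at h1
  have h3 : ‖φ f‖ / ‖f‖ ≤ δ := by nlinarith
  rwa [div_le_iff₀ hfn] at h3

variable [T2Space X] [LocallyCompactSpace X]

/-- After thresholding `f` to compact support, a partition of unity subordinate to the `T i` splits
it into `card ι` pieces, each of norm at most `‖f‖`. -/
theorem norm_functional_le_of_iUnion {ι : Type*} [Fintype ι] (φ : Dual C₀(X, ℂ))
    {T : ι → Set X} (hT : ∀ i, IsOpen (T i)) {δ : ℝ} (hδ : 0 ≤ δ)
    (h : ∀ i, ∀ f ∈ c0Sub (T i), ‖φ f‖ ≤ δ * ‖f‖) {f : C₀(X, ℂ)}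
    (hf : f ∈ c0Sub (⋃ i, T i)) : ‖φ f‖ ≤ Fintype.card ι * δ * ‖f‖ := by
  refine le_of_forall_pos_le_add fun ε hε => ?_
  obtain ⟨ε', hε', hle⟩ : ∃ ε' > 0, ‖φ‖ * ε' ≤ ε := by
    refine ⟨ε / (‖φ‖ + 1), by positivity, ?_⟩
    rw [mul_div_assoc', div_le_iff₀ (by positivity)]
    nlinarith [norm_nonneg φ]
  obtain ⟨K, hKU, hK, hK0⟩ := exists_compact_softC0 hf hε'
  set g := softC0 ε' hε' f with hg
  obtain ⟨χ, hχ1, hχ2, hχ3⟩ := exists_c0_partition hK hT hKU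
  have hsum : g = ∑ i, χ i * g := by
    ext x
    rw [← Finset.sum_mul, ZeroAtInftyContinuousMap.mul_apply]
    by_cases hx : x ∈ K
    · have : (∑ i, χ i) x = 1 := by
        rw [← hχ2 x hx]
        exact map_sum (⟨⟨fun f : C₀(X, ℂ) => f x, rfl⟩, fun _ _ => rfl⟩ : C₀(X, ℂ) →+ ℂ) χ _
      rw [this, one_mul]
    · rw [hK0 x hx, mul_zero]
  have hgn : ‖g‖ ≤ ‖f‖ := norm_softC0_le hε' f
  have h1 : ‖φ g‖ ≤ Fintype.card ι * δ * ‖f‖ := by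
    rw [hsum, map_sum]
    refine (norm_sum_le _ _).trans ?_
    have : ∀ i ∈ (Finset.univ : Finset ι), ‖φ (χ i * g)‖ ≤ δ * ‖f‖ := fun i _ => by
      refine (h i _ (mul_mem_c0Sub_left (hχ1 i) g)).trans (mul_le_mul_of_nonneg_left ?_ hδ)
      refine (norm_mul_le _ _).trans ((mul_le_of_le_one_left (norm_nonneg _) ?_).trans hgn)
      exact c0_norm_le_of _ zero_le_one (hχ3 i)
    refine (Finset.sum_le_sum this).trans ?_
    rw [Finset.sum_const, Finset.card_univ, nsmul_eq_mul, mul_assoc]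
  calc ‖φ f‖ = ‖φ g + φ (f - g)‖ := by rw [map_sub]; congr 1; ring
    _ ≤ ‖φ g‖ + ‖φ (f - g)‖ := norm_add_le _ _
    _ ≤ _ := add_le_add h1 (((φ.le_opNorm _).trans (mul_le_mul_of_nonneg_left
        (norm_sub_softC0_le hε' f) (norm_nonneg _))).trans hle)

/-- The functions with values in `[0, 1]` that are supported in `U` and equal to `1` on `K`. -/
def bumpSet (U K : Set X) : Set C₀(X, ℂ) :=
  {h | h ∈ c0Sub U ∧ (∀ x ∈ K, h x = 1) ∧ ∀ x, ∃ r ∈ Set.Icc (0 : ℝ) 1, h x = r}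

theorem norm_le_one_of_mem_bumpSet {U K : Set X} {h : C₀(X, ℂ)} (hh : h ∈ bumpSet U K) :
    ‖h‖ ≤ 1 := c0_norm_le_of _ zero_le_one fun x => by
  obtain ⟨r, hr, hx⟩ := hh.2.2 x
  rw [hx, Complex.norm_real, Real.norm_of_nonneg hr.1]
  exact hr.2

theorem norm_sub_mul_le_of_mem_bumpSet {U K : Set X} {h : C₀(X, ℂ)} (hh : h ∈ bumpSet U K)
    (f : C₀(X, ℂ)) : ‖f - h * f‖ ≤ ‖f‖ := c0_norm_le_of _ (norm_nonneg f) fun x => by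
  obtain ⟨r, hr, hx⟩ := hh.2.2 x
  have : (f - h * f) x = ((1 - r : ℝ) : ℂ) * f x := by
    rw [ZeroAtInftyContinuousMap.sub_apply, ZeroAtInftyContinuousMap.mul_apply, hx]
    push_cast; ring
  rw [this, norm_mul, Complex.norm_real, Real.norm_of_nonneg (by linarith [hr.2])]
  exact (mul_le_of_le_one_left (norm_nonneg _) (by linarith [hr.1])).trans (c0_norm_le f x)

/-- The net of bump functions supported in `U` converges weak-star in the bidual. -/
theorem exists_bump_limit {U : Set X} (hU : IsOpen U) :
    ∃ (e : Bidual C₀(X, ℂ)) (l : Filter C₀(X, ℂ)), l.NeBot ∧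
      (∀ K ⊆ U, IsCompact K → bumpSet U K ∈ l) ∧ ∀ φ, Tendsto (fun h => φ h) l (𝓝 (e φ)) := by
  let κ := {K : Set X // K ⊆ U ∧ IsCompact K}
  let l₀ : Filter C₀(X, ℂ) := ⨅ K : κ, 𝓟 (bumpSet U K.1)
  have hne : l₀.NeBot := by
    have : Nonempty κ := ⟨⟨∅, Set.empty_subset _, isCompact_empty⟩⟩
    refine iInf_neBot_of_directed' ?_ fun K => ?_
    · intro K L
      refine ⟨⟨K.1 ∪ L.1, Set.union_subset K.2.1 L.2.1, K.2.2.union L.2.2⟩, ?_, ?_⟩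
      · exact principal_mono.2 fun h hh => ⟨hh.1, fun x hx => hh.2.1 x (Or.inl hx), hh.2.2⟩
      · exact principal_mono.2 fun h hh => ⟨hh.1, fun x hx => hh.2.1 x (Or.inr hx), hh.2.2⟩
    · obtain ⟨h, h1, h2, h3⟩ := exists_c0_bump K.2.2 hU K.2.1
      exact principal_neBot_iff.2 ⟨h, h1, h2, h3⟩
  -- Passing to an ultrafilter turns weak-star compactness into convergence against all functionals
  -- at once.
  let l : Ultrafilter C₀(X, ℂ) := Ultrafilter.of l₀
  have hl : ∀ K ⊆ U, IsCompact K → bumpSet U K ∈ (l : Filter C₀(X, ℂ)) := fun K h1 h2 =>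
    Ultrafilter.of_le l₀ (mem_iInf_of_mem ⟨K, h1, h2⟩ (mem_principal_self _))
  obtain ⟨e, he⟩ := exists_weakStar_limit l (by
    filter_upwards [hl ∅ (Set.empty_subset _) isCompact_empty] with h hh
    exact norm_le_one_of_mem_bumpSet hh)
  exact ⟨e, l, l.neBot, hl, he⟩

/-- Once `h = 1` on the compact set where `φ` is concentrated, `f - h f` vanishes there. The
estimate is uniform in `f`, which is what later allows limits inside Arens products. -/
theorem eventually_functional_small {U : Set X} {l : Filter C₀(X, ℂ)}
    (hl : ∀ K ⊆ U, IsCompact K → bumpSet U K ∈ l) (φ : Dual C₀(X, ℂ)) {δ : ℝ}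
    (hδ : 0 < δ) : ∀ᶠ h in l, ∀ f ∈ c0Sub U, ‖φ (f - h * f)‖ ≤ δ * ‖f‖ := by
  obtain ⟨K, hKU, hK, hKφ⟩ := exists_compact_functional_small φ U hδ
  filter_upwards [hl K hKU hK] with h hh f hf
  refine (hKφ _ ((c0Sub U).sub_mem hf (mul_mem_c0Sub_right hf h)) fun x hx => ?_).trans
    (mul_le_mul_of_nonneg_left (norm_sub_mul_le_of_mem_bumpSet hh f) hδ.le)
  rw [ZeroAtInftyContinuousMap.sub_apply, ZeroAtInftyContinuousMap.mul_apply, hh.2.1 x hx, one_mul,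
    sub_self]

/-- The functional `a ↦ φ (a * c)`. -/
def dualMul (c : C₀(X, ℂ)) (φ : Dual C₀(X, ℂ)) : Dual C₀(X, ℂ) :=
  φ ∘L (ContinuousLinearMap.mul ℂ C₀(X, ℂ)).flip c

theorem dualMul_apply (c : C₀(X, ℂ)) (φ : Dual C₀(X, ℂ)) (a : C₀(X, ℂ)) :
    dualMul c φ a = φ (a * c) := rfl

/-- `e` is a left unit of the bidual of `C₀(U)`, acting on `C₀(U)`. -/
structure IsBidualUnit (U : Set X) (e : Bidual C₀(X, ℂ)) : Prop where
  bipolar : ∀ φ : Dual C₀(X, ℂ), (∀ f ∈ c0Sub U, φ f = 0) → e φ = 0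
  unit : ∀ φ : Dual C₀(X, ℂ), ∀ b ∈ c0Sub U, e (dualMul b φ) = φ b

/-- Since `h c ∈ C₀(U)`, the unit property rewrites `φ (h c)` as `e` applied to `φ(· h c)`. On
`C₀(U)` this functional is close to `φ(· c)`, and `e` sees only restrictions to `C₀(U)`. -/
theorem IsBidualUnit.norm_sub_le {U K : Set X} {e : Bidual C₀(X, ℂ)}
    (he : IsBidualUnit U e) (φ : Dual C₀(X, ℂ)) {δ : ℝ} (hδ : 0 ≤ δ)
    (hK : ∀ f ∈ c0Sub U, (∀ x ∈ K, f x = 0) → ‖φ f‖ ≤ δ * ‖f‖) {h : C₀(X, ℂ)}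
    (hh : h ∈ bumpSet U K) (c : C₀(X, ℂ)) :
    ‖e (dualMul c φ) - φ (h * c)‖ ≤ ‖e‖ * (δ * ‖c‖) := by
  have hhc : h * c ∈ c0Sub U := mul_mem_c0Sub_left hh.1 c
  rw [← he.unit φ _ hhc, ← map_sub]
  refine norm_le_of_mem_bipolar (c0Sub U) e he.bipolar _ (by positivity) fun f hf => ?_
  have h1 : (dualMul c φ - dualMul (h * c) φ) f = φ (f * c - h * (f * c)) := by
    rw [sub_apply, dualMul_apply, dualMul_apply, ← map_sub, mul_left_comm]
  rw [h1]
  have h2 : f * c ∈ c0Sub U := mul_mem_c0Sub_left hf c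
  refine (hK _ ((c0Sub U).sub_mem h2 (mul_mem_c0Sub_right h2 h)) fun x hx => ?_).trans ?_
  · change (f * c) x - h x * (f * c) x = 0
    rw [hh.2.1 x hx, one_mul, sub_self]
  · rw [mul_assoc]
    refine mul_le_mul_of_nonneg_left ((norm_sub_mul_le_of_mem_bumpSet hh _).trans ?_) hδ
    rw [mul_comm ‖c‖]
    exact norm_mul_le _ _

theorem c0_sum_apply {ι : Type*} (s : Finset ι) (f : ι → C₀(X, ℂ)) (x : X) :
    (∑ i ∈ s, f i) x = ∑ i ∈ s, f i x :=
  map_sum (⟨⟨fun f : C₀(X, ℂ) => f x, rfl⟩, fun _ _ => rfl⟩ : C₀(X, ℂ) →+ ℂ) f s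

open Classical in
/-- The combination of the units of the biduals of `C₀(U k)` with coefficients in `C₀(X)` is
controlled by the supremum of the corresponding combination of characteristic functions. -/
theorem norm_sum_bidualUnit_sub_le {ι : Type*} [Fintype ι] {U : ι → Set X}
    (hU : ∀ i, IsOpen (U i)) {e : ι → Bidual C₀(X, ℂ)}
    (he : ∀ i, IsBidualUnit (U i) (e i)) (c : ι → C₀(X, ℂ)) (a : C₀(X, ℂ)) {M : ℝ} (hM : 0 ≤ M)
    (hle : ∀ x, ‖∑ i, (if x ∈ U i then c i x else 0) - a x‖ ≤ M) (φ : Dual C₀(X, ℂ)) :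
    ‖∑ i, e i (dualMul (c i) φ) - φ a‖ ≤ M * ‖φ‖ := by
  set B : ℝ := ∑ i, ‖c i‖ + ‖a‖ with hB
  have hB0 : 0 ≤ B := by positivity
  -- The bracket collects three errors: truncation at `M + δ` instead of `M`, the part living on the
  -- sets `U i \ K i`, and the replacement of each unit `e i` by a bump function `h i`.
  suffices H : ∀ δ > 0, ‖∑ i, e i (dualMul (c i) φ) - φ a‖ ≤
      M * ‖φ‖ + δ * (‖φ‖ + Fintype.card ι * B + ∑ i, ‖e i‖ * ‖c i‖) by
    set Q : ℝ := ‖φ‖ + Fintype.card ι * B + ∑ i, ‖e i‖ * ‖c i‖ with hQ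
    have hQ0 : 0 ≤ Q := by positivity
    refine le_of_forall_pos_le_add fun ε hε => (H (ε / (Q + 1)) (by positivity)).trans ?_
    gcongr
    rw [div_mul_eq_mul_div, div_le_iff₀ (by positivity)]
    nlinarith
  intro δ hδ
  choose K hKU hK hKφ using fun i => exists_compact_functional_small φ (U i) hδ
  choose h hh using fun i => exists_c0_bump (hK i) (hU i) (hKU i)
  have hb : ∀ i, h i ∈ bumpSet (U i) (K i) := fun i => hh i
  set F : C₀(X, ℂ) := ∑ i, h i * c i - a with hF
  have hFx : ∀ x, F x = ∑ i, h i x * c i x - a x := fun x => by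
    rw [hF, ZeroAtInftyContinuousMap.sub_apply, c0_sum_apply]; rfl
  have hMδ : 0 < M + δ := by linarith
  -- Outside the sets `U i \ K i`, each `h i` equals the characteristic function of `U i`, so there
  -- `|F| ≤ M` and `R = 0`. Thus `F` splits into `F - R`, of norm at most `M + δ`, and `R`,
  -- supported where `φ` is small.
  set R := softC0 (M + δ) hMδ F with hR
  have hRmem : R ∈ c0Sub (⋃ i, U i \ K i) := fun x hx => by
    rw [Set.mem_iUnion, not_exists] at hx
    refine softThreshold_of_norm_le hMδ ?_
    have : F x = ∑ i, (if x ∈ U i then c i x else 0) - a x := by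
      rw [hFx]
      congr 1
      refine Finset.sum_congr rfl fun i _ => ?_
      split_ifs with hxi
      · have hxK : x ∈ K i := by
          by_contra h'
          exact hx i ⟨hxi, h'⟩
        rw [(hb i).2.1 x hxK, one_mul]
      · rw [(hb i).1 x hxi, zero_mul]
    rw [this]
    linarith [hle x]
  have hFn : ‖F‖ ≤ B := by
    refine (norm_sub_le _ _).trans (add_le_add ((norm_sum_le _ _).trans
      (Finset.sum_le_sum fun i _ => (norm_mul_le _ _).trans ?_)) le_rfl)
    exact mul_le_of_le_one_left (norm_nonneg _) (norm_le_one_of_mem_bumpSet (hb i))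
  have h1 : ‖φ R‖ ≤ Fintype.card ι * δ * B := by
    refine (norm_functional_le_of_iUnion φ (fun i => (hU i).sdiff (hK i).isClosed) hδ.le
      (fun i f hf => hKφ i f (fun x hx => hf x fun h' => hx h'.1) fun x hx =>
        hf x fun h' => h'.2 hx) hRmem).trans ?_
    exact mul_le_mul_of_nonneg_left ((norm_softC0_le hMδ F).trans hFn) (by positivity)
  have h2 : ‖φ (F - R)‖ ≤ ‖φ‖ * (M + δ) :=
    (φ.le_opNorm _).trans (mul_le_mul_of_nonneg_left (norm_sub_softC0_le hMδ F) (norm_nonneg _))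
  have h3 : ‖∑ i, (e i (dualMul (c i) φ) - φ (h i * c i))‖ ≤ δ * ∑ i, ‖e i‖ * ‖c i‖ := by
    refine (norm_sum_le _ _).trans ?_
    rw [Finset.mul_sum]
    refine Finset.sum_le_sum fun i _ => ?_
    refine ((he i).norm_sub_le φ hδ.le (hKφ i) (hb i) (c i)).trans_eq ?_
    ring
  have h4 : ∑ i, e i (dualMul (c i) φ) - φ a =
      ∑ i, (e i (dualMul (c i) φ) - φ (h i * c i)) + (φ (F - R) + φ R) := by
    rw [Finset.sum_sub_distrib, ← map_add, sub_add_cancel, hF, map_sub, map_sum]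
    ring
  rw [h4]
  refine (norm_add_le _ _).trans ((add_le_add h3 ((norm_add_le _ _).trans
    (add_le_add h2 h1))).trans_eq ?_)
  ring

/-- Evaluation at a point, as a functional on `C₀(X)`. -/
def evalC0 (x : X) : Dual C₀(X, ℂ) :=
  LinearMap.mkContinuous (⟨⟨fun f => f x, fun _ _ => rfl⟩, fun _ _ => rfl⟩ : C₀(X, ℂ) →ₗ[ℂ] ℂ) 1
    fun f => by simpa using c0_norm_le f x

theorem evalC0_apply (x : X) (f : C₀(X, ℂ)) : evalC0 x f = f x := rfl

-- For `x ∈ U`, multiplying `c` by a bump equal to `1` at `x` brings it into `C₀(U)` without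
-- changing the functional. For `x ∉ U`, the functional kills `C₀(U)`.
open Classical in
theorem IsBidualUnit.dualMul_evalC0 {U : Set X} (hU : IsOpen U)
    {e : Bidual C₀(X, ℂ)} (he : IsBidualUnit U e) (c : C₀(X, ℂ)) (x : X) :
    e (dualMul c (evalC0 x)) = if x ∈ U then c x else 0 := by
  split_ifs with hx
  · obtain ⟨h, h1, h2, -⟩ := exists_c0_bump isCompact_singleton hU (Set.singleton_subset_iff.2 hx)
    have : dualMul c (evalC0 x) = dualMul (h * c) (evalC0 x) := by
      ext f
      simp [dualMul_apply, evalC0_apply, h2 x rfl]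
    rw [this, he.unit _ _ (mul_mem_c0Sub_left h1 c), evalC0_apply,
      ZeroAtInftyContinuousMap.mul_apply, h2 x rfl, one_mul]
  · refine he.bipolar _ fun f hf => ?_
    rw [dualMul_apply, evalC0_apply, ZeroAtInftyContinuousMap.mul_apply, hf x hx, zero_mul]

end C0Functional

open InverseMonoid

/-! ### The Fell bundle of an action -/

namespace PartialAction

variable {S : Type u} [InverseMonoid S] {X : Type u} [TopologicalSpace X] (α : PartialAction S X)

theorem target_one : (α.act 1).target = Set.univ := by
  rw [α.act_one.target_eq]; rfl

theorem act_one_symm_apply (x : X) : (α.act 1).symm x = x :=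
  α.act_one.symm_eqOn_target (by rw [target_one]; trivial)

theorem target_mul_inv (s : S) : (α.act (s * s⁻¹)).target = (α.act s).target := by
  ext x
  rw [mem_target_mul, target_inv]
  exact ⟨fun h => h.1, fun h => ⟨h, (α.act s).map_target h⟩⟩

/-- The union of the domains of the `v` with `v ≤ s` and `v ≤ 1`. -/
def unitSet (s : S) : Set X :=
  ⋃ v : {v : S // NatLE v s ∧ NatLE v 1}, (α.act (v.1⁻¹ * v.1)).target

theorem isOpen_unitSet (s : S) : IsOpen (α.unitSet s) :=
  isOpen_iUnion fun _ => (α.act _).open_target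

variable [T2Space X]

/-- The inclusion of a fibre into `C₀(X)`. -/
def toC0 (s : S) : α.fellBundle.Fib s →ₗᵢ[ℂ] C₀(X, ℂ) where
  toFun f := f.1
  map_add' _ _ := rfl
  map_smul' _ _ := rfl
  norm_map' _ := rfl

theorem toC0_mem {s : S} (f : α.fellBundle.Fib s) : α.toC0 s f ∈ c0Sub (α.act s).target := f.2

/-- A function in `C₀(ran αₛ)` as an element of the fibre over `s`. -/
def ofC0 {s : S} (f : C₀(X, ℂ)) (hf : f ∈ c0Sub (α.act s).target) : α.fellBundle.Fib s := ⟨f, hf⟩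

theorem toC0_ofC0 {s : S} (f : C₀(X, ℂ)) (hf : f ∈ c0Sub (α.act s).target) :
    α.toC0 s (α.ofC0 f hf) = f := rfl

theorem toC0_lmul (s : S) (a : α.fellBundle.Fib 1) (b : α.fellBundle.Fib s) :
    α.toC0 s (α.fellBundle.lmul s a b) = α.toC0 1 a * α.toC0 s b := by
  ext x
  change a.1 x * b.1 ((α.act 1).symm x) = a.1 x * b.1 x
  rw [act_one_symm_apply]

theorem toC0_rmul_apply (s : S) (a : α.fellBundle.Fib s) (b : α.fellBundle.Fib 1) (x : X) :
    α.toC0 s (α.fellBundle.rmul s a b) x = α.toC0 s a x * α.toC0 1 b ((α.act s).symm x) := rfl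

theorem toC0_starOne_apply (a : α.fellBundle.Fib 1) (x : X) :
    α.toC0 1 (α.fellBundle.starOne a) x = conj (α.toC0 1 a x) := by
  change (α.fibStar 1 a).1 x = conj (a.1 x)
  have hx : x ∈ (α.act 1).source := by rw [α.act_one.source_eq]; trivial
  rw [fibStar_of_mem α 1 a hx]
  congr 2
  exact α.act_one.eqOn hx

theorem mem_idemIdeal_iff {e : S} (he : e * e = e) (f : α.fellBundle.Fib 1) :
    f ∈ α.fellBundle.idemIdeal e he ↔ α.toC0 1 f ∈ c0Sub (α.act e).target := by
  constructor
  · rintro ⟨g, rfl⟩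
    exact g.2
  · intro h
    exact ⟨α.ofC0 _ h, rfl⟩

/-- `C₀(X)` is the fibre over `1`. -/
def ofC0One : C₀(X, ℂ) →ₗᵢ[ℂ] α.fellBundle.Fib 1 where
  toFun f := α.ofC0 f fun x hx => (hx (by rw [target_one]; trivial)).elim
  map_add' _ _ := rfl
  map_smul' _ _ := rfl
  norm_map' _ := rfl

theorem toC0_ofC0One (f : C₀(X, ℂ)) : α.toC0 1 (α.ofC0One f) = f := rfl

variable [LocallyCompactSpace X]

/-- `C₀(U)`, with `U` the union of the generating domains, is itself a closed ideal containing the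
generators. Conversely, a compactly supported function on `U` meets finitely many domains, so a
partition of unity puts it into every competing ideal, and thresholds are dense in `C₀(U)`. -/
theorem mem_idealOf_iff (s : S) (f : α.fellBundle.Fib 1) :
    f ∈ α.fellBundle.idealOf s 1 ↔ α.toC0 1 f ∈ c0Sub (α.unitSet s) := by
  constructor
  · intro hf
    refine Submodule.mem_sInf.1 hf ((c0Sub (α.unitSet s)).comap (α.toC0 1).toLinearMap) ⟨?_, ?_, ?_⟩
    · exact (c0_isClosed_vanishing (α.unitSet s)).preimage (α.toC0 1).continuous
    · intro a b hb
      rw [Submodule.mem_comap] at hb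
      refine ⟨?_, ?_⟩
      · change α.toC0 1 _ ∈ c0Sub (α.unitSet s)
        rw [toC0_lmul]
        exact mul_mem_c0Sub_right hb _
      · change α.toC0 1 _ ∈ c0Sub (α.unitSet s)
        rw [toC0_lmul]
        exact mul_mem_c0Sub_left hb _
    · intro v h1 h2 b hb
      rw [mem_idemIdeal_iff] at hb
      exact fun x hx => hb x fun h => hx (Set.mem_iUnion.2 ⟨⟨v, h1, h2⟩, h⟩)
  · intro hf
    refine Submodule.mem_sInf.2 fun J hJ => ?_
    obtain ⟨hJc, hJi, hJv⟩ := hJ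
    have key : ∀ δ, ∀ hδ : 0 < δ, α.ofC0One (softC0 δ hδ (α.toC0 1 f)) ∈ J := fun δ hδ => by
      obtain ⟨K, hKU, hK, hK0⟩ := exists_compact_softC0 hf hδ
      obtain ⟨T, hT⟩ := hK.elim_finite_subcover _ (fun v => (α.act _).open_target) hKU
      obtain ⟨χ, hχ1, hχ2, -⟩ := exists_c0_partition (ι := T)
        (U := fun v => (α.act (v.1.1⁻¹ * v.1.1)).target) hK (fun v => (α.act _).open_target)
        (by simpa [Set.iUnion_subtype] using hT)
      have hsum : softC0 δ hδ (α.toC0 1 f) = ∑ i, χ i * softC0 δ hδ (α.toC0 1 f) := by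
        ext x
        rw [← Finset.sum_mul, ZeroAtInftyContinuousMap.mul_apply, c0_sum_apply]
        by_cases hx : x ∈ K
        · rw [hχ2 x hx, one_mul]
        · rw [hK0 x hx, mul_zero]
      rw [hsum, map_sum]
      refine J.sum_mem fun v _ => hJv v.1.1 v.1.2.1 v.1.2.2 ?_
      rw [mem_idemIdeal_iff, toC0_ofC0One]
      exact mul_mem_c0Sub_left (hχ1 v) _
    have hcl : f ∈ closure (J : Set (α.fellBundle.Fib 1)) := by
      refine Metric.mem_closure_iff.2 fun ε hε => ⟨_, key (ε / 2) (by linarith), ?_⟩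
      rw [dist_eq_norm, ← (α.toC0 1).norm_map, map_sub, toC0_ofC0One]
      exact (norm_sub_softC0_le _ _).trans_lt (by linarith)
    rwa [hJc.closure_eq] at hcl

/-- The unit is the weak-star limit of bump functions increasing to the characteristic function of
`unitSet s`. -/
theorem exists_isUnitOf (s : S) :
    ∃ e, α.fellBundle.IsUnitOf (α.fellBundle.idealOf s 1) e := by
  obtain ⟨e, l, hne, hl, hlim⟩ := exists_bump_limit (α.isOpen_unitSet s)
  let r : Dual (α.fellBundle.Fib 1) →L[ℂ] Dual C₀(X, ℂ) :=
    (ContinuousLinearMap.compL ℂ C₀(X, ℂ) (α.fellBundle.Fib 1) ℂ).flip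
      α.ofC0One.toContinuousLinearMap
  have hr : ∀ ψ f, r ψ f = ψ (α.ofC0One f) := fun _ _ => rfl
  have hsmall : ∀ ψ : Dual (α.fellBundle.Fib 1), ∀ δ > 0, ∀ᶠ h in l,
      ∀ b ∈ α.fellBundle.idealOf s 1,
        ‖ψ (b - α.fellBundle.lmul 1 (α.ofC0One h) b)‖ ≤ δ * ‖b‖ := fun ψ δ hδ => by
    filter_upwards [eventually_functional_small hl (r ψ) hδ] with h hh b hb
    have h1 := hh (α.toC0 1 b) ((α.mem_idealOf_iff s b).1 hb)
    rw [(α.toC0 1).norm_map, hr, map_sub] at h1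
    have h2 : α.ofC0One (h * α.toC0 1 b) = α.fellBundle.lmul 1 (α.ofC0One h) b := by
      apply (α.toC0 1).injective
      rw [toC0_lmul]; rfl
    rwa [h2] at h1
  have hcomm : ∀ a b, α.fellBundle.lmul 1 a b = α.fellBundle.lmul 1 b a := fun a b => by
    apply (α.toC0 1).injective
    rw [toC0_lmul, toC0_lmul, mul_comm]
  have hbip : e ∘L r ∈ α.fellBundle.bidualOf (α.fellBundle.idealOf s 1) := fun φ hφ => by
    refine tendsto_nhds_unique (hlim (r φ)) (tendsto_const_nhds.congr' ?_)
    filter_upwards [hl ∅ (Set.empty_subset _) isCompact_empty] with h hh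
    exact (hφ _ ((α.mem_idealOf_iff s _).2 hh.1)).symm
  refine ⟨e ∘L r, hbip, fun x hx => ⟨?_, ?_⟩⟩
  -- The product `e x` at `φ` is the limit of `x (φ (h ·))` over bumps `h`. As `x` depends only on
  -- restrictions to the ideal, uniform smallness of `φ (b - h b)` suffices.
  · ext φ
    rw [arens_apply]
    refine tendsto_nhds_unique (hlim _) ?_
    rw [Metric.tendsto_nhds]
    intro ε hε
    obtain ⟨δ, hδ, hlt⟩ : ∃ δ > 0, ‖x‖ * δ < ε := by
      refine ⟨ε / (‖x‖ + 1), by positivity, ?_⟩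
      rw [mul_div_assoc', div_lt_iff₀ (by positivity)]
      nlinarith [norm_nonneg x]
    filter_upwards [hsmall φ δ hδ] with h hh
    rw [dist_comm, dist_eq_norm]
    refine lt_of_le_of_lt ?_ hlt
    change ‖x φ - x (φ ∘L α.fellBundle.lmul 1 (α.ofC0One h))‖ ≤ _
    rw [← map_sub]
    refine norm_le_of_mem_bipolar _ x hx _ hδ.le fun b hb => ?_
    have := hh b hb
    rwa [map_sub] at this
  -- Here `x` is the outer factor, so it is enough to compare the two functionals on elements `b` of
  -- the ideal, where the claim is `φ (b h) → φ b`.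
  · ext φ
    rw [arens_apply, ← sub_eq_zero, ← map_sub]
    refine hx _ fun b hb => ?_
    rw [sub_apply, sub_eq_zero]
    refine tendsto_nhds_unique (hlim (r (φ ∘L α.fellBundle.lmul 1 b))) ?_
    rw [Metric.tendsto_nhds]
    intro ε hε
    obtain ⟨δ, hδ, hlt⟩ : ∃ δ > 0, δ * ‖b‖ < ε := by
      refine ⟨ε / (‖b‖ + 1), by positivity, ?_⟩
      rw [div_mul_eq_mul_div, div_lt_iff₀ (by positivity)]
      nlinarith [norm_nonneg b]
    filter_upwards [hsmall φ δ hδ] with h hh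
    rw [dist_comm, dist_eq_norm]
    refine lt_of_le_of_lt ?_ hlt
    have := hh b hb
    rwa [map_sub, hcomm] at this

/-- The default value `0` of `unitProj` never occurs for an action. -/
theorem isUnitOf_unitProj (s : S) :
    α.fellBundle.IsUnitOf (α.fellBundle.idealOf s 1) (α.fellBundle.unitProj s) := by
  have h := α.exists_isUnitOf s
  rw [FellBundle.unitProj, dif_pos h]
  exact h.choose_spec

/-- The restriction of functionals along the inclusion of a fibre. -/
def dualRestrict (s : S) : Dual C₀(X, ℂ) →L[ℂ] Dual (α.fellBundle.Fib s) :=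
  (ContinuousLinearMap.compL ℂ (α.fellBundle.Fib s) C₀(X, ℂ) ℂ).flip
    (α.toC0 s).toContinuousLinearMap

theorem dualRestrict_apply (s : S) (φ : Dual C₀(X, ℂ)) (f : α.fellBundle.Fib s) :
    α.dualRestrict s φ f = φ (α.toC0 s f) := rfl

theorem isBidualUnit_unitProj (s : S) :
    IsBidualUnit (α.unitSet s) (α.fellBundle.unitProj s ∘L α.dualRestrict 1) where
  bipolar φ hφ := (α.isUnitOf_unitProj s).1 _ fun b hb => hφ _ ((α.mem_idealOf_iff s b).1 hb)
  unit φ b hb := by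
    have hmem : toBidual (α.ofC0One b) ∈
        α.fellBundle.bidualOf (α.fellBundle.idealOf s 1) := fun ψ hψ =>
      hψ _ ((α.mem_idealOf_iff s _).2 hb)
    have h := congrArg (fun z => z (α.dualRestrict 1 φ)) ((α.isUnitOf_unitProj s).2 _ hmem).1
    simp only [arens_apply] at h
    refine Eq.trans ?_ h
    change α.fellBundle.unitProj s _ = _
    congr 1
    ext a
    change φ (α.toC0 1 a * b) = φ (α.toC0 1 (α.fellBundle.lmul 1 a (α.ofC0One b)))
    rw [toC0_lmul]; rfl

theorem arens_unitProj_toBidual (s w : S) (c : α.fellBundle.Fib s) (φ : Dual C₀(X, ℂ)) :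
    arens (α.fellBundle.lmul s) (α.fellBundle.unitProj w) (toBidual c) (α.dualRestrict s φ) =
      (α.fellBundle.unitProj w ∘L α.dualRestrict 1) (dualMul (α.toC0 s c) φ) := by
  rw [arens_apply]
  change α.fellBundle.unitProj w _ = α.fellBundle.unitProj w _
  congr 1
  ext a
  change φ (α.toC0 s (α.fellBundle.lmul s a c)) = φ (α.toC0 1 a * α.toC0 s c)
  rw [toC0_lmul]

/-- An element of `A₁` itself commutes with the bidual because `A₁` is commutative. This brings the
boundedness condition into the form with the unit on the left. -/
theorem arens_toBidual_unitProj (w : S) (c : α.fellBundle.Fib 1) :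
    arens (α.fellBundle.lmul 1) (toBidual c) (α.fellBundle.unitProj w) =
      arens (α.fellBundle.lmul 1) (α.fellBundle.unitProj w) (toBidual c) := by
  ext φ
  rw [arens_apply, arens_apply]
  change α.fellBundle.unitProj w _ = α.fellBundle.unitProj w _
  congr 1
  ext a
  change φ (α.fellBundle.lmul 1 c a) = φ (α.fellBundle.lmul 1 a c)
  congr 1
  apply (α.toC0 1).injective
  rw [toC0_lmul, toC0_lmul, mul_comm]

open Classical in
/-- The norm in the bidual of a combination of the units `1_w` is a supremum norm. -/
theorem norm_sum_arens_sub_le_iff (s : S) {ι : Type*} [Fintype ι] (w : ι → S)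
    (c : ι → α.fellBundle.Fib s) (a : α.fellBundle.Fib s) {M : ℝ} (hM : 0 ≤ M) :
    ‖∑ i, arens (α.fellBundle.lmul s) (α.fellBundle.unitProj (w i)) (toBidual (c i)) -
        toBidual a‖ ≤ M ↔
      ∀ x, ‖∑ i, (if x ∈ α.unitSet (w i) then α.toC0 s (c i) x else 0) - α.toC0 s a x‖ ≤ M := by
  have heval : ∀ φ : Dual C₀(X, ℂ),
      (∑ i, arens (α.fellBundle.lmul s) (α.fellBundle.unitProj (w i)) (toBidual (c i)) -
        toBidual a) (α.dualRestrict s φ) =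
      ∑ i, (α.fellBundle.unitProj (w i) ∘L α.dualRestrict 1) (dualMul (α.toC0 s (c i)) φ) -
        φ (α.toC0 s a) := fun φ => by
    rw [sub_apply, sum_apply]
    simp only [arens_unitProj_toBidual]
    rfl
  constructor
  · intro h x
    have h1 := heval (evalC0 x)
    simp only [(α.isBidualUnit_unitProj _).dualMul_evalC0 (α.isOpen_unitSet _), evalC0_apply] at h1
    rw [← h1]
    refine (ContinuousLinearMap.le_of_opNorm_le _ h _).trans (mul_le_of_le_one_right hM ?_)
    refine ContinuousLinearMap.opNorm_le_bound _ zero_le_one fun f => ?_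
    rw [dualRestrict_apply, one_mul, ← (α.toC0 s).norm_map]
    exact c0_norm_le _ _
  · intro h
    refine ContinuousLinearMap.opNorm_le_bound _ hM fun ψ => ?_
    -- Functionals on the fibre extend to `C₀(X)` with no larger norm, so the estimate there
    -- applies.
    obtain ⟨φ, h1, h2⟩ := exists_extension_of_linearIsometry (α.toC0 s) ψ
    have h3 : ψ = α.dualRestrict s φ := by
      ext f
      exact (h1 f).symm
    conv_lhs => rw [h3, heval φ]
    refine (norm_sum_bidualUnit_sub_le (fun i => α.isOpen_unitSet (w i))
      (fun i => α.isBidualUnit_unitProj (w i)) (fun i => α.toC0 s (c i)) (α.toC0 s a) hM h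
        φ).trans ?_
    exact mul_le_mul_of_nonneg_left h2 hM

end PartialAction

namespace TopGroupoid

/-! ### Inverse semigroups of bisections -/

section Wide

variable {G : Type u} [TopologicalSpace G] [TopGroupoid G] [IsEtale G]

theorem range_unit (x : UnitSpace G) : range x.1 = x := Subtype.ext (rng_of_unit x.2)

theorem source_unit (x : UnitSpace G) : source x.1 = x := Subtype.ext x.2

theorem inv_of_unit {x : G} (hx : src x = x) : inv x = x :=
  calc inv x = mul (inv x) (src (inv x)) := (mul_src _).symm
    _ = mul (inv x) x := by rw [src_inv, rng_of_unit hx]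
    _ = x := (inv_mul x).trans hx

theorem mul_inv_unit (x : UnitSpace G) {h : G} (hh : range h = x) : mul (inv x.1) h = h := by
  have h1 : rng h = x.1 := congrArg Subtype.val hh
  rw [inv_of_unit x.2, ← h1, rng_mul_self]

theorem mem_unit_of_idem {e : Bis G} (he : e * e = e) {g : G} (hg : g ∈ e.1) : src g = g := by
  have h1 : g ∈ (e * e).1 := by rwa [he]
  obtain ⟨a, ha, b, hb, hab, rfl⟩ := h1
  have e1 := e.2.src_inj hg hb (src_mul a b hab)
  have e2 := e.2.rng_inj hg ha (rng_mul a b hab)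
  have h3 : mul (inv a) (mul a b) = b := inv_mul_cancel_left hab
  rw [e2, inv_mul] at h3
  rw [e1, ← h3, src_src]

theorem subset_of_natLE {u v : Bis G} (h : NatLE v u) : v.1 ⊆ u.1 := by
  obtain ⟨e, he, rfl⟩ := h
  rintro _ ⟨g, hg, h, hh, hgh, rfl⟩
  have h1 := mem_unit_of_idem he hh
  rwa [← rng_of_unit h1, ← hgh, mul_src]

theorem eq_mul_of_subset {u v : Bis G} (h : v.1 ⊆ u.1) : v = u * (v⁻¹ * v) := by
  refine Subtype.ext (Set.ext fun g => ⟨fun hg => ?_, ?_⟩)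
  · refine ⟨g, h hg, src g, ⟨inv g, inv_mem_inv v hg, g, hg, src_inv g, inv_mul g⟩,
      (rng_src g).symm, mul_src g⟩
  · rintro ⟨a, ha, _, ⟨b, hb, c, hc, hbc, rfl⟩, habc, rfl⟩
    have hb' : inv b ∈ v.1 := hb
    have e1 : inv b = c := v.2.rng_inj hb' hc (by rw [rng_inv, hbc])
    rw [← e1, mul_inv] at habc ⊢
    rw [rng_rng] at habc
    rw [← habc, mul_src, u.2.src_inj ha (h hb') (by rw [habc, src_inv])]
    exact hb'

theorem idem_of_subset_one {v : Bis G} (h : v.1 ⊆ (1 : Bis G).1) : v * v = v := by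
  refine Subtype.ext (Set.ext fun g => ⟨?_, fun hg => ?_⟩)
  · rintro ⟨a, ha, b, hb, hab, rfl⟩
    have h1 : src a = a := h ha
    rwa [← h1, hab, rng_mul_self]
  · have h1 : src g = g := h hg
    exact ⟨g, hg, g, hg, by rw [h1, rng_of_unit h1], (congrArg (mul g) h1.symm).trans (mul_src g)⟩

/-- `ι : M → Bis(G)` is a homomorphism with a wide image, and `α` is the canonical action of `M`
on the unit space. -/
structure IsWideHom {M : Type u} [InverseMonoid M] (ι : M → Bis G)
    (α : PartialAction M (UnitSpace G)) : Prop where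
  map_one : ι 1 = 1
  map_mul : ∀ s t, ι (s * t) = ι s * ι t
  map_inv : ∀ s, ι s⁻¹ = (ι s)⁻¹
  act_eq : ∀ s, α.act s = bisHomeo (ι s)
  cover : ∀ g : G, ∃ s, g ∈ (ι s).1
  unit_inter : ∀ s, ∀ x : UnitSpace G, x.1 ∈ (ι s).1 →
    ∃ v, NatLE v s ∧ NatLE v 1 ∧ x.1 ∈ (ι v).1

namespace IsWideHom

variable {M : Type u} [InverseMonoid M] {ι : M → Bis G} {α : PartialAction M (UnitSpace G)}

theorem subset_of_natLE (hι : IsWideHom ι α) {s t : M} (h : NatLE s t) : (ι s).1 ⊆ (ι t).1 := by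
  obtain ⟨e, he, rfl⟩ := h
  refine TopGroupoid.subset_of_natLE ⟨ι e, ?_, hι.map_mul _ _⟩
  rw [← hι.map_mul, he]

theorem target_eq (hι : IsWideHom ι α) (s : M) : (α.act s).target = range '' (ι s).1 := by
  rw [hι.act_eq]; rfl

theorem source_eq (hι : IsWideHom ι α) (s : M) : (α.act s).source = source '' (ι s).1 := by
  rw [hι.act_eq]; rfl

theorem act_symm_range (hι : IsWideHom ι α) {s : M} {k : G} (hk : k ∈ (ι s).1) :
    (α.act s).symm (range k) = source k := by
  rw [hι.act_eq]
  exact bisFun_inv_range (ι s) hk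

/-- If `v ≤ 1`, then `ι v` consists of units and coincides with its own domain. So `unitSet s` is
the union of the `ι v` with `v ≤ s, 1`, which by `unit_inter` exhausts the units in `ι s`. -/
theorem mem_unitSet_iff (hι : IsWideHom ι α) (s : M) (x : UnitSpace G) :
    x ∈ α.unitSet s ↔ x.1 ∈ (ι s).1 := by
  have htar : ∀ v : M, (α.act (v⁻¹ * v)).target = source '' (ι v).1 := fun v => by
    have := α.target_mul_inv v⁻¹
    rw [inv_inv_eq, α.target_inv, hι.source_eq] at this
    exact this
  rw [PartialAction.unitSet, Set.mem_iUnion]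
  constructor
  · rintro ⟨⟨v, h1, h2⟩, hx⟩
    rw [htar] at hx
    obtain ⟨g, hg, rfl⟩ := hx
    have h3 := hι.subset_of_natLE h2 hg
    rw [hι.map_one] at h3
    have h4 : src g = g := h3
    change src g ∈ _
    rw [h4]
    exact hι.subset_of_natLE h1 hg
  · intro hx
    obtain ⟨v, h1, h2, h3⟩ := hι.unit_inter s x hx
    refine ⟨⟨v, h1, h2⟩, ?_⟩
    rw [htar]
    exact ⟨x.1, h3, source_unit x⟩

/-- A unit in `p (s t)*` has the form `h h⁻¹` with `h` in both `p` and `s t`. The factor of `h` in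
`ι s` has the same range as `k`, hence equals `k`, and the other factor is `k⁻¹ h`. -/
theorem range_mem_unitSet_iff (hι : IsWideHom ι α) {s : M} {k : G} (hk : k ∈ (ι s).1)
    (p t : M) :
    range k ∈ α.unitSet (p * (s * t)⁻¹) ↔
      ∃ h, range h = range k ∧ h ∈ (ι p).1 ∧ mul (inv k) h ∈ (ι t).1 := by
  rw [hι.mem_unitSet_iff, hι.map_mul, hι.map_inv, hι.map_mul]
  constructor
  · rintro ⟨g, hg, b, hb, hgb, hk'⟩
    have hk'' : mul g b = rng k := hk'
    obtain ⟨a, ha, c, hc, hac, hacb⟩ := hb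
    have h1 : rng g = rng k := by
      have := congrArg rng hk''
      rwa [rng_mul _ _ hgb, rng_rng] at this
    have h2 : inv b = g := by
      have h3 : mul (inv g) (mul g b) = b := inv_mul_cancel_left hgb
      rw [hk'', ← h1, ← src_inv, mul_src] at h3
      rw [← h3, inv_inv_self]
    rw [h2] at hacb
    have h4 : a = k := (ι s).2.rng_inj ha hk (by rw [← h1, ← hacb, rng_mul _ _ hac])
    subst h4
    refine ⟨g, range_eq_iff.2 h1, hg, ?_⟩
    rwa [← hacb, inv_mul_cancel_left hac]
  · rintro ⟨h, h1, h2, h3⟩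
    have h1' : rng h = rng k := range_eq_iff.1 h1
    refine ⟨h, h2, inv h, ?_, (rng_inv h).symm, (mul_inv h).trans h1'⟩
    rw [mem_inv_iff, inv_inv_self]
    refine ⟨k, hk, _, h3, ?_, mul_inv_cancel_left h1'.symm⟩
    rw [rng_mul _ _ (by rw [src_inv, h1']), rng_inv]

end IsWideHom

/-! ### Sections and functions on the groupoid -/

/-- The coefficient `∑_{r(h) = r(g)} conj (η h) η (g⁻¹ h)`. -/
def coeff (η : G → ℂ) (g : G) : ℂ :=
  ∑ᶠ h : {h : G // range h = range g}, conj (η h) * η (mul (inv g) h)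

/-- The function `∑_{r(h) = x} |η h|²` on the unit space. -/
def sqNorm (η : G → ℂ) (x : UnitSpace G) : ℝ := ∑ᶠ h : {h : G // range h = x}, ‖η h‖ ^ 2

open Classical in
/-- The function on `G` defined by a finite family of functions on the unit space, indexed by
bisections. -/
def spread {M : Type u} (ι : M → Bis G) (F : Finset M) (ξ : M → UnitSpace G → ℂ) (g : G) : ℂ :=
  ∑ p ∈ F, if g ∈ (ι p).1 then ξ p (range g) else 0

theorem finite_fibre {M : Type u} (ι : M → Bis G) (p : M) (x : UnitSpace G) :
    {h : {h : G // range h = x} | h.1 ∈ (ι p).1}.Finite := by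
  refine Set.Subsingleton.finite fun a ha b hb => Subtype.ext ?_
  exact (ι p).2.rng_inj ha hb (range_eq_iff.1 (a.2.trans b.2.symm))

/-- Each bisection meets a range fibre at most once. Finiteness matters because `finsum` is `0` on
infinite supports. -/
theorem finite_support_spread {M : Type u} (ι : M → Bis G) (F : Finset M)
    (ξ : M → UnitSpace G → ℂ) (x : UnitSpace G) :
    {h : {h : G // range h = x} | spread ι F ξ h.1 ≠ 0}.Finite := by
  refine (F.finite_toSet.biUnion fun p _ => finite_fibre ι p x).subset fun h hh => ?_
  obtain ⟨p, hp, hne⟩ := Finset.exists_ne_zero_of_sum_ne_zero hh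
  simp only [Set.mem_iUnion]
  refine ⟨p, hp, ?_⟩
  by_contra h'
  exact hne (if_neg h')

/-- At a unit, `x⁻¹ h = h`. Control of coefficients on sets of units is therefore control of the
squared norm. -/
theorem ofReal_sqNorm (η : G → ℂ) (x : UnitSpace G)
    (hfin : {h : {h : G // range h = x} | η h.1 ≠ 0}.Finite) :
    ((sqNorm η x : ℝ) : ℂ) = coeff η x.1 := by
  have h1 : ((sqNorm η x : ℝ) : ℂ) = ∑ᶠ h : {h : G // range h = x}, ((‖η h‖ ^ 2 : ℝ) : ℂ) := by
    refine map_finsum Complex.ofRealHom (hfin.subset fun h hh => ?_)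
    intro h0
    exact hh (by simp [h0])
  rw [h1, coeff, range_unit]
  refine finsum_congr fun h => ?_
  rw [mul_inv_unit x h.2, mul_comm, Complex.mul_conj, Complex.normSq_eq_norm_sq]

-- Expanding both factors, `(p, t)` contributes at those `h` with `h ∈ ι p` and `k⁻¹ h ∈ ι t`. The
-- range of `h` is prescribed, so there is at most one, and `range_mem_unitSet_iff` decides whether
-- it exists. The second value is taken at `r(k⁻¹ h) = s(k)`.
open Classical in
theorem IsWideHom.coeff_spread {M : Type u} [InverseMonoid M] {ι : M → Bis G}
    {α : PartialAction M (UnitSpace G)} (hι : IsWideHom ι α) (F : Finset M)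
    (ξ : M → UnitSpace G → ℂ) {s : M} {k : G} (hk : k ∈ (ι s).1) :
    coeff (spread ι F ξ) k = ∑ p ∈ F, ∑ t ∈ F,
      if range k ∈ α.unitSet (p * (s * t)⁻¹) then conj (ξ p (range k)) * ξ t (source k) else 0 := by
  have hr : ∀ h : {h : G // range h = range k}, range (mul (inv k) h.1) = source k := fun h =>
    Subtype.ext (by
      change rng (mul (inv k) h.1) = src k
      rw [rng_mul _ _ (by rw [src_inv]; exact (range_eq_iff.1 h.2).symm), rng_inv])
  have hexp : ∀ h : {h : G // range h = range k},
      conj (spread ι F ξ h) * spread ι F ξ (mul (inv k) h) = ∑ p ∈ F, ∑ t ∈ F,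
        if h.1 ∈ (ι p).1 ∧ mul (inv k) h ∈ (ι t).1 then
          conj (ξ p (range k)) * ξ t (source k) else 0 := fun h => by
    rw [spread, spread, map_sum, Finset.sum_mul_sum]
    refine Finset.sum_congr rfl fun p _ => Finset.sum_congr rfl fun t _ => ?_
    rw [h.2, hr h]
    by_cases h1 : h.1 ∈ (ι p).1 <;> by_cases h2 : mul (inv k) h.1 ∈ (ι t).1 <;> simp [h1, h2]
  have hfin : ∀ p t : M, (Function.support fun h : {h : G // range h = range k} =>
      if h.1 ∈ (ι p).1 ∧ mul (inv k) h ∈ (ι t).1 then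
          conj (ξ p (range k)) * ξ t (source k) else 0).Finite := fun p t => by
    refine (finite_fibre ι p (range k)).subset fun h hh => ?_
    by_contra h'
    exact hh (if_neg fun h'' => h' h''.1)
  rw [coeff, finsum_congr hexp, finsum_sum_comm]
  · refine Finset.sum_congr rfl fun p _ => ?_
    rw [finsum_sum_comm _ _ fun t _ => hfin p t]
    refine Finset.sum_congr rfl fun t _ => ?_
    have hiff := hι.range_mem_unitSet_iff hk p t
    split_ifs with hx
    · obtain ⟨h, h1, h2, h3⟩ := hiff.1 hx
      rw [finsum_eq_single _ ⟨h, h1⟩, if_pos ⟨h2, h3⟩]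
      intro h' hne
      refine if_neg fun h'' => hne (Subtype.ext ?_)
      exact (ι p).2.rng_inj h''.1 h2 (range_eq_iff.1 (h'.2.trans h1.symm))
    · exact finsum_eq_zero_of_forall_eq_zero fun h => if_neg fun h' : _ ∧ _ =>
        hx (hiff.2 ⟨h.1, h.2, h'.1, h'.2⟩)
  · intro p _
    refine (finite_fibre ι p (range k)).subset fun h hh => ?_
    by_contra h'
    exact hh (Finset.sum_eq_zero fun t _ => if_neg fun h'' => h' h''.1)

end Wide

/-! ### The approximation property in terms of functions on the groupoid. -/

section Approximation

variable {G : Type u} [TopologicalSpace G] [TopGroupoid G] [IsEtale G] [LocallyCompactSpace G]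

instance : LocallyCompactSpace (UnitSpace G) :=
  (isOpenBisection_units (G := G)).isOpen.locallyCompactSpace

variable [T2Space (UnitSpace G)]

variable {M : Type u} [InverseMonoid M] {ι : M → Bis G} {α : PartialAction M (UnitSpace G)}

theorem sum_coe_prod {N : Type*} [AddCommMonoid N] (F : Finset M) (f : M → M → N) :
    ∑ i : F × F, f i.1 i.2 = ∑ p ∈ F, ∑ t ∈ F, f p t := by
  rw [Fintype.sum_prod_type, ← Finset.sum_coe_sort F]
  exact Finset.sum_congr rfl fun p _ => Finset.sum_coe_sort F (f p)

theorem mem_sections_iff (hι : IsWideHom ι α) (ξ : M →₀ α.fellBundle.Fib 1) :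
    ξ ∈ α.fellBundle.sections ↔ ∀ p, α.toC0 1 (ξ p) ∈ c0Sub (range '' (ι p).1) := by
  refine forall_congr' fun p => ?_
  rw [α.mem_idemIdeal_iff, α.target_mul_inv, hι.target_eq]

/-- The function on `G` defined by a section. -/
def spreadSection (ι : M → Bis G) (ξ : M →₀ α.fellBundle.Fib 1) : G → ℂ :=
  spread ι ξ.support fun p => α.toC0 1 (ξ p)

/-- Right multiplication in the fibre evaluates `ξ t` at `α_s⁻¹ (r k) = s(k)`, so at `r(k)` the sum
is the coefficient at `k` times `a (r k)`. Off the range of `α_s` every term vanishes. -/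
theorem norm_approx_sub_le_iff (hι : IsWideHom ι α) (ξ : M →₀ α.fellBundle.Fib 1) (s : M)
    (a : α.fellBundle.Fib s) {ε : ℝ} (hε : 0 ≤ ε) :
    ‖∑ p ∈ ξ.support, ∑ t ∈ ξ.support,
      arens (α.fellBundle.lmul s) (α.fellBundle.unitProj (p * (s * t)⁻¹))
        (toBidual (α.fellBundle.rmul s (α.fellBundle.lmul s (α.fellBundle.starOne (ξ p)) a)
          (ξ t))) - toBidual a‖ ≤ ε ↔
      ∀ k ∈ (ι s).1, ‖(coeff (spreadSection ι ξ) k - 1) * α.toC0 s a (range k)‖ ≤ ε := by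
  classical
  have h := α.norm_sum_arens_sub_le_iff s (ι := ξ.support × ξ.support)
    (fun i => i.1.1 * (s * i.2.1)⁻¹) (fun i => α.fellBundle.rmul s (α.fellBundle.lmul s
      (α.fellBundle.starOne (ξ i.1.1)) a) (ξ i.2.1)) a hε
  rw [sum_coe_prod ξ.support fun p t => arens (α.fellBundle.lmul s)
    (α.fellBundle.unitProj (p * (s * t)⁻¹)) (toBidual (α.fellBundle.rmul s (α.fellBundle.lmul s
      (α.fellBundle.starOne (ξ p)) a) (ξ t)))] at h
  rw [h]
  have hin : ∀ k ∈ (ι s).1, ∑ i : ξ.support × ξ.support,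
      (if range k ∈ α.unitSet (i.1.1 * (s * i.2.1)⁻¹) then α.toC0 s (α.fellBundle.rmul s
        (α.fellBundle.lmul s (α.fellBundle.starOne (ξ i.1.1)) a) (ξ i.2.1)) (range k) else 0) =
      coeff (spreadSection ι ξ) k * α.toC0 s a (range k) := fun k hk => by
    rw [spreadSection, hι.coeff_spread _ _ hk, ← sum_coe_prod, Finset.sum_mul]
    refine Finset.sum_congr rfl fun i _ => ?_
    split_ifs
    · rw [α.toC0_rmul_apply, α.toC0_lmul, ZeroAtInftyContinuousMap.mul_apply,
        α.toC0_starOne_apply, hι.act_symm_range hk]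
      ring
    · rw [zero_mul]
  constructor
  · intro H k hk
    have := H (range k)
    rwa [hin k hk, ← sub_one_mul] at this
  · intro H x
    by_cases hx : x ∈ (α.act s).target
    · rw [hι.target_eq] at hx
      obtain ⟨k, hk, rfl⟩ := hx
      rw [hin k hk, ← sub_one_mul]
      exact H k hk
    · rw [α.toC0_mem a x hx, Finset.sum_eq_zero, sub_zero, norm_zero]
      · exact hε
      · intro i _
        rw [α.toC0_mem _ x hx, ite_self]

/-- The norm formula in the fibre over `1` with `a = 0`: the pointwise sum at `x` is the coefficient
at the unit `x`, that is, the squared norm. -/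
theorem norm_square_le_iff (hι : IsWideHom ι α) (ξ : M →₀ α.fellBundle.Fib 1) {C : ℝ}
    (hC : 0 ≤ C) :
    ‖∑ p ∈ ξ.support, ∑ t ∈ ξ.support,
      arens (α.fellBundle.lmul 1) (toBidual (α.fellBundle.lmul 1 (α.fellBundle.starOne (ξ p))
        (ξ t))) (α.fellBundle.unitProj (p * t⁻¹))‖ ≤ C ↔
      ∀ x, sqNorm (spreadSection ι ξ) x ≤ C := by
  classical
  have h := α.norm_sum_arens_sub_le_iff 1 (ι := ξ.support × ξ.support)
    (fun i => i.1.1 * i.2.1⁻¹) (fun i => α.fellBundle.lmul 1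
      (α.fellBundle.starOne (ξ i.1.1)) (ξ i.2.1)) 0 hC
  rw [sum_coe_prod ξ.support fun p t => arens (α.fellBundle.lmul 1)
    (α.fellBundle.unitProj (p * t⁻¹)) (toBidual (α.fellBundle.lmul 1
      (α.fellBundle.starOne (ξ p)) (ξ t)))] at h
  simp only [α.arens_toBidual_unitProj]
  have hz : ∀ y : Bidual (α.fellBundle.Fib 1), y - toBidual 0 = y := fun y =>
    (congrArg (y - ·) (map_zero _)).trans (sub_zero y)
  rw [hz] at h
  rw [h]
  refine forall_congr' fun x => ?_
  have hx : x.1 ∈ (ι 1).1 := by rw [hι.map_one]; exact x.2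
  have hfin := finite_support_spread ι ξ.support (fun p => α.toC0 1 (ξ p)) x
  have hnn : 0 ≤ sqNorm (spreadSection ι ξ) x := finsum_nonneg fun h => by positivity
  have key : ∑ i : ξ.support × ξ.support, (if x ∈ α.unitSet (i.1.1 * i.2.1⁻¹) then
      α.toC0 1 (α.fellBundle.lmul 1 (α.fellBundle.starOne (ξ i.1.1)) (ξ i.2.1)) x else 0) -
        α.toC0 1 0 x = ((sqNorm (spreadSection ι ξ) x : ℝ) : ℂ) := by
    rw [ofReal_sqNorm (spreadSection ι ξ) x hfin, spreadSection, hι.coeff_spread _ _ hx,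
      ← sum_coe_prod, map_zero, ZeroAtInftyContinuousMap.zero_apply, sub_zero]
    refine Finset.sum_congr rfl fun i _ => ?_
    rw [one_mul, range_unit, source_unit, α.toC0_lmul, ZeroAtInftyContinuousMap.mul_apply,
      α.toC0_starOne_apply]
  rw [key, Complex.norm_real, Real.norm_of_nonneg hnn]

/-! ### Decomposition of compactly supported functions -/

theorem spreadSection_eq_sum (ξ : M →₀ α.fellBundle.Fib 1) (F : Finset M) (hF : ξ.support ⊆ F)
    (g : G) : spreadSection ι ξ g = spread ι F (fun p => α.toC0 1 (ξ p)) g := by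
  classical
  refine Finset.sum_subset hF fun p _ hp => ?_
  change (if g ∈ (ι p).1 then α.toC0 1 (ξ p) (range g) else 0) = 0
  rw [Finsupp.notMem_support_iff.1 hp, map_zero, ZeroAtInftyContinuousMap.zero_apply, ite_self]

theorem spreadSection_add (ξ ζ : M →₀ α.fellBundle.Fib 1) :
    spreadSection ι (ξ + ζ) = spreadSection ι ξ + spreadSection ι ζ := by
  classical
  funext g
  rw [Pi.add_apply, spreadSection_eq_sum ξ (ξ.support ∪ ζ.support) Finset.subset_union_left,
    spreadSection_eq_sum ζ (ξ.support ∪ ζ.support) Finset.subset_union_right,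
    spreadSection_eq_sum (ξ + ζ) (ξ.support ∪ ζ.support) Finsupp.support_add, spread, spread,
    spread, ← Finset.sum_add_distrib]
  refine Finset.sum_congr rfl fun p _ => ?_
  split_ifs
  · rw [Finsupp.add_apply, map_add, ZeroAtInftyContinuousMap.add_apply]
  · rw [add_zero]

theorem spreadSection_zero : spreadSection ι (0 : M →₀ α.fellBundle.Fib 1) = 0 := rfl

theorem spreadSection_smul (c : ℂ) (ξ : M →₀ α.fellBundle.Fib 1) :
    spreadSection ι (c • ξ) = c • spreadSection ι ξ := by
  classical
  funext g
  rw [Pi.smul_apply, spreadSection_eq_sum (c • ξ) ξ.support Finsupp.support_smul, spreadSection,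
    spread, spread, smul_eq_mul, Finset.mul_sum]
  refine Finset.sum_congr rfl fun p _ => ?_
  split_ifs
  · rw [Finsupp.smul_apply, map_smul, ZeroAtInftyContinuousMap.smul_apply, smul_eq_mul]
  · rw [mul_zero]

open Classical in
theorem spreadSection_single (p : M) (f : α.fellBundle.Fib 1) (g : G) :
    spreadSection ι (Finsupp.single p f) g =
      if g ∈ (ι p).1 then α.toC0 1 f (range g) else 0 := by
  rw [spreadSection_eq_sum _ {p} Finsupp.support_single_subset, spread, Finset.sum_singleton,
    Finsupp.single_eq_same]

/-- A function that is continuous on an open bisection `u` and vanishes off a compact subset of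
`u` is, as a function of the range, in `C₀(G⁰)`. -/
theorem exists_c0_of_bisection {u : Set G} (hu : IsOpenBisection u) {f : G → ℂ}
    (hf : ContinuousOn f u) {K : Set G} (hKu : K ⊆ u) (hK : IsCompact K)
    (hf0 : ∀ g ∉ K, f g = 0) :
    ∃ φ : C₀(UnitSpace G, ℂ), (∀ g ∈ u, φ (range g) = f g) ∧ ∀ x ∉ range '' K, φ x = 0 := by
  classical
  have hKc : IsCompact (range '' K) := hK.image continuous_range
  let e : UnitSpace G → ℂ := fun x => if h : ∃ g ∈ u, range g = x then f h.choose else 0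
  have he : ∀ g ∈ u, e (range g) = f g := fun g hg => by
    have h : ∃ g' ∈ u, range g' = range g := ⟨g, hg, rfl⟩
    simp only [e]
    rw [dif_pos h, hu.rng_inj h.choose_spec.1 hg (range_eq_iff.1 h.choose_spec.2)]
  have he0 : ∀ x ∉ range '' K, e x = 0 := fun x hx => by
    simp only [e]
    split_ifs with h
    · refine hf0 _ fun h' => hx ⟨_, h', h.choose_spec.2⟩
    · rfl
  have hcont : Continuous e := by
    rw [continuous_iff_continuousAt]
    intro x
    by_cases hx : x ∈ range '' K
    · obtain ⟨g, hg, rfl⟩ := hx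
      have h1 : ContinuousAt (e ∘ fun g : u => range g.1) ⟨g, hKu hg⟩ := by
        have h2 : (e ∘ fun g : u => range g.1) = u.domRestrict f := funext fun g => he g.1 g.2
        rw [h2]
        exact (continuousOn_iff_continuous_domRestrict.1 hf).continuousAt
      exact hu.range_openEmbedding.continuousAt_iff.1 h1
    · refine continuousAt_const.congr (f := fun _ => (0 : ℂ)) ?_
      filter_upwards [hKc.isClosed.isOpen_compl.mem_nhds hx] with y hy
      exact (he0 y hy).symm
  exact ⟨c0OfCompact e hcont hKc he0, he, he0⟩

/-- View `f` as a function `φ` of the range, cover its support by finitely many `u ∩ ι p`, and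
distribute `φ` over these `p` by a partition of unity. -/
theorem exists_section_of_bisection (hι : IsWideHom ι α) {u : Set G} (hu : IsOpenBisection u)
    {f : G → ℂ} (hf : ContinuousOn f u) {K : Set G} (hKu : K ⊆ u) (hK : IsCompact K)
    (hf0 : ∀ g ∉ K, f g = 0) :
    ∃ ξ ∈ α.fellBundle.sections, f = spreadSection (α := α) ι ξ := by
  classical
  obtain ⟨φ, hφ1, hφ2⟩ := exists_c0_of_bisection hu hf hKu hK hf0
  obtain ⟨T, hT⟩ := hK.elim_finite_subcover (fun p => u ∩ (ι p).1)
    (fun p => hu.isOpen.inter (ι p).2.isOpen) (fun g hg => by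
      obtain ⟨p, hp⟩ := hι.cover g
      exact Set.mem_iUnion.2 ⟨p, hKu hg, hp⟩)
  -- Supports are taken in `r(u ∩ ι p)` rather than `r(u) ∩ r(ι p)`: then `χ p (r g) ≠ 0` forces `g
  -- ∈ ι p` for `g ∈ u`, and `g ∈ u` for `g ∈ ι p`.
  obtain ⟨χ, hχ1, hχ2, -⟩ := exists_c0_partition (ι := T)
    (U := fun p => range '' (u ∩ (ι p.1).1)) (hK.image continuous_range)
    (fun p => isOpenMap_range _ (hu.isOpen.inter (ι p.1).2.isOpen)) (by
      rintro _ ⟨g, hg, rfl⟩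
      obtain ⟨p, hp, hgp⟩ := Set.mem_iUnion₂.1 (hT hg)
      exact Set.mem_iUnion.2 ⟨⟨p, hp⟩, g, hgp, rfl⟩)
  have hsec : ∀ p : T, Finsupp.single p.1 (α.ofC0One (χ p * φ)) ∈ α.fellBundle.sections :=
    fun p => (mem_sections_iff hι _).2 fun q => by
      rcases eq_or_ne p.1 q with rfl | hne
      · rw [Finsupp.single_eq_same, α.toC0_ofC0One]
        refine mul_mem_c0Sub_left (fun x hx => hχ1 p x fun h => hx ?_) φ
        exact Set.image_mono Set.inter_subset_right h
      · rw [Finsupp.single_eq_of_ne (Ne.symm hne), map_zero]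
        exact Submodule.zero_mem _
  have hval : ∀ (p : T) (g : G), spreadSection ι (Finsupp.single p.1 (α.ofC0One (χ p * φ))) g =
      if g ∈ u then χ p (range g) * f g else 0 := fun p g => by
    rw [spreadSection_single, α.toC0_ofC0One, ZeroAtInftyContinuousMap.mul_apply]
    by_cases hgu : g ∈ u
    · rw [if_pos hgu]
      split_ifs with hgp
      · rw [hφ1 g hgu]
      · rw [hχ1 p (range g), zero_mul]
        rintro ⟨g', hg', e⟩
        rw [hu.rng_inj hg'.1 hgu (range_eq_iff.1 e)] at hg'
        exact hgp hg'.2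
    · rw [if_neg hgu]
      split_ifs with hgp
      · rw [hχ1 p (range g), zero_mul]
        rintro ⟨g', hg', e⟩
        rw [(ι p.1).2.rng_inj hg'.2 hgp (range_eq_iff.1 e)] at hg'
        exact hgu hg'.1
      · rfl
  refine ⟨∑ p : T, Finsupp.single p.1 (α.ofC0One (χ p * φ)), ?_, ?_⟩
  · rw [mem_sections_iff hι]
    intro q
    rw [Finsupp.finsetSum_apply, map_sum]
    exact Submodule.sum_mem _ fun p _ => (mem_sections_iff hι _).1 (hsec p) q
  · have hmap : spreadSection ι (∑ p : T, Finsupp.single p.1 (α.ofC0One (χ p * φ))) =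
        ∑ p : T, spreadSection ι (Finsupp.single p.1 (α.ofC0One (χ p * φ))) :=
      map_sum (⟨⟨spreadSection ι, spreadSection_zero⟩, spreadSection_add⟩ :
        (M →₀ α.fellBundle.Fib 1) →+ (G → ℂ)) _ _
    rw [hmap]
    funext g
    rw [Finset.sum_apply]
    simp only [hval]
    by_cases hg : g ∈ K
    · simp only [if_pos (hKu hg)]
      rw [← Finset.sum_mul, hχ2 _ ⟨g, hg, rfl⟩, one_mul]
    · simp [hf0 g hg]

theorem exists_section_of_mem_compactlySupported (hι : IsWideHom ι α) {η : G → ℂ}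
    (hη : η ∈ CompactlySupported G) :
    ∃ ξ ∈ α.fellBundle.sections, η = spreadSection (α := α) ι ξ := by
  induction hη using Submodule.span_induction with
  | mem f hf =>
    obtain ⟨u, hu, hfu, K, hKu, hK, hf0⟩ := hf
    exact exists_section_of_bisection hι hu hfu hKu hK hf0
  | zero =>
    refine ⟨0, (mem_sections_iff hι _).2 fun p => ?_, ?_⟩
    · rw [Finsupp.zero_apply, map_zero]
      exact Submodule.zero_mem _
    · exact spreadSection_zero.symm
  | add f g _ _ hf hg =>
    obtain ⟨ξ, h1, rfl⟩ := hf
    obtain ⟨ζ, h2, rfl⟩ := hg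
    refine ⟨ξ + ζ, (mem_sections_iff hι _).2 fun p => ?_, (spreadSection_add ξ ζ).symm⟩
    rw [Finsupp.add_apply, map_add]
    exact Submodule.add_mem _ ((mem_sections_iff hι _).1 h1 p) ((mem_sections_iff hι _).1 h2 p)
  | smul c f _ hf =>
    obtain ⟨ξ, h1, rfl⟩ := hf
    refine ⟨c • ξ, (mem_sections_iff hι _).2 fun p => ?_, (spreadSection_smul c ξ).symm⟩
    rw [Finsupp.smul_apply, map_smul]
    exact Submodule.smul_mem _ c ((mem_sections_iff hι _).1 h1 p)

end Approximation

theorem tendsto_bidual_iff {E : Type u} [NormedAddCommGroup E] [NormedSpace ℂ E] {I : Type*}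
    {l : Filter I} {f : I → Bidual E} {y : Bidual E} :
    Tendsto f l (𝓝 y) ↔ ∀ ε > 0, ∀ᶠ i in l, ‖f i - y‖ < ε := by
  have h := Metric.tendsto_nhds (α := Bidual E) (u := f) (f := l) (a := y)
  have hd : ∀ a b : Bidual E, dist a b = ‖a - b‖ := fun a b => dist_eq_norm a b
  simp only [hd] at h
  exact h

/-! ### Amenability is equivalent to the approximation property for a wide homomorphism. -/

section Equivalence

variable {G : Type u} [TopologicalSpace G] [TopGroupoid G] [IsEtale G]

theorem range_inv_mul {k h : G} (hh : range h = range k) : range (mul (inv k) h) = source k :=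
  Subtype.ext (by
    change rng (mul (inv k) h) = src k
    rw [rng_mul _ _ (by rw [src_inv]; exact (range_eq_iff.1 hh).symm), rng_inv])

/-- Left translation by `k⁻¹` between the fibres of the range map. -/
def translate (k : G) : {h : G // range h = range k} ≃ {h : G // range h = source k} where
  toFun h := ⟨mul (inv k) h.1, range_inv_mul h.2⟩
  invFun h := ⟨mul k h.1, Subtype.ext (rng_mul _ _ (congrArg Subtype.val h.2).symm)⟩
  left_inv h := Subtype.ext (mul_inv_cancel_left (range_eq_iff.1 h.2).symm)
  right_inv h := Subtype.ext (inv_mul_cancel_left (congrArg Subtype.val h.2).symm)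

/-- Cauchy–Schwarz, in the form `2ab ≤ a² + b²`: left translation identifies the fibre over `r(k)`
with that over `s(k)`, so both sums of squares are at most `1`. -/
theorem norm_coeff_le_one {η : G → ℂ}
    (hfin : ∀ x, {h : {h : G // range h = x} | η h.1 ≠ 0}.Finite)
    (hη : ∀ x, sqNorm η x ≤ 1) (k : G) : ‖coeff η k‖ ≤ 1 := by
  classical
  have hfin' : {h : {h : G // range h = range k} | η (mul (inv k) h.1) ≠ 0}.Finite :=
    (hfin (source k)).preimage (f := translate k) (translate k).injective.injOn
  let T := (hfin (range k)).toFinset ∪ hfin'.toFinset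
  have h1 : coeff η k = ∑ h ∈ T, conj (η h) * η (mul (inv k) h) := by
    refine finsum_eq_sum_of_support_subset _ fun h hh => ?_
    simp only [T, Finset.coe_union, Set.Finite.coe_toFinset]
    refine Or.inl fun h0 => hh ?_
    simp [h0]
  have h2 : sqNorm η (range k) = ∑ h ∈ T, ‖η h‖ ^ 2 := by
    refine finsum_eq_sum_of_support_subset _ fun h hh => ?_
    simp only [T, Finset.coe_union, Set.Finite.coe_toFinset]
    refine Or.inl fun h0 => hh ?_
    simp [h0]
  have h3 : sqNorm η (source k) = ∑ h ∈ T, ‖η (mul (inv k) h)‖ ^ 2 := by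
    rw [sqNorm, ← finsum_comp_equiv (translate k)]
    refine finsum_eq_sum_of_support_subset _ fun h hh => ?_
    simp only [T, Finset.coe_union, Set.Finite.coe_toFinset]
    refine Or.inr fun h0 => hh ?_
    simp [translate, h0]
  have h4 : ‖coeff η k‖ ≤ ∑ h ∈ T, (‖η h‖ ^ 2 + ‖η (mul (inv k) h)‖ ^ 2) / 2 := by
    rw [h1]
    refine (norm_sum_le _ _).trans (Finset.sum_le_sum fun h _ => ?_)
    rw [norm_mul, RCLike.norm_conj]
    nlinarith [sq_nonneg (‖η h‖ - ‖η (mul (inv k) h)‖)]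
  rw [← Finset.sum_div, Finset.sum_add_distrib, ← h2, ← h3] at h4
  linarith [hη (range k), hη (source k)]

theorem isCompact_bisection_inter_preimage {u : Set G} (hu : IsOpenBisection u)
    {Q : Set (UnitSpace G)} (hQ : IsCompact Q) (hQu : Q ⊆ range '' u) :
    IsCompact (u ∩ range ⁻¹' Q) := by
  have h1 := hu.range_openEmbedding.isInducing.isCompact_preimage' hQ (by
    intro x hx
    obtain ⟨g, hg, rfl⟩ := hQu hx
    exact ⟨⟨g, hg⟩, rfl⟩)
  have h2 := h1.image continuous_subtype_val
  convert h2 using 1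
  ext g
  constructor
  · rintro ⟨h, h'⟩
    exact ⟨⟨g, h⟩, h', rfl⟩
  · rintro ⟨⟨g, h⟩, h', rfl⟩
    exact ⟨h, h'⟩

theorem spread_mem_compactlySupported {M : Type u} (ι : M → Bis G) (F : Finset M)
    {ξ : M → UnitSpace G → ℂ} (hc : ∀ p, Continuous (ξ p))
    (hs : ∀ p, ∃ Q ⊆ range '' (ι p).1, IsCompact Q ∧ ∀ x ∉ Q, ξ p x = 0) :
    spread ι F ξ ∈ CompactlySupported G := by
  classical
  have h : spread ι F ξ = ∑ p ∈ F, fun g => if g ∈ (ι p).1 then ξ p (range g) else 0 := by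
    funext g
    rw [Finset.sum_apply]
    rfl
  rw [h]
  refine Submodule.sum_mem _ fun p _ => Submodule.subset_span ?_
  obtain ⟨Q, hQ1, hQ2, hQ3⟩ := hs p
  refine ⟨(ι p).1, (ι p).2, ?_, (ι p).1 ∩ range ⁻¹' Q, Set.inter_subset_left,
    isCompact_bisection_inter_preimage (ι p).2 hQ2 hQ1, fun g hg => ?_⟩
  · refine ((hc p).comp continuous_range).continuousOn.congr fun g hg => ?_
    exact if_pos hg
  · by_cases h1 : g ∈ (ι p).1
    · refine (if_pos h1).trans ?_
      exact hQ3 _ fun h2 => hg ⟨h1, h2⟩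
    · exact if_neg h1

theorem sqNorm_mul_range (ψ : UnitSpace G → ℂ) (η : G → ℂ) (x : UnitSpace G) :
    sqNorm (fun g => ψ (range g) * η g) x = ‖ψ x‖ ^ 2 * sqNorm η x := by
  rw [sqNorm, sqNorm, ← smul_eq_mul, smul_finsum]
  refine finsum_congr fun h => ?_
  rw [h.2, norm_mul, mul_pow, smul_eq_mul]

theorem coeff_mul_range (ψ : UnitSpace G → ℂ) (η : G → ℂ) (k : G) :
    coeff (fun g => ψ (range g) * η g) k = conj (ψ (range k)) * ψ (source k) * coeff η k := by
  rw [coeff, coeff, ← smul_eq_mul _ (∑ᶠ _, _), smul_finsum]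
  refine finsum_congr fun h => ?_
  rw [range_inv_mul h.2, h.2, map_mul, smul_eq_mul]
  ring

variable [LocallyCompactSpace G] [T2Space (UnitSpace G)]
variable {M : Type u} [InverseMonoid M] {ι : M → Bis G} {α : PartialAction M (UnitSpace G)}

/-- Realise each `η i` as a spread section. Uniform convergence applies over the compact set where
`|a|` is not small; elsewhere the coefficients need only be bounded. -/
theorem hasApproximationProperty_of_amenable (hι : IsWideHom ι α)
    (hG : IsTopologicallyAmenable G) : α.HasApproximationProperty := by
  obtain ⟨I, _, _, _, η, hη1, hη2, hη3⟩ := hG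
  choose ξ hξ1 hξ2 using fun i =>
    exists_section_of_mem_compactlySupported hι (hη1 i)
  have hsq : ∀ i x, sqNorm (spreadSection ι (ξ i)) x ≤ 1 := fun i x => by
    have := (Real.sqrt_le_iff.1 (hη2 i x)).2
    rw [one_pow] at this
    rw [← hξ2]
    exact this
  refine ⟨I, inferInstance, inferInstance, inferInstance, ξ, hξ1,
    ⟨1, fun i => (norm_square_le_iff hι _ zero_le_one).2 (hsq i)⟩, fun s a => ?_⟩
  rw [tendsto_bidual_iff]
  intro ε hε
  set f := α.toC0 s a with hf
  let Q : Set (UnitSpace G) := {x | ε / 4 ≤ ‖f x‖}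
  have hQ : IsCompact Q := c0_compact f (by linarith)
  have hQs : Q ⊆ range '' (ι s).1 := by
    intro x hx
    by_contra h
    rw [← hι.target_eq] at h
    have h1 : ε / 4 ≤ ‖f x‖ := hx
    rw [hf, α.toC0_mem a x h, norm_zero] at h1
    linarith
  have hK := isCompact_bisection_inter_preimage (ι s).2 hQ hQs
  have hδ : 0 < ε / (2 * (‖f‖ + 1)) := by positivity
  filter_upwards [Metric.tendstoUniformlyOn_iff.1 (hη3 _ hK) _ hδ] with i hi
  refine lt_of_le_of_lt ((norm_approx_sub_le_iff hι (ξ i) s a (by positivity : 0 ≤ ε / 2)).2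
    fun k hk => ?_) (by linarith)
  rw [norm_mul, ← hf]
  by_cases hkQ : range k ∈ Q
  · have h1 := hi k ⟨hk, hkQ⟩
    rw [dist_comm, dist_eq_norm] at h1
    have h2 : ‖coeff (spreadSection ι (ξ i)) k - 1‖ ≤ ε / (2 * (‖f‖ + 1)) := by
      rw [← hξ2]
      exact h1.le
    refine (mul_le_mul h2 (c0_norm_le f _) (norm_nonneg _) hδ.le).trans ?_
    rw [div_mul_eq_mul_div, div_le_iff₀ (by positivity)]
    nlinarith [norm_nonneg f]
  -- Off `Q` the crude bound `|coeff - 1| ≤ 2` gives `2 · ε / 4 = ε / 2`.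
  · have h1 : ‖f (range k)‖ ≤ ε / 4 := (not_le.1 hkQ).le
    have h2 : ‖coeff (spreadSection ι (ξ i)) k - 1‖ ≤ 2 := by
      refine (norm_sub_le _ _).trans ?_
      have := norm_coeff_le_one (finite_support_spread ι (ξ i).support
        fun p => α.toC0 1 (ξ i p)) (hsq i) k
      rw [norm_one]
      unfold spreadSection
      linarith
    nlinarith [norm_nonneg (f (range k)), norm_nonneg (coeff (spreadSection ι (ξ i)) k - 1)]

/-- Testing against an `a ∈ A_s` equal to `1` on `r(L)`, with `L ⊆ ι s` compact, makes norm
convergence to `a` uniform convergence of the coefficients on `L`. Finitely many such neighbourhoods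
cover `K`. -/
theorem exists_section_coeff_near_one (hι : IsWideHom ι α) (h : α.HasApproximationProperty)
    {K : Set G} (hK : IsCompact K) {ε : ℝ} (hε : 0 < ε) :
    ∃ ξ ∈ α.fellBundle.sections, ∀ g ∈ K, ‖coeff (spreadSection (α := α) ι ξ) g - 1‖ ≤ ε := by
  obtain ⟨I, _, _, _, ξ, hξ1, -, hξ3⟩ := h
  suffices H : ∀ᶠ i in atTop, ∀ g ∈ K, ‖coeff (spreadSection ι (ξ i)) g - 1‖ ≤ ε by
    obtain ⟨i, hi⟩ := H.exists
    exact ⟨ξ i, hξ1 i, hi⟩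
  refine hK.induction_on (p := fun t => ∀ᶠ i in atTop, ∀ g ∈ t,
    ‖coeff (spreadSection ι (ξ i)) g - 1‖ ≤ ε) ?_ ?_ ?_ ?_
  · simp
  · intro s t hst ht
    filter_upwards [ht] with i hi g hg
    exact hi g (hst hg)
  · intro s t hs ht
    filter_upwards [hs, ht] with i hi hi' g hg
    exact hg.elim (hi g) (hi' g)
  · intro g _
    obtain ⟨s, hs⟩ := hι.cover g
    obtain ⟨L, hLg, hLs, hL⟩ := local_compact_nhds ((ι s).2.isOpen.mem_nhds hs)
    obtain ⟨f, hf1, hf2, -⟩ := exists_c0_bump (hL.image continuous_range)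
      (isOpenMap_range _ (ι s).2.isOpen) (Set.image_mono hLs)
    rw [← hι.target_eq] at hf1
    refine ⟨L, mem_nhdsWithin_of_mem_nhds hLg, ?_⟩
    filter_upwards [tendsto_bidual_iff.1 (hξ3 s (α.ofC0 f hf1)) ε hε] with i hi k hk
    have := (norm_approx_sub_le_iff hι (ξ i) s (α.ofC0 f hf1) hε.le).1 hi.le k (hLs hk)
    rwa [α.toC0_ofC0, hf2 _ ⟨k, hk, rfl⟩, mul_one] at this

theorem norm_conj_mul_sub_le {a b a' b' : ℂ} {B τ : ℝ} (ha : ‖a‖ ≤ B) (hb' : ‖b'‖ ≤ B)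
    (h1 : ‖a - a'‖ ≤ τ) (h2 : ‖b - b'‖ ≤ τ) :
    ‖conj a' * b' - conj a * b‖ ≤ 2 * B * τ := by
  have h : conj a' * b' - conj a * b = -(conj (a - a') * b' + conj a * (b - b')) := by
    rw [map_sub]; ring
  have hB : 0 ≤ B := (norm_nonneg _).trans ha
  have hτ : 0 ≤ τ := (norm_nonneg _).trans h1
  rw [h, norm_neg]
  refine (norm_add_le _ _).trans ?_
  rw [norm_mul, norm_mul, RCLike.norm_conj, RCLike.norm_conj]
  have e1 := mul_le_mul h1 hb' (norm_nonneg _) hτ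
  have e2 := mul_le_mul ha h2 (norm_nonneg _) hB
  linarith

/-- The values of a section only vanish at infinity, so they are thresholded to reach `C_c(G)`. Each
of the `card F ^ 2` products in `coeff_spread` moves by at most `2 B τ`, uniformly on `G`. -/
theorem exists_truncation (hι : IsWideHom ι α) (ξ : M →₀ α.fellBundle.Fib 1) {δ : ℝ}
    (hδ : 0 < δ) : ∃ τ > 0, ∀ g, ‖coeff (spread ι ξ.support fun p x =>
      softThreshold τ (α.toC0 1 (ξ p) x)) g - coeff (spreadSection ι ξ) g‖ ≤ δ := by
  classical
  set F := ξ.support with hF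
  set B : ℝ := ∑ p ∈ F, ‖ξ p‖ with hB
  have hB0 : 0 ≤ B := Finset.sum_nonneg fun _ _ => norm_nonneg _
  have hle : ∀ p ∈ F, ∀ x, ‖α.toC0 1 (ξ p) x‖ ≤ B := fun p hp x => by
    refine (c0_norm_le _ x).trans ?_
    rw [(α.toC0 1).norm_map]
    exact Finset.single_le_sum (f := fun p => ‖ξ p‖) (fun _ _ => norm_nonneg _) hp
  obtain ⟨τ, hτ, hτ'⟩ : ∃ τ > 0, (F.card : ℝ) * (F.card * (2 * B * τ)) ≤ δ := by
    refine ⟨δ / (F.card * (F.card * (2 * B)) + 1), by positivity, ?_⟩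
    have : (F.card : ℝ) * (F.card * (2 * B * (δ / (F.card * (F.card * (2 * B)) + 1)))) =
      (F.card * (F.card * (2 * B)) * δ) / (F.card * (F.card * (2 * B)) + 1) := by ring
    rw [this, div_le_iff₀ (by positivity)]
    nlinarith
  refine ⟨τ, hτ, fun g => ?_⟩
  obtain ⟨s, hs⟩ := hι.cover g
  rw [spreadSection, hι.coeff_spread _ _ hs, hι.coeff_spread _ _ hs, ← Finset.sum_sub_distrib]
  refine le_trans ?_ hτ'
  rw [← nsmul_eq_mul, ← Finset.sum_const]
  refine (norm_sum_le _ _).trans (Finset.sum_le_sum fun p hp => ?_)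
  rw [← nsmul_eq_mul, ← Finset.sum_const, ← Finset.sum_sub_distrib]
  refine (norm_sum_le _ _).trans (Finset.sum_le_sum fun t ht => ?_)
  split_ifs
  · exact norm_conj_mul_sub_le (hle p hp _) ((norm_softThreshold_le hτ _).trans (hle t ht _))
      (norm_sub_softThreshold_le hτ _) (norm_sub_softThreshold_le hτ _)
  · rw [sub_zero, norm_zero]
    positivity

/-- Multiply `η` by `c φ(r(·))` with a cut-off `φ` equal to `1` on `r(K) ∪ s(K)`. On `K` the
coefficients change only by the factor `c²`, while the squared norm has to be controlled only on the
support of `φ`. -/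
theorem exists_compactlySupported_coeff_near_one (hι : IsWideHom ι α)
    (h : α.HasApproximationProperty) {K : Set G} (hK : IsCompact K) {ε : ℝ} (hε : 0 < ε) :
    ∃ η ∈ CompactlySupported G, (∀ x, sqNorm η x ≤ 1) ∧ ∀ g ∈ K, ‖coeff η g - 1‖ ≤ ε := by
  obtain ⟨φ, hφ1, hφ2, -, hφ4⟩ := exists_continuousMap_one_of_isCompact_subset_isOpen
    ((hK.image continuous_range).union (hK.image continuous_source)) isOpen_univ
    (Set.subset_univ _)
  -- The support of `φ`, as a set of unit arrows, joins `K`: near-`1` coefficients there mean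
  -- `sqNorm η ≤ 1 + ε / 2`.
  have hQ : IsCompact (Subtype.val '' tsupport φ : Set G) := hφ2.image continuous_subtype_val
  obtain ⟨ξ, hξ1, hξ2⟩ := exists_section_coeff_near_one hι h (hK.union hQ)
    (by linarith : 0 < ε / 4)
  obtain ⟨τ, hτ, hτ'⟩ := exists_truncation hι ξ (by linarith : 0 < ε / 4)
  set ξ' : M → UnitSpace G → ℂ := fun p x => softThreshold τ (α.toC0 1 (ξ p) x) with hξ'
  set η := spread ι ξ.support ξ' with hη
  have hηc : ∀ g ∈ K ∪ Subtype.val '' tsupport φ, ‖coeff η g - 1‖ ≤ ε / 2 := fun g hg => by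
    calc ‖coeff η g - 1‖ = ‖(coeff η g - coeff (spreadSection ι ξ) g) +
          (coeff (spreadSection ι ξ) g - 1)‖ := by congr 1; ring
      _ ≤ ε / 4 + ε / 4 := (norm_add_le _ _).trans (add_le_add (hτ' g) (hξ2 g hg))
      _ = ε / 2 := by ring
  -- This `c` normalises the bound `1 + ε / 2` on the squared norm to exactly `1`.
  set c : ℝ := (Real.sqrt (1 + ε / 2))⁻¹ with hc
  have hc2 : c ^ 2 * (1 + ε / 2) = 1 := by
    rw [hc, inv_pow, Real.sq_sqrt (by positivity), inv_mul_cancel₀ (by positivity)]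
  have hc1 : c ^ 2 ≤ 1 := by nlinarith [sq_nonneg c]
  set ψ : UnitSpace G → ℂ := fun x => ((c * φ x : ℝ) : ℂ) with hψ
  have hψη : (fun g => ψ (range g) * η g) = spread ι ξ.support fun p x => ψ x * ξ' p x := by
    funext g
    rw [hη, spread, spread, Finset.mul_sum]
    refine Finset.sum_congr rfl fun p _ => ?_
    rw [mul_ite, mul_zero]
  refine ⟨fun g => ψ (range g) * η g, ?_, fun x => ?_, fun g hg => ?_⟩
  · rw [hψη]
    refine spread_mem_compactlySupported ι _ (fun p => ?_) fun p => ?_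
    · refine Continuous.mul (by fun_prop) ?_
      exact (continuous_softThreshold hτ).comp (map_continuous (α.toC0 1 (ξ p)))
    · obtain ⟨Q, h1, h2, h3⟩ := exists_compact_softC0 ((mem_sections_iff hι ξ).1 hξ1 p) hτ
      refine ⟨Q, h1, h2, fun x hx => ?_⟩
      have : ξ' p x = 0 := h3 x hx
      rw [this, mul_zero]
  · rw [sqNorm_mul_range, Complex.norm_real, Real.norm_eq_abs, sq_abs]
    by_cases hx : x ∈ tsupport φ
    · have h1 := hηc x.1 (Or.inr ⟨x, hx, rfl⟩)
      rw [← ofReal_sqNorm η x (finite_support_spread ι _ _ x), ← Complex.ofReal_one,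
        ← Complex.ofReal_sub, Complex.norm_real, Real.norm_eq_abs] at h1
      have h2 := (abs_le.1 h1).2
      have h3 : 0 ≤ sqNorm η x := finsum_nonneg fun h => by positivity
      have h4 := hφ4 x
      have h5 : (c * φ x) ^ 2 ≤ c ^ 2 := by
        rw [mul_pow]
        exact mul_le_of_le_one_right (sq_nonneg _) (pow_le_one₀ h4.1 h4.2)
      calc (c * φ x) ^ 2 * sqNorm η x ≤ c ^ 2 * (1 + ε / 2) :=
            mul_le_mul h5 (by linarith) h3 (sq_nonneg _)
        _ = 1 := hc2
    · rw [image_eq_zero_of_notMem_tsupport hx]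
      simp
  · have hr : φ (range g) = 1 := hφ1 (Or.inl ⟨g, hg, rfl⟩)
    have hs : φ (source g) = 1 := hφ1 (Or.inr ⟨g, hg, rfl⟩)
    have hc2' : (c : ℂ) ^ 2 * (1 + ε / 2) = 1 := by exact_mod_cast hc2
    have h1 : coeff (fun g => ψ (range g) * η g) g - 1 =
        ((c ^ 2 : ℝ) : ℂ) * ((coeff η g - 1) - ((ε / 2 : ℝ) : ℂ)) := by
      rw [coeff_mul_range]
      simp only [hψ, hr, hs, mul_one, Complex.conj_ofReal]
      push_cast
      linear_combination hc2'
    rw [h1, norm_mul, Complex.norm_real, Real.norm_of_nonneg (sq_nonneg c)]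
    have h2 : ‖(coeff η g - 1) - ((ε / 2 : ℝ) : ℂ)‖ ≤ ε := by
      refine (norm_sub_le _ _).trans ?_
      rw [Complex.norm_real, Real.norm_of_nonneg (by positivity)]
      linarith [hηc g (Or.inl hg)]
    exact (mul_le_of_le_one_left (norm_nonneg _) hc1).trans h2

/-- The net is indexed by pairs of a compact set and a natural number `n`, with tolerance `1 / (n +
1)`. -/
theorem amenable_of_hasApproximationProperty (hι : IsWideHom ι α)
    (h : α.HasApproximationProperty) : IsTopologicallyAmenable G := by
  choose η hη1 hη2 hη3 using fun i : {K : Set G // IsCompact K} × ℕ =>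
    exists_compactlySupported_coeff_near_one hι h i.1.2
      (by positivity : 0 < 1 / ((i.2 : ℝ) + 1))
  refine ⟨{K : Set G // IsCompact K} × ℕ, inferInstance, ⟨fun i j =>
    ⟨⟨⟨i.1.1 ∪ j.1.1, i.1.2.union j.1.2⟩, max i.2 j.2⟩, ?_, ?_⟩⟩,
    ⟨⟨⟨∅, isCompact_empty⟩, 0⟩⟩, η, hη1, fun i x => ?_, fun K hK => ?_⟩
  · exact ⟨Set.subset_union_left, le_max_left _ _⟩
  · exact ⟨Set.subset_union_right, le_max_right _ _⟩
  · exact Real.sqrt_le_one.2 (hη2 i x)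
  · rw [Metric.tendstoUniformlyOn_iff]
    intro ε hε
    obtain ⟨n, hn⟩ := exists_nat_one_div_lt hε
    filter_upwards [eventually_ge_atTop (⟨⟨K, hK⟩, n⟩ : {K : Set G // IsCompact K} × ℕ)] with i hi
      g hg
    rw [dist_comm, dist_eq_norm]
    refine lt_of_le_of_lt (hη3 i g (hi.1 hg)) (lt_of_le_of_lt ?_ hn)
    have : (n : ℝ) ≤ i.2 := by exact_mod_cast hi.2
    exact one_div_le_one_div_of_le (by positivity) (by linarith)

theorem amenable_iff_hasApproximationProperty (hι : IsWideHom ι α) :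
    IsTopologicallyAmenable G ↔ α.HasApproximationProperty :=
  ⟨hasApproximationProperty_of_amenable hι, amenable_of_hasApproximationProperty hι⟩

end Equivalence

/-! ### The canonical actions as wide homomorphisms. -/

section Canonical

variable {G : Type u} [TopologicalSpace G] [TopGroupoid G] [IsEtale G]

theorem natLE_of_subset {u v : Bis G} (h : v.1 ⊆ u.1) : NatLE v u :=
  ⟨v⁻¹ * v, idem_inv_mul v, eq_mul_of_subset h⟩

theorem isOpenBisection_inter {u v : Set G} (hu : IsOpenBisection u) (hv : IsOpen v) :
    IsOpenBisection (u ∩ v) :=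
  isOpenBisection_of (hu.isOpen.inter hv) (fun _ hg _ hh => hu.src_inj hg.1 hh.1)
    fun _ hg _ hh => hu.rng_inj hg.1 hh.1

theorem isWideHom_id : IsWideHom (fun u : Bis G => u) (canonicalAction G) where
  map_one := rfl
  map_mul _ _ := rfl
  map_inv _ := rfl
  act_eq _ := rfl
  cover g := by
    obtain ⟨u, hu, hg, -⟩ := exists_bisection g isOpen_univ (Set.mem_univ g)
    exact ⟨⟨u, hu⟩, hg⟩
  unit_inter u x hx := ⟨⟨u.1 ∩ (1 : Bis G).1, isOpenBisection_inter u.2 (1 : Bis G).2.isOpen⟩,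
    natLE_of_subset Set.inter_subset_left, natLE_of_subset Set.inter_subset_right, hx, x.2⟩

theorem isWideHom_canonicalActionOf {S : InverseSubsemigroup (Bis G)} (hS : IsWide S) :
    IsWideHom (fun u : S.unitize.Elem => u.1) (canonicalActionOf S) where
  map_one := rfl
  map_mul _ _ := rfl
  map_inv _ := rfl
  act_eq _ := rfl
  cover g := by
    obtain ⟨u, hu, hg⟩ := hS.1 g
    exact ⟨⟨u, Or.inr hu⟩, hg⟩
  unit_inter := by
    rintro ⟨s, rfl | hs⟩ x hx
    · exact ⟨1, natLE_of_eq rfl, natLE_of_eq rfl, x.2⟩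
    -- `G⁰` need not belong to `S`, so it cannot serve in the intersection axiom. Instead `w w*`,
    -- for some `w ∈ S` through `x`, is an element of `S` that contains `x` and consists of units.
    · obtain ⟨w, hw, hxw⟩ := hS.1 x.1
      have hwS : w * w⁻¹ ∈ S.carrier := S.mul_mem' hw (S.inv_mem w hw)
      have hxw' : x.1 ∈ (w * w⁻¹).1 := ⟨x.1, hxw, inv x.1, inv_mem_inv w hxw, (rng_inv _).symm,
        (mul_inv _).trans (rng_of_unit x.2)⟩
      obtain ⟨v, hv, hxv, hvs⟩ := hS.2 x.1 s hs _ hwS ⟨hx, hxw'⟩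
      have hv1 : v.1 ⊆ (1 : Bis G).1 := fun g hg =>
        mem_unit_of_idem (idem_mul_inv w) (hvs hg).2
      let v' : S.unitize.Elem := ⟨v, Or.inr hv⟩
      -- The order of the subsemigroup needs an idempotent from it; `v* v` is one.
      refine ⟨v', ⟨v'⁻¹ * v', idem_inv_mul v', Subtype.ext ?_⟩,
        idem_natLE_one (Subtype.ext (idem_of_subset_one hv1)), hxv⟩
      exact eq_mul_of_subset fun g hg => (hvs hg).1

/-- The inverse semigroup of all open bisections. -/
def allBisections : InverseSubsemigroup (Bis G) where
  carrier := Set.univ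
  mul_mem' _ _ := trivial
  inv_mem _ _ := trivial

theorem isWide_allBisections : IsWide (allBisections (G := G)) := by
  refine ⟨fun g => ?_, fun g u _ v _ hg => ?_⟩
  · obtain ⟨u, hu⟩ := isWideHom_id.cover g
    exact ⟨u, trivial, hu⟩
  · exact ⟨⟨u.1 ∩ v.1, isOpenBisection_inter u.2 v.2.isOpen⟩, trivial, hg, subset_rfl⟩

end Canonical

end TopGroupoid
end InvFell
end

theorem corollary4p19 {G : Type*} [TopologicalSpace G] [InvFell.TopGroupoid G]
    [LocallyCompactSpace G] [InvFell.TopGroupoid.IsEtale G]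
    [T2Space (InvFell.TopGroupoid.UnitSpace G)] :
    [InvFell.TopGroupoid.IsTopologicallyAmenable G,
      (InvFell.TopGroupoid.canonicalAction G).HasApproximationProperty,
      ∀ S : InvFell.InverseSubsemigroup (InvFell.TopGroupoid.Bis G),
        InvFell.TopGroupoid.IsWide S →
          (InvFell.TopGroupoid.canonicalActionOf S).HasApproximationProperty].TFAE ∧
    ∀ S : InvFell.InverseSubsemigroup (InvFell.TopGroupoid.Bis G),
      InvFell.TopGroupoid.IsWide S →
        (InvFell.TopGroupoid.IsTopologicallyAmenable G ↔
          (InvFell.TopGroupoid.canonicalActionOf S).HasApproximationProperty) := by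
  have key : ∀ S : InvFell.InverseSubsemigroup (InvFell.TopGroupoid.Bis G),
      InvFell.TopGroupoid.IsWide S →
        (InvFell.TopGroupoid.IsTopologicallyAmenable G ↔
          (InvFell.TopGroupoid.canonicalActionOf S).HasApproximationProperty) := fun S hS =>
    InvFell.TopGroupoid.amenable_iff_hasApproximationProperty
      (InvFell.TopGroupoid.isWideHom_canonicalActionOf hS)
  refine ⟨?_, key⟩
  tfae_have 1 ↔ 2 := InvFell.TopGroupoid.amenable_iff_hasApproximationProperty
    InvFell.TopGroupoid.isWideHom_id
  tfae_have 1 → 3 := fun h S hS => (key S hS).1 h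
  -- A single wide subsemigroup suffices, and the family of all open bisections is one.
  tfae_have 3 → 1 := fun h => (key _ InvFell.TopGroupoid.isWide_allBisections).2
    (h _ InvFell.TopGroupoid.isWide_allBisections)
  tfae_finish
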